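/- Let $d\in\{2,3\}$, let $\Omega\subset\mathbb R^d$ be a polyhedral domain, $T>0$, $\gamma,\mu_+,\mu_->0$ and $\vec f(\cdot,t):\Omega\to\mathbb R^d$. For a conforming partitioning $\mathcal T$ of $\Omega$ into finitely many disjoint open simplices let $S_k$ be the continuous functions on $\overline\Omega$ that are polynomials of degree at most $k$ on each element. Let the velocity space $\mathbb U^h\subset H^1_0(\Omega,\mathbb R^d)\cap[S_k]^d$ (for some $k$) and the pressure space $\mathbb P^h\subset L^2(\Omega)$ be linear subspaces, where $\mathbb P^h$ contains the constants, and put $\widehat{\mathbb P}^h=\{\varphi\in\mathbb P^h:\int_\Omega\varphi=0\}$. Let $\Gamma=\bigcup_{j}\overline{\sigma_j}$ be a closed polyhedral surface, i.e. a finite union of nondegenerate $(d-1)$-simplices without hanging vertices and without self-intersections, with interior $\Omega_-\subset\Omega$ and exterior $\Omega_+$ such that $\Gamma=\partial\Omega_-=\overline{\Omega_-}\cap\overline{\Omega_+}$, and let $\vec\nu$ be its piecewise constant unit normal pointing into $\Omega_+$. Let $W(\Gamma)$ and $\underline V(\Gamma)=[W(\Gamma)]^d$ be the continuous, piecewise affine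 functions on $\Gamma$, $\langle v,w\rangle_\Gamma=\int_\Gamma v\cdot w\,d\mathcal H^{d-1}$, and $\langle v,w\rangle^h_\Gamma=\frac1d\sum_j\mathcal H^{d-1}(\sigma_j)\sum_{k=1}^d(v\cdot w)((\vec q_{j_k})^-)$, where $\vec q_{j_1},\dots,\vec q_{j_d}$ are the vertices of $\sigma_j$ and $(\cdot)^-$ denotes the limit from within $\sigma_j$. Write $(\cdot,\cdot)$ for the $L^2$-inner product on $\Omega$, $D(\vec u)=\frac12(\nabla\vec u+(\nabla\vec u)^T)$, $\vec I_2$ for interpolation onto $[S_2]^d$ at the vertices and edge midpoints, and $\mu^h$ for the function equal to $\mu_-$ on elements contained in $\Omega_-$, $\mu_+$ on elements contained in $\Omega_+$, and $\frac12(\mu_-+\mu_+)$ on all other elements. Given $\Gamma$, a function $\vec Y$ on $\Gamma$ and a force $\vec g$, consider, for $\vec U\in\mathbb U^h$, $P\in\widehat{\mathbb P}^h$, $\vec X\in\underline V(\Gamma)$, $\kappa\in W(\Gamma)$, the system $$2(\mu^hD(\vec U),D(\vec\xi))-(P,\nabla\cdot\vec\xi)-\gamma\langle\kappa\vec\nu,\vec\xi\rangle_\Gamma=(\vec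 I_2\vec g,\vec\xi)\quad\forall\vec\xi\in\mathbb U^h,\qquad(\nabla\cdot\vec U,\varphi)=0\quad\forall\varphi\in\widehat{\mathbb P}^h,$$ $$\langle\vec Y,\chi\vec\nu\rangle^h_\Gamma-\langle\vec U,\chi\vec\nu\rangle_\Gamma=0\quad\forall\chi\in W(\Gamma),\qquad\langle\kappa\vec\nu,\vec\eta\rangle^h_\Gamma+\langle\nabla_s\vec X,\nabla_s\vec\eta\rangle_\Gamma=0\quad\forall\vec\eta\in\underline V(\Gamma).$$ (i) Semidiscrete scheme. Let $\Gamma^h(t)$, $t\in[0,T]$, be such surfaces with a fixed connectivity and with vertices that are continuous on $[0,T]$ and differentiable on $(0,T]$, let $\vec X^h_t\in\underline V(\Gamma^h(t))$ be the piecewise affine function whose value at each vertex is the velocity of that vertex, and suppose that for every $t\in(0,T]$ the system holds on $\Gamma=\Gamma^h(t)$ with spaces $\mathbb U^h(t),\mathbb P^h(t)$ (and their mesh), $\vec U=\vec U^h(t)$, $P=P^h(t)$, $\kappa=\kappa^h(t)$, $\vec X=\vec{\rm id}$, $\vec Y=\vec X^h_t$ and $\vec g=\vec f(\cdot,t)$.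 If $t\in(0,T]$ and $1_{\Omega_-^h(t)}\in\mathbb P^h(t)$, then $$\frac{d}{dt}\mathcal L^d(\Omega_-^h(t))=\langle\vec X^h_t,\vec\nu^h\rangle_{\Gamma^h(t)}=\langle\vec X^h_t,\vec\nu^h\rangle^h_{\Gamma^h(t)}=\langle\vec U^h,\vec\nu^h\rangle_{\Gamma^h(t)}=\int_{\Omega_-^h(t)}\nabla\cdot\vec U^h\,d\mathcal L^d=0$$ (one-sided derivative at $t=T$). If $1_{\Omega_-^h(t)}\in\mathbb P^h(t)$ for all $t\in(0,T]$, then both phase volumes $\mathcal L^d(\Omega_-^h(t))$ and $\mathcal L^d(\Omega\cap\Omega_+^h(t))$ are constant on $[0,T]$. (ii) Fully discrete scheme. Let $0=t_0<\dots<t_M=T$, $\tau_m=t_{m+1}-t_m$, and for $m=0,\dots,M-1$ let $\Gamma^m$ be such surfaces (with interior $\Omega^m_-$ and normal $\vec\nu^m$), with $\vec X^m$ the identity on $\Gamma^m$, and suppose that $(\vec U^{m+1},P^{m+1},\vec X^{m+1},\kappa^{m+1})$ solves the system on $\Gamma=\Gamma^m$ with spaces $\mathbb U^m,\mathbb P^m$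 (and their mesh), $\vec Y=(\vec X^{m+1}-\vec X^m)/\tau_m$ and $\vec g=\vec f(\cdot,t_{m+1})$, and that $\Gamma^{m+1}=\vec X^{m+1}(\Gamma^m)$. Then, for every $m\in\{0,\dots,M-1\}$ with $1_{\Omega_-^m}\in\mathbb P^m$, $$\langle\vec U^{m+1},\vec\nu^m\rangle_{\Gamma^m}=0\qquad\text{and}\qquad\langle\vec X^{m+1}-\vec X^m,\vec\nu^m\rangle_{\Gamma^m}=0.$$ -/

import Mathlib

open MeasureTheory Set Filter Topology
open scoped ContDiff

namespace TwoPhaseStokes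

/-- `ℝᵈ` with its Euclidean structure. -/
abbrev Vec (d : ℕ) := EuclideanSpace ℝ (Fin d)

/-- The `j`-th standard unit vector. -/
noncomputable abbrev unitVec {d : ℕ} (j : Fin d) : Vec d := EuclideanSpace.single j (1 : ℝ)

/-! ### Bulk mesh and bulk finite element spaces -/

/-- A conforming partitioning of `Ω` into finitely many disjoint open `d`-simplices. -/
structure BulkMesh (d : ℕ) (Ω : Set (Vec d)) where
  /-- number of elements -/
  n : ℕ
  /-- the elements; the open simplex is `(simplex j).interior` -/
  simplex : Fin n → Affine.Simplex ℝ (Vec d) d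
  subset : ∀ j, (simplex j).interior ⊆ Ω
  disjoint : ∀ i j, i ≠ j → Disjoint (simplex i).interior (simplex j).interior
  cover : ⋃ j, (simplex j).closedInterior = closure Ω
  /-- two closed elements meet in a common (possibly empty) face -/
  conforming : ∀ i j, (simplex i).closedInterior ∩ (simplex j).closedInterior =
    convexHull ℝ (range (simplex i).points ∩ range (simplex j).points)

/-- `S_k`: functions that are continuous on `Ω̄` and polynomial of degree at most `k` on every
open element. -/
def MemSk {d : ℕ} {Ω : Set (Vec d)} (mesh : BulkMesh d Ω) (k : ℕ) (g : Vec d → ℝ) : Prop :=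
  ContinuousOn g (closure Ω) ∧
  ∀ j, ∃ p : MvPolynomial (Fin d) ℝ, p.totalDegree ≤ k ∧
    ∀ x ∈ (mesh.simplex j).interior, g x = MvPolynomial.eval (fun i => x i) p

/-- `[S_k]ᵈ`. -/
def MemSkVec {d : ℕ} {Ω : Set (Vec d)} (mesh : BulkMesh d Ω) (k : ℕ) (u : Vec d → Vec d) : Prop :=
  ∀ i : Fin d, MemSk mesh k (fun x => u x i)

/-- `H¹₀(Ω; ℝᵈ)`: the closure of the smooth vector fields with compact support in `Ω` with
respect to the `H¹`-norm; `G` is the weak gradient of `u`. -/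
def MemH10 {d : ℕ} (Ω : Set (Vec d)) (u : Vec d → Vec d) : Prop :=
  MemLp u 2 (volume.restrict Ω) ∧
  ∃ G : Vec d → Vec d →L[ℝ] Vec d, MemLp G 2 (volume.restrict Ω) ∧
  ∃ φ : ℕ → Vec d → Vec d,
    (∀ n, ContDiff ℝ ∞ (φ n) ∧ HasCompactSupport (φ n) ∧ tsupport (φ n) ⊆ Ω) ∧
    Tendsto (fun n => eLpNorm (φ n - u) 2 (volume.restrict Ω)) atTop (𝓝 0) ∧
    Tendsto (fun n => eLpNorm (fderiv ℝ (φ n) - G) 2 (volume.restrict Ω)) atTop (𝓝 0)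

/-- Bulk finite element spaces: a mesh, a velocity space `𝕌ʰ ⊆ H¹₀(Ω; ℝᵈ)` of continuous
piecewise polynomial fields, and a pressure space `ℙʰ ⊆ L²(Ω)` that contains the constants. -/
structure FESpaces (d : ℕ) (Ω : Set (Vec d)) where
  mesh : BulkMesh d Ω
  /-- polynomial degree of the velocity space -/
  deg : ℕ
  U : Submodule ℝ (Vec d → Vec d)
  U_piecewise : ∀ u ∈ U, MemSkVec mesh deg u
  U_H10 : ∀ u ∈ U, MemH10 Ω u
  P : Submodule ℝ (Lp ℝ 2 (volume.restrict Ω))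
  const_mem : ∃ φ ∈ P, φ =ᵐ[volume.restrict Ω] fun _ => (1 : ℝ)

/-- The characteristic function of `A` belongs to the pressure space. -/
def FESpaces.CharMem {d : ℕ} {Ω : Set (Vec d)} (F : FESpaces d Ω) (A : Set (Vec d)) : Prop :=
  ∃ φ ∈ F.P, φ =ᵐ[volume.restrict Ω] A.indicator (fun _ => (1 : ℝ))

/-- `∇ · u`. -/
noncomputable def divergence {d : ℕ} (u : Vec d → Vec d) (x : Vec d) : ℝ :=
  ∑ i : Fin d, (fderiv ℝ u x (unitVec i)) i

/-- The entry `(i, j)` of `D(u) = ½ (∇u + (∇u)ᵀ)`. -/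
noncomputable def symGrad {d : ℕ} (u : Vec d → Vec d) (x : Vec d) (i j : Fin d) : ℝ :=
  ((fderiv ℝ u x (unitVec j)) i + (fderiv ℝ u x (unitVec i)) j) / 2

/-- `g` interpolates `f` in `[S_2]ᵈ`: it agrees with `f` at all vertices (`a = b`) and all edge
midpoints of the mesh. -/
def IsP2Interpolant {d : ℕ} {Ω : Set (Vec d)} (mesh : BulkMesh d Ω) (f g : Vec d → Vec d) : Prop :=
  MemSkVec mesh 2 g ∧
  ∀ j, ∀ a b : Fin (d + 1),
    g (midpoint ℝ ((mesh.simplex j).points a) ((mesh.simplex j).points b)) =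
      f (midpoint ℝ ((mesh.simplex j).points a) ((mesh.simplex j).points b))

/-! ### Polyhedral interfaces

An interface mesh is given by its connectivity `facet : Fin J → Fin d → Fin K` (the `d` vertex
indices of each of the `J` facets) and by the positions `q : Fin K → ℝᵈ` of its vertices. -/

section Interface

variable {d K J : ℕ} (facet : Fin J → Fin d → Fin K) (q : Fin K → Vec d)

/-- The open `(d-1)`-simplex `σ_j`. -/
def openFacet (j : Fin J) : Set (Vec d) :=
  {x | ∃ w : Fin d → ℝ, (∀ i, 0 < w i) ∧ ∑ i, w i = 1 ∧ x = ∑ i, w i • q (facet j i)}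

/-- The closed `(d-1)`-simplex. -/
def closedFacet (j : Fin J) : Set (Vec d) :=
  convexHull ℝ (range fun i => q (facet j i))

/-- `Γ`, the union of the closed facets. -/
def surface : Set (Vec d) := ⋃ j, closedFacet facet q j

/-- `Ω₋`, the interior of `Γ`: the union of the bounded components of the complement. -/
def inside : Set (Vec d) :=
  {x | x ∈ (surface facet q)ᶜ ∧
    Bornology.IsBounded (connectedComponentIn (surface facet q)ᶜ x)}

/-- `Ω₊`, the exterior of `Γ`: the union of the unbounded components of the complement. -/
def outside : Set (Vec d) :=
  {x | x ∈ (surface facet q)ᶜ ∧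
    ¬ Bornology.IsBounded (connectedComponentIn (surface facet q)ᶜ x)}

/-- `Γ` is a closed polyhedral surface without hanging vertices and without self-intersections,
which is the common boundary of its interior and its exterior, and whose interior lies in `Ω`. -/
structure IsPolyhedralInterface (Ω : Set (Vec d)) : Prop where
  nondegenerate : ∀ j, AffineIndependent ℝ fun i => q (facet j i)
  vertex_used : ∀ k, ∃ j i, facet j i = k
  disjoint : ∀ i j, i ≠ j → Disjoint (openFacet facet q i) (openFacet facet q j)
  conforming : ∀ i j, closedFacet facet q i ∩ closedFacet facet q j =
    convexHull ℝ (q '' (range (facet i) ∩ range (facet j)))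
  eq_frontier : surface facet q = frontier (inside facet q)
  eq_closure_inter : surface facet q = closure (inside facet q) ∩ closure (outside facet q)
  inside_subset : inside facet q ⊆ Ω

/-- `ν` is the piecewise constant unit normal on `Γ` that points into `Ω₊`. (Its values on the
facet boundaries, a null set, are irrelevant.) -/
def IsOuterNormal (ν : Vec d → Vec d) : Prop :=
  ∀ j, ∃ n : Vec d, ‖n‖ = 1 ∧
    (∀ i i', inner ℝ n (q (facet j i) - q (facet j i')) = 0) ∧
    ∀ x ∈ openFacet facet q j,
      ν x = n ∧ ∀ᶠ ε : ℝ in 𝓝[>] 0, x + ε • n ∈ outside facet q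

/-- `W(Γ)` (for `F = ℝ`) and `V(Γ)` (for `F = ℝᵈ`): functions that are continuous on `Γ` and
affine on each open facet. -/
def MemSurfaceP1 {F : Type*} [NormedAddCommGroup F] [NormedSpace ℝ F] (χ : Vec d → F) : Prop :=
  ContinuousOn χ (surface facet q) ∧
  ∀ j, ∃ A : Vec d →ᵃ[ℝ] F, EqOn χ A (openFacet facet q j)

/-- `⟨v, w⟩_Γ = ∫_Γ v · w dℋᵈ⁻¹`. -/
noncomputable def surfaceInner (v w : Vec d → Vec d) : ℝ :=
  ∫ x in surface facet q, inner ℝ (v x) (w x) ∂μHE[d - 1]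

/-- The mass lumped inner product
`⟨v, w⟩ʰ_Γ = (1/d) ∑_j ℋᵈ⁻¹(σ_j) ∑_k (v · w)((q_{j_k})⁻)`, where the one-sided value at a vertex is
the limit from within the open facet. -/
noncomputable def lumpedInner (v w : Vec d → Vec d) : ℝ :=
  (1 / (d : ℝ)) * ∑ j, (μHE[d - 1] : Measure (Vec d)).real (openFacet facet q j) *
    ∑ i : Fin d, limUnder (𝓝[openFacet facet q j] (q (facet j i))) fun x => inner ℝ (v x) (w x)

/-- `⟨∇ₛ v, ∇ₛ w⟩_Γ = ∫_Γ ∇ₛ v : ∇ₛ w dℋᵈ⁻¹`; the `i`-th component of the surface gradient is the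
derivative in the direction `eᵢ - (eᵢ · ν) ν`. -/
noncomputable def surfaceGradInner (ν v w : Vec d → Vec d) : ℝ :=
  ∫ x in surface facet q,
    ∑ i : Fin d,
      inner ℝ (lineDeriv ℝ v x (unitVec i - inner ℝ (unitVec i) (ν x) • ν x))
        (lineDeriv ℝ w x (unitVec i - inner ℝ (unitVec i) (ν x) • ν x))
    ∂μHE[d - 1]

open Classical in
/-- The discrete viscosity: `μ₋` on elements inside `Ω₋`, `μ₊` on elements inside `Ω₊` and
`(μ₋ + μ₊)/2` on the remaining elements, which are those that meet `Γ`. -/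
noncomputable def discreteViscosity {Ω : Set (Vec d)} (mesh : BulkMesh d Ω) (μp μm : ℝ)
    (x : Vec d) : ℝ :=
  ∑ j, (mesh.simplex j).interior.indicator
    (fun _ => if (mesh.simplex j).interior ⊆ inside facet q then μm
      else if (mesh.simplex j).interior ⊆ outside facet q then μp
      else (μm + μp) / 2) x

/-! ### The schemes -/

/-- The system of finite element equations on a given interface `Γ` with normal `ν`, for the
velocity `u`, the pressure `p`, the interface position `X ∈ V(Γ)`, the interface velocity `Y`
(a difference quotient in the fully discrete scheme, the time derivative in the semidiscrete
scheme), and the curvature `κ`; `f` is the force at the relevant time. -/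
structure SolvesSystem {Ω : Set (Vec d)} (γ μp μm : ℝ) (f : Vec d → Vec d) (F : FESpaces d Ω)
    (ν : Vec d → Vec d) (u : Vec d → Vec d) (p : Lp ℝ 2 (volume.restrict Ω))
    (X Y : Vec d → Vec d) (κ : Vec d → ℝ) : Prop where
  u_mem : u ∈ F.U
  p_mem : p ∈ F.P
  p_mean : ∫ x in Ω, p x = 0
  X_mem : MemSurfaceP1 facet q X
  κ_mem : MemSurfaceP1 facet q κ
  momentum : ∃ fh : Vec d → Vec d, IsP2Interpolant F.mesh f fh ∧ ∀ ξ ∈ F.U,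
    2 * (∫ x in Ω, discreteViscosity facet q F.mesh μp μm x *
          ∑ i, ∑ j, symGrad u x i j * symGrad ξ x i j)
      - (∫ x in Ω, p x * divergence ξ x)
      - γ * surfaceInner facet q (fun x => κ x • ν x) ξ
      = ∫ x in Ω, inner ℝ (fh x) (ξ x)
  incompressible : ∀ φ ∈ F.P, ∫ x in Ω, φ x = 0 → ∫ x in Ω, divergence u x * φ x = 0
  kinematic : ∀ χ : Vec d → ℝ, MemSurfaceP1 facet q χ →
    lumpedInner facet q Y (fun x => χ x • ν x)
      - surfaceInner facet q u (fun x => χ x • ν x) = 0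
  curvature : ∀ η : Vec d → Vec d, MemSurfaceP1 facet q η →
    lumpedInner facet q (fun x => κ x • ν x) η + surfaceGradInner facet q ν X η = 0

end Interface

/-- A solution of the semidiscrete (continuous in time) scheme on `[0, T]`. The interface `Γʰ(t)`
has the vertices `q t k`; `V t = Xʰ_t ∈ V(Γʰ(t))` is its piecewise linear velocity. -/
structure IsSemidiscreteSolution {d K J : ℕ} (Ω : Set (Vec d)) (γ μp μm T : ℝ)
    (f : ℝ → Vec d → Vec d) (facet : Fin J → Fin d → Fin K) (F : ℝ → FESpaces d Ω)
    (q : ℝ → Fin K → Vec d) (ν : ℝ → Vec d → Vec d) (V : ℝ → Vec d → Vec d)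
    (u : ℝ → Vec d → Vec d) (p : ℝ → Lp ℝ 2 (volume.restrict Ω)) (κ : ℝ → Vec d → ℝ) : Prop where
  isInterface : ∀ t ∈ Icc 0 T, IsPolyhedralInterface facet (q t) Ω
  normal : ∀ t ∈ Icc 0 T, IsOuterNormal facet (q t) (ν t)
  continuous : ∀ k, ContinuousOn (fun t => q t k) (Icc 0 T)
  V_mem : ∀ t ∈ Ioc 0 T, MemSurfaceP1 facet (q t) (V t)
  velocity : ∀ t ∈ Ioc 0 T, ∀ k, HasDerivWithinAt (fun s => q s k) (V t (q t k)) (Icc 0 T) t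
  solves : ∀ t ∈ Ioc 0 T,
    SolvesSystem facet (q t) γ μp μm (f t) (F t) (ν t) (u t) (p t) id (V t) (κ t)

/-- A solution of the fully discrete scheme for the time levels `t 0 < ⋯ < t M`. The interface
`Γᵐ` has the vertices `q m k`, and `X m`, `u m`, `p m`, `κ m` are the unknowns with superscript
`m`; `Xᵐ` itself is identified with the identity on `Γᵐ`, and `Γᵐ⁺¹ = Xᵐ⁺¹(Γᵐ)`. -/
structure IsDiscreteSolution {d K J : ℕ} (Ω : Set (Vec d)) (γ μp μm : ℝ) (M : ℕ) (t : ℕ → ℝ)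
    (f : ℝ → Vec d → Vec d) (facet : Fin J → Fin d → Fin K) (F : ℕ → FESpaces d Ω)
    (q : ℕ → Fin K → Vec d) (ν : ℕ → Vec d → Vec d) (X : ℕ → Vec d → Vec d)
    (u : ℕ → Vec d → Vec d) (p : ℕ → Lp ℝ 2 (volume.restrict Ω)) (κ : ℕ → Vec d → ℝ) : Prop where
  isInterface : ∀ m < M, IsPolyhedralInterface facet (q m) Ω
  normal : ∀ m < M, IsOuterNormal facet (q m) (ν m)
  solves : ∀ m < M,
    SolvesSystem facet (q m) γ μp μm (f (t (m + 1))) (F m) (ν m) (u (m + 1)) (p (m + 1))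
      (X (m + 1)) (fun x => (t (m + 1) - t m)⁻¹ • (X (m + 1) x - x)) (κ (m + 1))
  next : ∀ m < M, ∀ k, q (m + 1) k = X (m + 1) (q m k)

end TwoPhaseStokes

/-!
Both schemes conserve volume because the incompressibility constraint may be tested with the
characteristic function of the interior `Ω₋`, and the kinematic condition with the constant `1`.

The first test gives `∫_{Ω₋} ∇ · u = 0`: a pressure test function must have mean zero, but `∇ · u`
has mean zero over `Ω` because `u ∈ H¹₀`, so the mean of the characteristic function does not matter
(`FESpaces.setIntegral_divergence_eq_zero`). By the divergence theorem on `Ω₋` the flux of `u`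
through `Γ` vanishes (`IsPolyhedralInterface.setIntegral_divergence`), and the kinematic condition
carries this over to the lumped flux of the interface velocity, which equals the exact flux because
the trapezoidal rule is exact for affine integrands (`IsPolyhedralInterface.lumpedInner_normal`).
This settles the fully discrete scheme (`SolvesSystem.flux_eq_zero`).

The divergence theorem is proved one coordinate at a time. Almost every line parallel to the axis
crosses the facets transversally and in their relative interiors, so that its trace on `Ω₋` is
bounded by the crossing points, at which the characteristic function jumps by the sign of a
component of the normal; the fundamental theorem of calculus on the line and Fubini's theorem give
the flux (`IsPolyhedralInterface.setIntegral_inside`). A piecewise polynomial field is continuous,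
and smooth at all but countably many points of almost every line, which is enough.

In the semidiscrete scheme it remains to show that the volume of `Ω₋` has the flux of the interface
velocity as its derivative (`hasDerivWithinAt_volume_inside`). The divergence theorem for the field
`x` expresses the volume as a polynomial in the vertices, with coefficients given by the
orientations of the facets (`IsPolyhedralInterface.volume_inside`), and the orientations are locally
constant in time (`IsPolyhedralInterface.eventually_facetSign_eq`). The derivative of this
polynomial differs from the flux by a sum over the boundaries of the oriented facets, which cancels
since the oriented facets form a cycle: each vertex (`d = 2`,
`IsPolyhedralInterface.sum_vertex_eq_zero`) and each edge (`d = 3`,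
`IsPolyhedralInterface.sum_edge_eq_zero`) is met as often with one orientation as with the other.
The cycle property in turn follows from the divergence theorem, applied to divergence-free fields
that are concentrated near the vertex or the midpoint of the edge.
-/

namespace TwoPhaseStokes

/-! ### Integration over an open subset of the line -/

/-- If a function on the line has the constant value `v x` on a punctured neighbourhood of every
point `x`, then `v` is constant; the values of the function at exceptional points are irrelevant. -/
theorem eq_of_eventually_const_punctured {k : ℝ → ℝ} {v : ℝ → ℝ}
    (h : ∀ x, ∀ᶠ z in 𝓝[≠] x, k z = v x) (x y : ℝ) : v x = v y := by
  have hv : IsLocallyConstant v := by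
    refine (IsLocallyConstant.iff_eventually_eq v).2 fun x => ?_
    have h1 : ∀ᶠ y in 𝓝[≠] x, v y = v x := by
      filter_upwards [eventually_eventually_nhdsWithin.2 (h x), self_mem_nhdsWithin] with y hy hyx
      have hne : {x}ᶜ ∈ 𝓝 y := isOpen_compl_singleton.mem_nhds hyx
      rw [nhdsWithin_eq_nhds.2 hne] at hy
      obtain ⟨z, hz1, hz2⟩ := ((hy.filter_mono nhdsWithin_le_nhds).and (h y)).exists
      exact hz2.symm.trans hz1
    have := eventually_nhdsWithin_iff.1 h1
    filter_upwards [this] with y hy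
    by_cases hyx : y = x
    · rw [hyx]
    · exact hy hyx
  exact hv.apply_eq_of_isPreconnected isPreconnected_univ (mem_univ _) (mem_univ _)

/-- Fundamental theorem of calculus on a bounded open subset `S` of the line with finitely many
boundary points `c j`: the integral of `f'` over `S` is the sum of the boundary values of `f`,
weighted by the jumps `J j` of the characteristic function of `S`. -/
theorem setIntegral_eq_sum_jumps {ι : Type*} (I : Finset ι) (c J : ι → ℝ) {S : Set ℝ}
    (hS : IsOpen S) (hb : Bornology.IsBounded S) {f f' : ℝ → ℝ} (hf : ContinuousOn f (closure S))
    {N : Set ℝ} (hN : N.Countable) (hd : ∀ x ∈ S \ N, HasDerivAt f (f' x) x)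
    (hi : IntegrableOn f' S)
    (hjump : ∀ x, ∃ l r : ℝ, (∀ᶠ z in 𝓝[<] x, S.indicator (fun _ => (1 : ℝ)) z = l) ∧
      (∀ᶠ z in 𝓝[>] x, S.indicator (fun _ => (1 : ℝ)) z = r) ∧
      l - r = ∑ j ∈ I, if c j = x then J j else 0) :
    ∫ x in S, f' x = ∑ j ∈ I, J j * f (c j) := by
  set F : ℝ → ℝ := S.indicator f' with hF
  have hFi : Integrable F := (integrable_indicator_iff hS.measurableSet).2 hi
  set Φ : ℝ → ℝ := fun z => ∫ x in Iic z, F x with hΦ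
  have hΦsub : ∀ z x, Φ x - Φ z = ∫ y in z..x, F y := fun z x =>
    intervalIntegral.integral_Iic_sub_Iic hFi.integrableOn hFi.integrableOn
  -- on an interval inside `S`, the primitive `Φ` differs from `f` by a constant
  have hin : ∀ z x, z < x → Ioo z x ⊆ S → Φ x - Φ z = f x - f z := by
    intro z x hzx hsub
    rw [hΦsub]
    refine integral_eq_of_hasDerivAt_off_countable_of_le f F hzx.le hN
      (hf.mono ?_) ?_ hFi.intervalIntegrable
    · rw [← closure_Ioo hzx.ne]; exact closure_mono hsub
    · intro y hy
      rw [hF, indicator_of_mem (hsub hy.1)]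
      exact hd y ⟨hsub hy.1, hy.2⟩
  have hout : ∀ z x, z < x → (∀ y ∈ Ioo z x, y ∉ S) → Φ x - Φ z = 0 := by
    intro z x hzx hsub
    rw [hΦsub]
    have := integral_eq_of_hasDerivAt_off_countable_of_le (fun _ => (0 : ℝ)) F hzx.le
      countable_empty continuousOn_const (fun y hy => ?_) hFi.intervalIntegrable
    · simpa using this
    · rw [hF, indicator_of_notMem (hsub y hy.1)]
      exact hasDerivAt_const _ _
  set χ : ℝ → ℝ := S.indicator (fun _ => (1 : ℝ)) with hχ
  have hcomb : ∀ z x l, z < x → (∀ y ∈ Ioo z x, χ y = l) → Φ x - Φ z = l * (f x - f z) := by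
    intro z x l hzx h
    by_cases hm : (z + x) / 2 ∈ S
    · have hl : l = 1 := by
        rw [← h ((z + x) / 2) ⟨by linarith, by linarith⟩, hχ, indicator_of_mem hm]
      rw [hl, one_mul]
      refine hin z x hzx fun y hy => ?_
      by_contra hy'
      have := h y hy
      rw [hχ, indicator_of_notMem hy', hl] at this
      norm_num at this
    · have hl : l = 0 := by
        rw [← h ((z + x) / 2) ⟨by linarith, by linarith⟩, hχ, indicator_of_notMem hm]
      rw [hl, zero_mul]
      refine hout z x hzx fun y hy hy' => ?_
      have := h y hy
      rw [hχ, indicator_of_mem hy', hl] at this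
      norm_num at this
  -- `k` subtracts from the primitive `Φ` its increments on the components of `S` and the boundary
  -- values collected so far; it is locally constant away from the points where `χ` jumps, and `v`
  -- is its continuous extension to these points
  set k : ℝ → ℝ := fun z => Φ z - χ z * f z - ∑ j ∈ I, if c j < z then J j * f (c j) else 0 with hk
  choose l r hl hr hlr using hjump
  set v : ℝ → ℝ := fun x => Φ x - l x * f x - ∑ j ∈ I, if c j < x then J j * f (c j) else 0 with hv
  have hkv : ∀ x, ∀ᶠ z in 𝓝[≠] x, k z = v x := by
    intro x
    have hlt : ∀ j, ∀ᶠ z in 𝓝[<] x, (c j < z ↔ c j < x) := by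
      intro j
      rcases lt_or_ge (c j) x with h | h
      · filter_upwards [Ioo_mem_nhdsLT h] with z hz
        exact ⟨fun _ => h, fun _ => hz.1⟩
      · filter_upwards [self_mem_nhdsWithin] with z hz
        exact ⟨fun h' => h'.trans hz, fun h' => absurd h' (not_lt.2 h)⟩
    have hgt : ∀ j, ∀ᶠ z in 𝓝[>] x, (c j < z ↔ c j ≤ x) := by
      intro j
      rcases lt_or_ge x (c j) with h | h
      · filter_upwards [Ioo_mem_nhdsGT h] with z hz
        exact ⟨fun h' => absurd (h'.trans hz.2) (lt_irrefl _), fun h' => absurd h (not_lt.2 h')⟩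
      · filter_upwards [self_mem_nhdsWithin] with z hz
        exact ⟨fun h' => h, fun h' => lt_of_le_of_lt h' hz⟩
    rw [← nhdsLT_sup_nhdsGT, eventually_sup]
    constructor
    · obtain ⟨a, ha, hsub⟩ := (mem_nhdsLT_iff_exists_Ioo_subset).1 (hl x)
      filter_upwards [Ioo_mem_nhdsLT ha, (eventually_all_finset I).2 fun j _ => hlt j] with z hz hz'
      have h1 := hcomb z x (l x) hz.2 fun y hy => hsub ⟨hz.1.trans hy.1, hy.2⟩
      have h2 : χ z = l x := hsub hz
      have h3 : (∑ j ∈ I, if c j < z then J j * f (c j) else 0) =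
          ∑ j ∈ I, if c j < x then J j * f (c j) else 0 :=
        Finset.sum_congr rfl fun j hj => by simp only [hz' j hj]
      simp only [hk, hv, h2, h3]
      linarith
    · obtain ⟨a, ha, hsub⟩ := (mem_nhdsGT_iff_exists_Ioo_subset).1 (hr x)
      filter_upwards [Ioo_mem_nhdsGT ha, (eventually_all_finset I).2 fun j _ => hgt j] with z hz hz'
      have h1 := hcomb x z (r x) hz.1 fun y hy => hsub ⟨hy.1, hy.2.trans hz.2⟩
      have h2 : χ z = r x := hsub hz
      have h3 : (∑ j ∈ I, if c j < z then J j * f (c j) else 0) =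
          (∑ j ∈ I, if c j < x then J j * f (c j) else 0) +
            (∑ j ∈ I, if c j = x then J j else 0) * f x := by
        rw [Finset.sum_mul, ← Finset.sum_add_distrib]
        refine Finset.sum_congr rfl fun j hj => ?_
        simp only [hz' j hj]
        rcases lt_trichotomy (c j) x with h | h | h
        · simp [h, h.le, h.ne]
        · simp [h]
        · simp [h.not_ge, h.not_gt, h.ne']
      simp only [hk, hv, h2, h3, ← hlr x]
      linarith
  have hconst := eq_of_eventually_const_punctured hkv
  obtain ⟨R, hR⟩ := hb.exists_norm_le
  obtain ⟨B, hB⟩ := (I.finite_toSet.image c).isBounded.exists_norm_le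
  have hSR : ∀ x ∈ S, |x| ≤ R := hR
  have hcB : ∀ j ∈ I, |c j| ≤ B := fun j hj => hB _ (mem_image_of_mem c hj)
  -- far to the left everything vanishes
  have hleft : v (-(max R B) - 1) = 0 := by
    obtain ⟨z, hz, hz2⟩ := (((hkv (-(max R B) - 1)).filter_mono
      (show 𝓝[<] (-(max R B) - 1) ≤ 𝓝[≠] (-(max R B) - 1) from
        nhdsWithin_mono _ fun z hz => ne_of_lt hz)).and
        (self_mem_nhdsWithin : Iio (-(max R B) - 1) ∈ 𝓝[<] (-(max R B) - 1))).exists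
    rw [← hz]
    have hz3 : z < -(max R B) - 1 := hz2
    have hR' := le_max_left R B
    have hB' := le_max_right R B
    have hzS : ∀ y ≤ z, y ∉ S := fun y hy hyS => by
      have := abs_le.1 (hSR y hyS); linarith [this.1]
    have h1 : Φ z = 0 := by
      rw [hΦ]
      refine setIntegral_eq_zero_of_forall_eq_zero fun y hy => ?_
      rw [hF, indicator_of_notMem (hzS y hy)]
    have h2 : χ z = 0 := by rw [hχ, indicator_of_notMem (hzS z le_rfl)]
    have h3 : (∑ j ∈ I, if c j < z then J j * f (c j) else 0) = 0 :=
      Finset.sum_eq_zero fun j hj => by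
        rw [if_neg]
        have := abs_le.1 (hcB j hj); linarith [this.1]
    simp only [hk, h1, h2, h3]; ring
  have hright : v (max R B + 1) = (∫ x in S, f' x) - ∑ j ∈ I, J j * f (c j) := by
    obtain ⟨z, hz, hz2⟩ := (((hkv (max R B + 1)).filter_mono
      (show 𝓝[>] (max R B + 1) ≤ 𝓝[≠] (max R B + 1) from
        nhdsWithin_mono _ fun z hz => ne_of_gt hz)).and
        (self_mem_nhdsWithin : Ioi (max R B + 1) ∈ 𝓝[>] (max R B + 1))).exists
    rw [← hz]
    have hz3 : max R B + 1 < z := hz2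
    have hR' := le_max_left R B
    have hB' := le_max_right R B
    have hzS : ∀ y, z ≤ y → y ∉ S := fun y hy hyS => by
      have := abs_le.1 (hSR y hyS); linarith [this.2]
    have h1 : Φ z = ∫ x in S, f' x := by
      rw [hΦ]
      change ∫ x in Iic z, F x = _
      rw [hF, setIntegral_indicator hS.measurableSet, inter_eq_right.2]
      intro y hy
      by_contra hyz
      exact hzS y (le_of_lt (not_le.1 hyz)) hy
    have h2 : χ z = 0 := by rw [hχ, indicator_of_notMem (hzS z le_rfl)]
    have h3 : (∑ j ∈ I, if c j < z then J j * f (c j) else 0) = ∑ j ∈ I, J j * f (c j) :=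
      Finset.sum_congr rfl fun j hj => by
        rw [if_pos]
        have := abs_le.1 (hcB j hj); linarith [this.2]
    simp only [hk, h1, h2, h3]; ring
  have := hconst (-(max R B) - 1) (max R B + 1)
  rw [hleft, hright] at this
  linarith

/-! ### Barycentric parametrization of a facet -/

/-- The open reference simplex; a point `w` stands for the barycentric coordinates
`(1 - ∑ i, w i, w 0, …, w (n - 1))`. -/
def baryDomain (n : ℕ) : Set (Fin n → ℝ) := {w | (∀ i, 0 < w i) ∧ ∑ i, w i < 1}

/-- The closed reference simplex. -/
def closedBaryDomain (n : ℕ) : Set (Fin n → ℝ) := {w | (∀ i, 0 ≤ w i) ∧ ∑ i, w i ≤ 1}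

/-- The linear part of the parametrization of the facet with vertices `p`. -/
noncomputable def edgeMap {n d : ℕ} (p : Fin (n + 1) → Vec d) : (Fin n → ℝ) →ₗ[ℝ] Vec d :=
  Fintype.linearCombination ℝ fun k => p k.succ - p 0

/-- The affine parametrization over the reference simplex of the facet with vertices `p`. -/
noncomputable def facetMap {n d : ℕ} (p : Fin (n + 1) → Vec d) (w : Fin n → ℝ) : Vec d :=
  p 0 + edgeMap p w

theorem edgeMap_apply {n d : ℕ} (p : Fin (n + 1) → Vec d) (w : Fin n → ℝ) :
    edgeMap p w = ∑ k, w k • (p k.succ - p 0) := by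
  simp [edgeMap, Fintype.linearCombination_apply]

theorem facetMap_apply {n d : ℕ} (p : Fin (n + 1) → Vec d) (w : Fin n → ℝ) :
    facetMap p w = p 0 + ∑ k, w k • (p k.succ - p 0) := by
  rw [facetMap, edgeMap_apply]

theorem facetMap_eq_sum {n d : ℕ} (p : Fin (n + 1) → Vec d) (w : Fin n → ℝ) :
    facetMap p w = ∑ i, (Fin.cons (1 - ∑ k, w k) w : Fin (n + 1) → ℝ) i • p i := by
  rw [facetMap_apply, Fin.sum_univ_succ]
  simp only [Fin.cons_zero, Fin.cons_succ, smul_sub, Finset.sum_sub_distrib, sub_smul, one_smul,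
    Finset.sum_smul]
  abel

theorem sum_smul_eq_facetMap {n d : ℕ} (p : Fin (n + 1) → Vec d) {w : Fin (n + 1) → ℝ}
    (hw : ∑ i, w i = 1) : ∑ i, w i • p i = facetMap p (fun k => w k.succ) := by
  rw [facetMap_eq_sum]
  refine Finset.sum_congr rfl fun i _ => ?_
  rw [Fin.sum_univ_succ] at hw
  refine Fin.cases ?_ (fun k => ?_) i
  · simp only [Fin.cons_zero]; congr 1; linarith
  · simp

theorem continuous_facetMap {n d : ℕ} (p : Fin (n + 1) → Vec d) : Continuous (facetMap p) := by
  have : Continuous (edgeMap p) := (edgeMap p).continuous_of_finiteDimensional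
  unfold facetMap
  fun_prop

theorem isOpen_baryDomain (n : ℕ) : IsOpen (baryDomain n) := by
  have : baryDomain n = (⋂ i, {w : Fin n → ℝ | 0 < w i}) ∩ {w | ∑ i, w i < 1} := by
    ext w; simp [baryDomain]
  rw [this]
  refine (isOpen_iInter_of_finite fun i => ?_).inter ?_
  · exact isOpen_lt continuous_const (continuous_apply i)
  · exact isOpen_lt (by fun_prop) continuous_const

theorem baryDomain_subset_closed (n : ℕ) : baryDomain n ⊆ closedBaryDomain n :=
  fun _ hw => ⟨fun i => (hw.1 i).le, hw.2.le⟩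

theorem isCompact_closedBaryDomain (n : ℕ) : IsCompact (closedBaryDomain n) := by
  refine Metric.isCompact_of_isClosed_isBounded ?_ ?_
  · have : closedBaryDomain n = (⋂ i, {w : Fin n → ℝ | 0 ≤ w i}) ∩ {w | ∑ i, w i ≤ 1} := by
      ext w; simp [closedBaryDomain]
    rw [this]
    refine (isClosed_iInter fun i => ?_).inter ?_
    · exact isClosed_le continuous_const (continuous_apply i)
    · exact isClosed_le (by fun_prop) continuous_const
  · refine (Metric.isBounded_Icc (0 : Fin n → ℝ) 1).subset fun w hw => ⟨hw.1, fun i => ?_⟩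
    exact (Finset.single_le_sum (fun k _ => hw.1 k) (Finset.mem_univ i)).trans hw.2

theorem volume_closedBaryDomain_diff (n : ℕ) :
    volume (closedBaryDomain n \ baryDomain n) = 0 := by
  rcases Nat.eq_zero_or_pos n with rfl | hn
  · have : closedBaryDomain 0 \ baryDomain 0 = ∅ := by
      ext w; simp [closedBaryDomain, baryDomain]
    rw [this, measure_empty]
  have hsub : closedBaryDomain n \ baryDomain n ⊆
      (⋃ i, {w : Fin n → ℝ | w i = 0}) ∪ {w | ∑ i, w i = 1} := by
    rintro w ⟨⟨h1, h2⟩, h3⟩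
    by_contra hcon
    simp only [mem_union, mem_iUnion, mem_ofPred_eq, not_or, not_exists] at hcon
    exact h3 ⟨fun i => lt_of_le_of_ne (h1 i) (Ne.symm (hcon.1 i)), lt_of_le_of_ne h2 hcon.2⟩
  refine measure_mono_null hsub (measure_union_null (measure_iUnion_null fun i => ?_) ?_)
  · exact Measure.pi_hyperplane (fun _ => (volume : Measure ℝ)) i 0
  · -- the hyperplane `∑ w = 1` is a proper affine subspace
    let φ : (Fin n → ℝ) →ₗ[ℝ] ℝ := ∑ i, LinearMap.proj i
    have hφ : ∀ w, φ w = ∑ i, w i := fun w => by simp [φ]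
    let s : AffineSubspace ℝ (Fin n → ℝ) :=
      (AffineSubspace.mk' (1 : ℝ) ⊥).comap φ.toAffineMap
    have hs : (s : Set (Fin n → ℝ)) = {w | ∑ i, w i = 1} := by
      ext w
      simp [s, hφ, AffineSubspace.mem_mk', sub_eq_zero]
    rw [← hs]
    refine Measure.addHaar_affineSubspace _ _ fun htop => ?_
    have : (0 : Fin n → ℝ) ∈ (s : Set (Fin n → ℝ)) := by rw [htop]; trivial
    rw [hs] at this
    simp at this

theorem facetMap_comp_eq_affine {n d : ℕ} (p : Fin (n + 1) → Vec d) {F : Type*} [AddCommGroup F]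
    [Module ℝ F] (A : Vec d →ᵃ[ℝ] F) (w : Fin n → ℝ) :
    A (facetMap p w) = A (p 0) + ∑ k, w k • (A (p k.succ) - A (p 0)) := by
  have h : facetMap p w = edgeMap p w +ᵥ p 0 := by rw [vadd_eq_add, facetMap, add_comm]
  rw [h, A.map_vadd, edgeMap_apply, map_sum, vadd_eq_add, add_comm]
  congr 1
  refine Finset.sum_congr rfl fun k _ => ?_
  rw [map_smul, ← vsub_eq_sub (p k.succ), A.linearMap_vsub, vsub_eq_sub]

/-! ### The conormal functional -/

/-- The linear functional `v ↦ det (v, p₁ - p₀, …, pₙ - p₀)`, that is, the inner product with the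
generalized cross product of the edge vectors of the facet with vertices `p`. -/
noncomputable def conormal {n : ℕ} (p : Fin (n + 1) → Vec (n + 1)) : Vec (n + 1) →ₗ[ℝ] ℝ where
  toFun v := (Matrix.of fun a b =>
    (Fin.cons v (fun k : Fin n => p k.succ - p 0) : Fin (n + 1) → Vec (n + 1)) a b).det
  map_add' v w := by
    simp only [Matrix.det_succ_row_zero, Matrix.of_apply, Fin.cons_zero, PiLp.add_apply, mul_add,
      add_mul, Finset.sum_add_distrib]
    rfl
  map_smul' c v := by
    simp only [Matrix.det_succ_row_zero, Matrix.of_apply, Fin.cons_zero, PiLp.smul_apply,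
      smul_eq_mul, Finset.mul_sum, RingHom.id_apply]
    refine Finset.sum_congr rfl fun k _ => ?_
    have : ∀ M N : Matrix (Fin n) (Fin n) ℝ, M = N → (-1) ^ (k : ℕ) * (c * v k) * M.det =
      c * ((-1) ^ (k : ℕ) * v k * N.det) := fun M N h => by rw [h]; ring
    exact this _ _ rfl

theorem conormal_apply {n : ℕ} (p : Fin (n + 1) → Vec (n + 1)) (v : Vec (n + 1)) :
    conormal p v = (Matrix.of fun a b =>
      (Fin.cons v (fun k : Fin n => p k.succ - p 0) : Fin (n + 1) → Vec (n + 1)) a b).det := rfl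

theorem conormal_edge {n : ℕ} (p : Fin (n + 1) → Vec (n + 1)) (k : Fin n) :
    conormal p (p k.succ - p 0) = 0 := by
  rw [conormal_apply]
  refine Matrix.det_zero_of_row_eq (Fin.succ_ne_zero k).symm ?_
  ext b
  simp [Matrix.of_apply]

theorem conormal_edgeMap {n : ℕ} (p : Fin (n + 1) → Vec (n + 1)) (w : Fin n → ℝ) :
    conormal p (edgeMap p w) = 0 := by
  rw [edgeMap_apply, map_sum]
  refine Finset.sum_eq_zero fun k _ => ?_
  rw [map_smul, conormal_edge, smul_zero]

theorem linearIndependent_edges {n d : ℕ} {p : Fin (n + 1) → Vec d} (hp : AffineIndependent ℝ p) :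
    LinearIndependent ℝ fun k : Fin n => p k.succ - p 0 := by
  have h := (affineIndependent_iff_linearIndependent_vsub ℝ p 0).1 hp
  exact h.comp (fun k : Fin n => ⟨k.succ, Fin.succ_ne_zero k⟩) fun a b hab => by
    simpa using hab

theorem edgeMap_injective {n d : ℕ} {p : Fin (n + 1) → Vec d} (hp : AffineIndependent ℝ p) :
    Function.Injective (edgeMap p) :=
  (linearIndependent_edges hp).fintypeLinearCombination_injective

theorem facetMap_injective {n d : ℕ} {p : Fin (n + 1) → Vec d} (hp : AffineIndependent ℝ p) :
    Function.Injective (facetMap p) := fun _ _ h => edgeMap_injective hp (add_left_cancel h)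

/-- A vector normal to a nondegenerate facet determines its conormal functional. -/
theorem conormal_eq_mul_inner {n : ℕ} {p : Fin (n + 1) → Vec (n + 1)}
    (hp : AffineIndependent ℝ p) {ν : Vec (n + 1)} (hν : ‖ν‖ = 1)
    (horth : ∀ i i', inner ℝ ν (p i - p i') = 0) (v : Vec (n + 1)) :
    conormal p v = conormal p ν * inner ℝ ν v := by
  set E : Submodule ℝ (Vec (n + 1)) := Submodule.span ℝ (range fun k : Fin n => p k.succ - p 0)
  have hE : E = (ℝ ∙ ν)ᗮ := by
    refine Submodule.eq_of_le_of_finrank_eq ?_ ?_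
    · refine Submodule.span_le.2 ?_
      rintro _ ⟨k, rfl⟩
      exact Submodule.mem_orthogonal_singleton_iff_inner_right.2 (horth _ _)
    · have h1 : Module.finrank ℝ E = n := by
        have := finrank_span_eq_card (linearIndependent_edges hp)
        simpa using this
      have hν0 : ν ≠ 0 := fun h => by simp [h] at hν
      have : Fact (Module.finrank ℝ (Vec (n + 1)) = n + 1) := ⟨by simp⟩
      exact h1.trans (Submodule.finrank_orthogonal_span_singleton (n := n) hν0).symm
  have hker : ∀ x ∈ E, conormal p x = 0 := by
    intro x hx
    have : E ≤ LinearMap.ker (conormal p) := by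
      refine Submodule.span_le.2 ?_
      rintro _ ⟨k, rfl⟩
      exact conormal_edge p k
    exact this hx
  have hmem : v - inner ℝ ν v • ν ∈ E := by
    rw [hE, Submodule.mem_orthogonal_singleton_iff_inner_right, inner_sub_right, inner_smul_right,
      real_inner_self_eq_norm_sq, hν]
    ring
  have := hker _ hmem
  rw [map_sub, map_smul, sub_eq_zero, smul_eq_mul] at this
  rw [this, mul_comm]

/-- The conormal functional of a unit normal is, up to sign, the ratio of the areas of the facet and
of the reference simplex. -/
theorem abs_conormal_eq_normDet {n : ℕ} (p : Fin (n + 1) → Vec (n + 1)) {ν : Vec (n + 1)}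
    (hν : ‖ν‖ = 1) (horth : ∀ i i', inner ℝ ν (p i - p i') = 0) :
    |conormal p ν| = (edgeMap p ∘ₗ (WithLp.linearEquiv 2 ℝ (Fin n → ℝ)).toLinearMap :
      EuclideanSpace ℝ (Fin n) →ₗ[ℝ] Vec (n + 1)).normDet := by
  set f : EuclideanSpace ℝ (Fin n) →ₗ[ℝ] Vec (n + 1) :=
    edgeMap p ∘ₗ (WithLp.linearEquiv 2 ℝ (Fin n → ℝ)).toLinearMap
  rw [← sq_eq_sq₀ (abs_nonneg _) f.normDet_nonneg, sq_abs]
  have h := f.normDet_sq_eq_det_gram (EuclideanSpace.basisFun (Fin n) ℝ)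
  simp only [RCLike.ofReal_real_eq_id, id_eq] at h
  rw [h]
  have hfe : ∀ k, f (EuclideanSpace.basisFun (Fin n) ℝ k) = p k.succ - p 0 := by
    intro k
    simp [f, edgeMap_apply, Pi.single_apply]
  set M : Matrix (Fin (n + 1)) (Fin (n + 1)) ℝ := Matrix.of fun a b =>
    (Fin.cons ν (fun k : Fin n => p k.succ - p 0) : Fin (n + 1) → Vec (n + 1)) a b
  have hM : conormal p ν = M.det := rfl
  rw [hM, sq]
  nth_rewrite 2 [← Matrix.det_transpose]
  rw [← Matrix.det_mul]
  have hMM : ∀ a b, (M * M.transpose) a b =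
      inner ℝ ((Fin.cons ν (fun k : Fin n => p k.succ - p 0) : Fin (n + 1) → Vec (n + 1)) a)
        ((Fin.cons ν (fun k : Fin n => p k.succ - p 0) : Fin (n + 1) → Vec (n + 1)) b) := by
    intro a b
    simp [M, Matrix.mul_apply, PiLp.inner_apply, mul_comm]
  rw [Matrix.det_succ_row_zero, Fin.sum_univ_succ]
  have h0 : ∀ k : Fin n, (M * M.transpose) 0 k.succ = 0 := by
    intro k; rw [hMM]; simp [horth]
  have h00 : (M * M.transpose) 0 0 = 1 := by
    rw [hMM]; simp [hν]
  simp only [h0, h00, mul_zero, zero_mul, Finset.sum_const_zero, add_zero]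
  simp only [Fin.val_zero, pow_zero, one_mul]
  congr 1
  ext a b
  rw [Matrix.submatrix_apply, hMM, Matrix.gram_apply, hfe, hfe]
  simp

theorem conormal_ne_zero {n : ℕ} {p : Fin (n + 1) → Vec (n + 1)} (hp : AffineIndependent ℝ p)
    {ν : Vec (n + 1)} (hν : ‖ν‖ = 1) (horth : ∀ i i', inner ℝ ν (p i - p i') = 0) :
    conormal p ν ≠ 0 := by
  rw [← abs_pos, abs_conormal_eq_normDet p hν horth]
  refine lt_of_le_of_ne (LinearMap.normDet_nonneg _) (Ne.symm fun h => ?_)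
  rw [LinearMap.normDet_eq_zero_iff_ker_ne_bot] at h
  refine h (LinearMap.ker_eq_bot.2 ?_)
  rw [LinearMap.coe_comp]
  exact (edgeMap_injective hp).comp (WithLp.linearEquiv 2 ℝ (Fin n → ℝ)).injective

/-- Area formula for a facet, on the level of measures. -/
theorem hausdorff_facetMap_image {n : ℕ} (p : Fin (n + 1) → Vec (n + 1)) {ν : Vec (n + 1)}
    (hν : ‖ν‖ = 1) (horth : ∀ i i', inner ℝ ν (p i - p i') = 0) (s : Set (Fin n → ℝ)) :
    (μHE[n] : Measure (Vec (n + 1))) (facetMap p '' s) =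
      ENNReal.ofReal |conormal p ν| * volume s := by
  set f : EuclideanSpace ℝ (Fin n) →ₗ[ℝ] Vec (n + 1) :=
    edgeMap p ∘ₗ (WithLp.linearEquiv 2 ℝ (Fin n → ℝ)).toLinearMap with hf
  set s' : Set (EuclideanSpace ℝ (Fin n)) := WithLp.toLp 2 '' s
  have h1 : facetMap p '' s = (IsometryEquiv.addLeft (p 0)) '' (f '' s') := by
    simp only [s', image_image]
    rfl
  rw [h1, (IsometryEquiv.addLeft (p 0)).isometry.euclideanHausdorffMeasure_image,
    abs_conormal_eq_normDet p hν horth]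
  have h2 := f.euclideanHausdorffMeasure_image_eq_normDet_mul_volume s'
  rw [finrank_euclideanSpace_fin] at h2
  rw [h2]
  congr 1
  have h3 : s' = (MeasurableEquiv.toLp 2 (Fin n → ℝ)).symm ⁻¹' s := by
    rw [← MeasurableEquiv.image_eq_preimage_symm]; rfl
  rw [h3]
  exact ((PiLp.volume_preserving_ofLp (Fin n)).measure_preimage_equiv
    (f := (MeasurableEquiv.toLp 2 (Fin n → ℝ)).symm) s)

/-- Area formula for a facet. -/
theorem setIntegral_facetMap_image {n : ℕ} {p : Fin (n + 1) → Vec (n + 1)}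
    (hp : AffineIndependent ℝ p) {ν : Vec (n + 1)} (hν : ‖ν‖ = 1)
    (horth : ∀ i i', inner ℝ ν (p i - p i') = 0) (s : Set (Fin n → ℝ))
    (g : Vec (n + 1) → ℝ) :
    ∫ x in facetMap p '' s, g x ∂(μHE[n] : Measure (Vec (n + 1))) =
      |conormal p ν| * ∫ w in s, g (facetMap p w) := by
  have hemb : MeasurableEmbedding (facetMap p) :=
    (continuous_facetMap p).measurableEmbedding (facetMap_injective hp)
  have hmeas : (μHE[n] : Measure (Vec (n + 1))).restrict (facetMap p '' s) =
      ENNReal.ofReal |conormal p ν| • (volume.restrict s).map (facetMap p) := by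
    ext t ht
    rw [Measure.restrict_apply ht, Measure.smul_apply, Measure.map_apply hemb.measurable ht,
      Measure.restrict_apply (hemb.measurable ht), smul_eq_mul,
      ← hausdorff_facetMap_image p hν horth]
    congr 1
    rw [inter_comm, ← image_inter_preimage, inter_comm]
  rw [hmeas, integral_smul_measure, hemb.integral_map, ENNReal.toReal_ofReal (abs_nonneg _),
    smul_eq_mul]

theorem openFacet_eq_image {n K J : ℕ} (facet : Fin J → Fin (n + 1) → Fin K)
    (q : Fin K → Vec (n + 1)) (j : Fin J) :
    openFacet facet q j = facetMap (fun i => q (facet j i)) '' baryDomain n := by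
  ext x
  constructor
  · rintro ⟨w, hw, hsum, rfl⟩
    refine ⟨fun k => w k.succ, ⟨fun k => hw _, ?_⟩, (sum_smul_eq_facetMap _ hsum).symm⟩
    rw [Fin.sum_univ_succ] at hsum
    linarith [hw 0]
  · rintro ⟨w, ⟨hw, hsum⟩, rfl⟩
    refine ⟨Fin.cons (1 - ∑ k, w k) w, fun i => ?_, ?_, facetMap_eq_sum _ _⟩
    · refine Fin.cases ?_ (fun k => ?_) i
      · simpa using hsum
      · simpa using hw k
    · rw [Fin.sum_univ_succ]; simp

theorem convexHull_range_eq_image {n d : ℕ} (p : Fin (n + 1) → Vec d) :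
    convexHull ℝ (range p) = facetMap p '' closedBaryDomain n := by
  have h : convexHull ℝ (range p) =
      Fintype.linearCombination ℝ p '' stdSimplex ℝ (Fin (n + 1)) := by
    classical
    rw [← convexHull_basis_eq_stdSimplex, LinearMap.image_convexHull, ← range_comp]
    congr 2
    ext1 i
    simp [Fintype.linearCombination_apply]
  rw [h]
  ext x
  constructor
  · rintro ⟨w, ⟨hw, hsum⟩, rfl⟩
    refine ⟨fun k => w k.succ, ⟨fun k => hw _, ?_⟩, ?_⟩
    · rw [Fin.sum_univ_succ] at hsum
      linarith [hw 0]
    · rw [Fintype.linearCombination_apply, sum_smul_eq_facetMap _ hsum]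
  · rintro ⟨w, ⟨hw, hsum⟩, rfl⟩
    refine ⟨Fin.cons (1 - ∑ k, w k) w, ⟨fun i => ?_, ?_⟩, ?_⟩
    rotate_left 2
    · rw [Fintype.linearCombination_apply, facetMap_eq_sum]
    · refine Fin.cases ?_ (fun k => ?_) i
      · simpa using hsum
      · simpa using hw k
    · rw [Fin.sum_univ_succ]; simp

/-! ### Means over the reference simplex -/

theorem integrableOn_baryDomain {n : ℕ} {g : (Fin n → ℝ) → ℝ}
    (hg : ContinuousOn g (closedBaryDomain n)) : IntegrableOn g (baryDomain n) :=
  (hg.integrableOn_compact (isCompact_closedBaryDomain n)).mono_set (baryDomain_subset_closed n)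

theorem integrable_const_baryDomain (n : ℕ) (c : ℝ) :
    Integrable (fun _ : Fin n → ℝ => c) (volume.restrict (baryDomain n)) :=
  integrableOn_baryDomain continuousOn_const

/-- The barycentric coordinates have equal integrals over the reference simplex: the affine
involution that exchanges the vertex `0` and the vertex `k + 1` preserves the measure. -/
theorem integral_baryDomain_coord_eq {n : ℕ} (k : Fin n) :
    ∫ w in baryDomain n, w k = ∫ w in baryDomain n, (1 - ∑ i, w i) := by
  classical
  let L : (Fin n → ℝ) →L[ℝ] (Fin n → ℝ) :=
    ContinuousLinearMap.id ℝ _ -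
      (ContinuousLinearMap.proj (R := ℝ) (φ := fun _ : Fin n => ℝ) k
        + ∑ i, ContinuousLinearMap.proj (R := ℝ) (φ := fun _ : Fin n => ℝ) i).smulRight
          (Pi.single k (1 : ℝ))
  have hL : ∀ w, L w = w - (w k + ∑ i, w i) • Pi.single k (1 : ℝ) := fun w => by
    simp [L]
  let S : (Fin n → ℝ) → (Fin n → ℝ) := fun w => Pi.single k 1 + L w
  have hSk : ∀ w, S w k = 1 - ∑ i, w i := fun w => by simp [S, hL]; ring
  have hSne : ∀ w i, i ≠ k → S w i = w i := fun w i hi => by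
    simp [S, hL, hi]
  have hLL : L.comp L = ContinuousLinearMap.id ℝ _ := by
    ext1 w
    ext i
    have hs : ∑ i, L w i = - w k := by
      simp only [hL, Pi.sub_apply, Finset.sum_sub_distrib, Pi.smul_apply, smul_eq_mul,
        ← Finset.mul_sum, Finset.sum_pi_single', Finset.mem_univ, if_true]
      ring
    have hk : L w k = - ∑ i, w i := by simp [hL]
    rw [ContinuousLinearMap.comp_apply, hL (L w), hs, hk, hL w]
    simp
    ring
  have hdet : |L.det| = 1 := by
    have h1 : L.det * L.det = 1 := by
      have : (L.comp L).det = 1 := by rw [hLL]; simp [ContinuousLinearMap.det]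
      rw [← this]
      simp [ContinuousLinearMap.det, LinearMap.det_comp]
    have h2 : |L.det| * |L.det| = 1 := by rw [← abs_mul, h1, abs_one]
    nlinarith [abs_nonneg L.det]
  have hSsum : ∀ w, ∑ i, S w i = 1 - w k := by
    intro w
    rw [← Finset.sum_erase_add _ _ (Finset.mem_univ k), hSk,
      ← Finset.sum_erase_add _ w (Finset.mem_univ k),
      Finset.sum_congr rfl fun i hi => hSne w i (Finset.ne_of_mem_erase hi)]
    ring
  have hSS : ∀ w, S (S w) = w := by
    intro w
    ext i
    by_cases hi : i = k
    · subst hi; rw [hSk, hSsum]; ring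
    · rw [hSne _ _ hi, hSne _ _ hi]
  have hmaps : ∀ w ∈ baryDomain n, S w ∈ baryDomain n := by
    rintro w ⟨h1, h2⟩
    refine ⟨fun i => ?_, ?_⟩
    · by_cases hi : i = k
      · subst hi; rw [hSk]; linarith
      · rw [hSne _ _ hi]; exact h1 i
    · rw [hSsum]; linarith [h1 k]
  have himg : S '' baryDomain n = baryDomain n := by
    refine Subset.antisymm (image_subset_iff.2 hmaps) fun w hw => ⟨S w, hmaps w hw, hSS w⟩
  have hchg := integral_image_eq_integral_abs_det_fderiv_smul volume
    (isOpen_baryDomain n).measurableSet (f := S) (f' := fun _ => L)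
    (fun x _ => (L.hasFDerivAt.const_add _).hasFDerivWithinAt)
    (fun x _ y _ h => by rw [← hSS x, h, hSS]) (fun w => w k)
  rw [himg] at hchg
  rw [hchg]
  refine setIntegral_congr_fun (isOpen_baryDomain n).measurableSet fun w _ => ?_
  simp only [hdet, hSk, one_smul]

theorem integral_baryDomain_coord {n : ℕ} (k : Fin n) :
    ∫ w in baryDomain n, w k = volume.real (baryDomain n) / (n + 1) := by
  have hint : ∀ i : Fin n, IntegrableOn (fun w : Fin n → ℝ => w i) (baryDomain n) := fun i =>
    integrableOn_baryDomain (continuous_apply i).continuousOn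
  have h : ∀ i : Fin n, ∫ w in baryDomain n, w i = ∫ w in baryDomain n, w k := fun i => by
    rw [integral_baryDomain_coord_eq, integral_baryDomain_coord_eq]
  have h2 := integral_baryDomain_coord_eq k
  rw [integral_sub (integrable_const_baryDomain n 1)
    (integrable_finsetSum _ fun i _ => hint i), integral_finsetSum _ fun i _ => hint i,
    Finset.sum_congr rfl fun i _ => h i] at h2
  simp only [integral_const, smul_eq_mul, mul_one, Finset.sum_const, Finset.card_univ,
    Fintype.card_fin, nsmul_eq_mul, measureReal_restrict_apply_univ] at h2
  have hn : (n : ℝ) + 1 ≠ 0 := by positivity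
  field_simp
  linarith

/-- The integral of an affine function over a facet is determined by the mean of its vertex
values. -/
theorem integral_affine_facetMap {n d : ℕ} (p : Fin (n + 1) → Vec d) (A : Vec d →ᵃ[ℝ] ℝ) :
    ∫ w in baryDomain n, A (facetMap p w) =
      volume.real (baryDomain n) / (n + 1) * ∑ i, A (p i) := by
  have hint : ∀ i : Fin n, IntegrableOn (fun w : Fin n → ℝ => w i * (A (p i.succ) - A (p 0)))
      (baryDomain n) := fun i =>
    integrableOn_baryDomain (((continuous_apply i).mul continuous_const).continuousOn)
  simp only [facetMap_comp_eq_affine, smul_eq_mul]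
  rw [integral_add (integrable_const_baryDomain n _)
    (integrable_finsetSum _ fun i _ => hint i), integral_finsetSum _ fun i _ => hint i]
  simp only [integral_mul_const, integral_baryDomain_coord, integral_const, smul_eq_mul,
    measureReal_restrict_apply_univ]
  rw [← Finset.mul_sum, Finset.sum_sub_distrib, Fin.sum_univ_succ (f := fun i => A (p i))]
  simp only [Finset.sum_const, Finset.card_univ, Fintype.card_fin, nsmul_eq_mul]
  have hn : (n : ℝ) + 1 ≠ 0 := by positivity
  field_simp
  ring

/-! ### Lines parallel to a coordinate axis -/

/-- The point of `ℝⁿ⁺¹` with `i`-th coordinate `s` and remaining coordinates `y`. -/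
def linePt {n : ℕ} (i : Fin (n + 1)) (y : Fin n → ℝ) (s : ℝ) : Vec (n + 1) :=
  WithLp.toLp 2 (i.insertNth s y)

/-- The projection of `ℝⁿ⁺¹` along the `i`-th coordinate axis. -/
def dropCoord {n : ℕ} (i : Fin (n + 1)) : Vec (n + 1) →ₗ[ℝ] (Fin n → ℝ) where
  toFun x k := x (i.succAbove k)
  map_add' _ _ := rfl
  map_smul' _ _ := rfl

theorem dropCoord_apply {n : ℕ} (i : Fin (n + 1)) (x : Vec (n + 1)) (k : Fin n) :
    dropCoord i x k = x (i.succAbove k) := rfl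

@[simp] theorem linePt_same {n : ℕ} (i : Fin (n + 1)) (y : Fin n → ℝ) (s : ℝ) :
    linePt i y s i = s := by simp [linePt]

@[simp] theorem dropCoord_linePt {n : ℕ} (i : Fin (n + 1)) (y : Fin n → ℝ) (s : ℝ) :
    dropCoord i (linePt i y s) = y := by
  ext k; simp [linePt, dropCoord_apply]

theorem linePt_dropCoord {n : ℕ} (i : Fin (n + 1)) (x : Vec (n + 1)) :
    linePt i (dropCoord i x) (x i) = x := by
  ext k
  refine Fin.succAboveCases i ?_ (fun k => ?_) k
  · simp
  · simp [linePt, dropCoord_apply]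

theorem linePt_eq_add {n : ℕ} (i : Fin (n + 1)) (y : Fin n → ℝ) (s t : ℝ) :
    linePt i y s = linePt i y t + (s - t) • unitVec i := by
  ext k
  refine Fin.succAboveCases i ?_ (fun k => ?_) k
  · simp
  · simp [linePt]

theorem continuous_linePt {n : ℕ} (i : Fin (n + 1)) (y : Fin n → ℝ) : Continuous (linePt i y) := by
  have : linePt i y = fun s => linePt i y 0 + (s - 0) • unitVec i := by
    ext1 s; exact linePt_eq_add i y s 0
  rw [this]
  fun_prop

theorem hasDerivAt_linePt {n : ℕ} (i : Fin (n + 1)) (y : Fin n → ℝ) (s : ℝ) :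
    HasDerivAt (linePt i y) (unitVec i) s := by
  have : linePt i y = fun s => linePt i y 0 + (s - 0) • unitVec i := by
    ext1 s; exact linePt_eq_add i y s 0
  rw [this]
  simpa using (((hasDerivAt_id s).sub_const 0).smul_const (unitVec i)).const_add (linePt i y 0)

theorem isometry_linePt {n : ℕ} (i : Fin (n + 1)) (y : Fin n → ℝ) : Isometry (linePt i y) := by
  refine Isometry.of_dist_eq fun s t => ?_
  rw [linePt_eq_add i y s t, dist_eq_norm, add_sub_cancel_left, norm_smul]
  simp [Real.dist_eq]

theorem measurePreserving_linePt {n : ℕ} (i : Fin (n + 1)) :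
    MeasurePreserving (fun z : ℝ × (Fin n → ℝ) => linePt i z.2 z.1) := by
  have h1 := (volume_preserving_piFinSuccAbove (fun _ : Fin (n + 1) => ℝ) i).symm
  exact (PiLp.volume_preserving_toLp (Fin (n + 1))).comp h1

theorem measurableEmbedding_linePt {n : ℕ} (i : Fin (n + 1)) :
    MeasurableEmbedding (fun z : ℝ × (Fin n → ℝ) => linePt i z.2 z.1) :=
  (MeasurableEquiv.toLp 2 (Fin (n + 1) → ℝ)).measurableEmbedding.comp
    (MeasurableEquiv.piFinSuccAbove (fun _ : Fin (n + 1) => ℝ) i).symm.measurableEmbedding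

theorem integral_eq_integral_linePt {n : ℕ} (i : Fin (n + 1)) {g : Vec (n + 1) → ℝ}
    (hg : Integrable g) : ∫ x, g x = ∫ y, ∫ s, g (linePt i y s) := by
  rw [← (measurePreserving_linePt i).integral_comp (measurableEmbedding_linePt i)]
  have hg' := ((measurePreserving_linePt i).integrable_comp_emb
    (measurableEmbedding_linePt i)).2 hg
  exact integral_prod_symm _ hg'

theorem ae_integrable_linePt {n : ℕ} (i : Fin (n + 1)) {g : Vec (n + 1) → ℝ}
    (hg : Integrable g) : ∀ᵐ y, Integrable fun s => g (linePt i y s) := by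
  have hg' := ((measurePreserving_linePt i).integrable_comp_emb
    (measurableEmbedding_linePt i)).2 hg
  exact hg'.prod_left_ae

/-! ### Projection of a facet along a coordinate axis -/

/-- The projection along an axis scales areas on a facet by the corresponding component of the
conormal. -/
theorem abs_det_dropCoord_edgeMap {n : ℕ} (p : Fin (n + 1) → Vec (n + 1)) (i : Fin (n + 1)) :
    |LinearMap.det (dropCoord i ∘ₗ edgeMap p)| = |conormal p (unitVec i)| := by
  have h : dropCoord i ∘ₗ edgeMap p =
      Matrix.toLin' (Matrix.of fun a k : Fin n => (p k.succ - p 0) (i.succAbove a)) := by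
    refine LinearMap.ext fun w => ?_
    ext a
    simp [dropCoord_apply, edgeMap_apply, Matrix.mulVec, dotProduct, mul_comm]
  rw [h, LinearMap.det_toLin', ← Matrix.det_transpose, conormal_apply, Matrix.det_succ_row_zero,
    Finset.sum_eq_single i]
  · simp only [Matrix.of_apply, Fin.cons_zero, abs_mul, abs_pow, abs_neg, abs_one, one_pow, one_mul]
    rw [PiLp.single_apply, if_pos rfl, abs_one, one_mul]
    congr 2
  · intro b _ hb
    simp [Matrix.of_apply, hb]
  · simp

theorem hasFDerivAt_dropCoord_facetMap {n : ℕ} (p : Fin (n + 1) → Vec (n + 1)) (i : Fin (n + 1))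
    (w : Fin n → ℝ) : HasFDerivAt (fun w => dropCoord i (facetMap p w))
      (LinearMap.toContinuousLinearMap (dropCoord i ∘ₗ edgeMap p)) w := by
  have h : (fun w => dropCoord i (facetMap p w)) = fun w => dropCoord i (p 0) +
      LinearMap.toContinuousLinearMap (dropCoord i ∘ₗ edgeMap p) w := by
    ext1 w; simp [facetMap]
  rw [h]
  exact (ContinuousLinearMap.hasFDerivAt _).const_add _

/-- The height above `y`, in the direction of the `i`-th axis, of the hyperplane through a facet
that is not parallel to this axis, that is, `conormal p (unitVec i) ≠ 0`. -/
noncomputable def facetHeight {n : ℕ} (p : Fin (n + 1) → Vec (n + 1)) (i : Fin (n + 1))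
    (y : Fin n → ℝ) : ℝ :=
  -conormal p (linePt i y 0 - p 0) / conormal p (unitVec i)

theorem facetMap_coord_eq_height {n : ℕ} (p : Fin (n + 1) → Vec (n + 1)) {i : Fin (n + 1)}
    (hi : conormal p (unitVec i) ≠ 0) (w : Fin n → ℝ) :
    facetMap p w i = facetHeight p i (dropCoord i (facetMap p w)) := by
  have h1 : conormal p (facetMap p w - p 0) = 0 := by
    rw [facetMap, add_sub_cancel_left, conormal_edgeMap]
  rw [← linePt_dropCoord i (facetMap p w), linePt_eq_add i _ _ 0, sub_zero, add_sub_right_comm,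
    map_add, map_smul, smul_eq_mul] at h1
  rw [facetHeight, eq_div_iff hi]
  linarith

theorem linePt_facetHeight {n : ℕ} (p : Fin (n + 1) → Vec (n + 1)) {i : Fin (n + 1)}
    (hi : conormal p (unitVec i) ≠ 0) (w : Fin n → ℝ) :
    linePt i (dropCoord i (facetMap p w)) (facetHeight p i (dropCoord i (facetMap p w))) =
      facetMap p w := by
  rw [← facetMap_coord_eq_height p hi, linePt_dropCoord]

theorem ae_linePt_notMem_of_null {n : ℕ} (p : Fin (n + 1) → Vec (n + 1)) (i : Fin (n + 1))
    {D : Set (Fin n → ℝ)} (hD : volume D = 0) :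
    ∀ᵐ y, ∀ s, linePt i y s ∉ facetMap p '' D := by
  have h : volume ((fun w => dropCoord i (facetMap p w)) '' D) = 0 :=
    addHaar_image_eq_zero_of_differentiableOn_of_addHaar_eq_zero _
      (fun w _ => (hasFDerivAt_dropCoord_facetMap p i w).differentiableAt.differentiableWithinAt) hD
  filter_upwards [measure_eq_zero_iff_ae_notMem.1 h] with y hy s hs
  obtain ⟨w, hw, hws⟩ := hs
  exact hy ⟨w, hw, by simp only [hws, dropCoord_linePt]⟩

/-- Almost every line parallel to an axis misses the facets that are parallel to this axis, as these
have null projections. -/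
theorem ae_linePt_notMem_of_parallel {n : ℕ} (p : Fin (n + 1) → Vec (n + 1)) {i : Fin (n + 1)}
    (hi : conormal p (unitVec i) = 0) : ∀ᵐ y, ∀ s w, linePt i y s ≠ facetMap p w := by
  have hdet : (LinearMap.toContinuousLinearMap (dropCoord i ∘ₗ edgeMap p)).det = 0 := by
    have := abs_det_dropCoord_edgeMap p i
    rw [hi, abs_zero, abs_eq_zero] at this
    exact this
  have h : volume ((fun w => dropCoord i (facetMap p w)) '' univ) = 0 :=
    addHaar_image_eq_zero_of_det_fderivWithin_eq_zero _
      (fun w _ => (hasFDerivAt_dropCoord_facetMap p i w).hasFDerivWithinAt) fun _ _ => hdet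
  filter_upwards [measure_eq_zero_iff_ae_notMem.1 h] with y hy s w hs
  exact hy ⟨w, mem_univ _, by simp only [← hs, dropCoord_linePt]⟩

/-- Almost every line parallel to an axis meets a facet in at most one point. -/
theorem ae_linePt_subsingleton {n : ℕ} (p : Fin (n + 1) → Vec (n + 1)) (i : Fin (n + 1)) :
    ∀ᵐ y, {s | linePt i y s ∈ convexHull ℝ (range p)}.Subsingleton := by
  rw [convexHull_range_eq_image]
  by_cases hi : conormal p (unitVec i) = 0
  · filter_upwards [ae_linePt_notMem_of_parallel p hi] with y hy s hs
    obtain ⟨w, -, hw⟩ := hs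
    exact absurd hw.symm (hy s w)
  · refine Eventually.of_forall fun y s hs t ht => ?_
    have key : ∀ s, linePt i y s ∈ facetMap p '' closedBaryDomain n → s = facetHeight p i y := by
      rintro s ⟨w, -, hw⟩
      have := facetMap_coord_eq_height p hi w
      rwa [hw, dropCoord_linePt, linePt_same] at this
    exact (key s hs).trans (key t ht).symm

theorem dropCoord_facetMap_injective {n : ℕ} (p : Fin (n + 1) → Vec (n + 1)) {i : Fin (n + 1)}
    (hi : conormal p (unitVec i) ≠ 0) :
    Function.Injective fun w => dropCoord i (facetMap p w) := by
  have hdet : LinearMap.det (dropCoord i ∘ₗ edgeMap p) ≠ 0 := by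
    rw [← abs_ne_zero, abs_det_dropCoord_edgeMap]; exact abs_ne_zero.2 hi
  have hinj : Function.Injective (dropCoord i ∘ₗ edgeMap p) :=
    ((LinearMap.equivOfDetNeZero _ hdet).injective)
  intro w w' h
  simp only [facetMap, map_add] at h
  exact hinj (add_left_cancel h)

/-- The part of the coordinate hyperplane that lies under a facet. -/
def facetShadow {n : ℕ} (p : Fin (n + 1) → Vec (n + 1)) (i : Fin (n + 1)) : Set (Fin n → ℝ) :=
  (fun w => dropCoord i (facetMap p w)) '' baryDomain n

theorem measurableSet_facetShadow {n : ℕ} (p : Fin (n + 1) → Vec (n + 1)) {i : Fin (n + 1)}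
    (hi : conormal p (unitVec i) ≠ 0) : MeasurableSet (facetShadow p i) :=
  measurable_image_of_fderivWithin (isOpen_baryDomain n).measurableSet
    (fun w _ => (hasFDerivAt_dropCoord_facetMap p i w).hasFDerivWithinAt)
    (dropCoord_facetMap_injective p hi).injOn

/-- Change of variables between the projection of a facet and the reference simplex. -/
theorem setIntegral_facetShadow {n : ℕ} (p : Fin (n + 1) → Vec (n + 1)) {i : Fin (n + 1)}
    (hi : conormal p (unitVec i) ≠ 0) (g : Vec (n + 1) → ℝ) :
    ∫ y in facetShadow p i, g (linePt i y (facetHeight p i y)) =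
      |conormal p (unitVec i)| * ∫ w in baryDomain n, g (facetMap p w) := by
  have h := integral_image_eq_integral_abs_det_fderiv_smul volume
    (isOpen_baryDomain n).measurableSet
    (fun w _ => (hasFDerivAt_dropCoord_facetMap p i w).hasFDerivWithinAt)
    (dropCoord_facetMap_injective p hi).injOn fun y => g (linePt i y (facetHeight p i y))
  rw [facetShadow, h, ← integral_const_mul]
  refine setIntegral_congr_fun (isOpen_baryDomain n).measurableSet fun w _ => ?_
  simp only [linePt_facetHeight p hi, smul_eq_mul, ← abs_det_dropCoord_edgeMap p i]
  rfl

theorem integrableOn_facetShadow {n : ℕ} (p : Fin (n + 1) → Vec (n + 1)) {i : Fin (n + 1)}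
    (hi : conormal p (unitVec i) ≠ 0) {g : Vec (n + 1) → ℝ}
    (hg : IntegrableOn (fun w => g (facetMap p w)) (baryDomain n)) :
    IntegrableOn (fun y => g (linePt i y (facetHeight p i y))) (facetShadow p i) := by
  refine (integrableOn_image_iff_integrableOn_abs_det_fderiv_smul volume
    (isOpen_baryDomain n).measurableSet
    (fun w _ => (hasFDerivAt_dropCoord_facetMap p i w).hasFDerivWithinAt)
    (dropCoord_facetMap_injective p hi).injOn fun y => g (linePt i y (facetHeight p i y))).2 ?_
  simp only [linePt_facetHeight p hi, smul_eq_mul]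
  exact hg.const_mul _

/-! ### Interior and exterior of a polyhedral interface -/

theorem isCompact_closedFacet {d K J : ℕ} (facet : Fin J → Fin d → Fin K) (q : Fin K → Vec d)
    (j : Fin J) : IsCompact (closedFacet facet q j) :=
  (finite_range _).isCompact_convexHull (𝕜 := ℝ)

theorem isCompact_surface {d K J : ℕ} (facet : Fin J → Fin d → Fin K) (q : Fin K → Vec d) :
    IsCompact (surface facet q) := isCompact_iUnion fun j => isCompact_closedFacet facet q j

theorem openFacet_subset_closedFacet {d K J : ℕ} (facet : Fin J → Fin d → Fin K)
    (q : Fin K → Vec d) (j : Fin J) : openFacet facet q j ⊆ closedFacet facet q j := by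
  rintro x ⟨w, hw, hsum, rfl⟩
  exact (convex_convexHull ℝ _).sum_mem (fun i _ => (hw i).le) hsum
    fun i _ => subset_convexHull ℝ _ (mem_range_self i)

theorem closedFacet_subset_surface {d K J : ℕ} (facet : Fin J → Fin d → Fin K) (q : Fin K → Vec d)
    (j : Fin J) : closedFacet facet q j ⊆ surface facet q :=
  subset_iUnion (fun j => closedFacet facet q j) j

theorem mem_inside_of_connected {d K J : ℕ} {facet : Fin J → Fin d → Fin K} {q : Fin K → Vec d}
    {C : Set (Vec d)} (hC : IsPreconnected C) (hCs : C ⊆ (surface facet q)ᶜ) {x y : Vec d}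
    (hx : x ∈ C) (hy : y ∈ C) (hxi : x ∈ inside facet q) : y ∈ inside facet q := by
  have := connectedComponentIn_eq (hC.subset_connectedComponentIn hx hCs hy)
  exact ⟨hCs hy, this ▸ hxi.2⟩

theorem mem_outside_of_connected {d K J : ℕ} {facet : Fin J → Fin d → Fin K} {q : Fin K → Vec d}
    {C : Set (Vec d)} (hC : IsPreconnected C) (hCs : C ⊆ (surface facet q)ᶜ) {x y : Vec d}
    (hx : x ∈ C) (hy : y ∈ C) (hxi : x ∈ outside facet q) : y ∈ outside facet q := by
  have := connectedComponentIn_eq (hC.subset_connectedComponentIn hx hCs hy)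
  exact ⟨hCs hy, this ▸ hxi.2⟩

theorem disjoint_inside_outside {d K J : ℕ} (facet : Fin J → Fin d → Fin K) (q : Fin K → Vec d) :
    Disjoint (inside facet q) (outside facet q) :=
  disjoint_left.2 fun _ h h' => h'.2 h.2

theorem inside_union_outside {d K J : ℕ} (facet : Fin J → Fin d → Fin K) (q : Fin K → Vec d) :
    inside facet q ∪ outside facet q = (surface facet q)ᶜ := by
  ext x
  by_cases h : Bornology.IsBounded (connectedComponentIn (surface facet q)ᶜ x) <;>
    simp [inside, outside, h]

theorem isOpen_inside {d K J : ℕ} (facet : Fin J → Fin d → Fin K) (q : Fin K → Vec d) :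
    IsOpen (inside facet q) := by
  have hop : IsOpen (surface facet q)ᶜ := (isCompact_surface facet q).isClosed.isOpen_compl
  refine isOpen_iff_mem_nhds.2 fun x hx => ?_
  have h1 : connectedComponentIn (surface facet q)ᶜ x ∈ 𝓝 x :=
    hop.connectedComponentIn.mem_nhds (mem_connectedComponentIn hx.1)
  exact mem_of_superset h1 fun y hy => mem_inside_of_connected isPreconnected_connectedComponentIn
    (connectedComponentIn_subset _ _) (mem_connectedComponentIn hx.1) hy hx

theorem isOpen_outside {d K J : ℕ} (facet : Fin J → Fin d → Fin K) (q : Fin K → Vec d) :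
    IsOpen (outside facet q) := by
  have hop : IsOpen (surface facet q)ᶜ := (isCompact_surface facet q).isClosed.isOpen_compl
  refine isOpen_iff_mem_nhds.2 fun x hx => ?_
  have h1 : connectedComponentIn (surface facet q)ᶜ x ∈ 𝓝 x :=
    hop.connectedComponentIn.mem_nhds (mem_connectedComponentIn hx.1)
  exact mem_of_superset h1 fun y hy => mem_outside_of_connected isPreconnected_connectedComponentIn
    (connectedComponentIn_subset _ _) (mem_connectedComponentIn hx.1) hy hx

/-! ### Barycentric coordinates and conformity -/

theorem barycentric_unique {n d : ℕ} {p : Fin (n + 1) → Vec d} (hp : AffineIndependent ℝ p)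
    {w w' : Fin (n + 1) → ℝ} (hw : ∑ i, w i = 1) (hw' : ∑ i, w' i = 1)
    (h : ∑ i, w i • p i = ∑ i, w' i • p i) : w = w' := by
  rw [sum_smul_eq_facetMap p hw, sum_smul_eq_facetMap p hw'] at h
  have h1 := facetMap_injective hp h
  have h2 : ∀ k : Fin n, w k.succ = w' k.succ := fun k => congrFun h1 k
  ext i
  refine Fin.cases ?_ h2 i
  rw [Fin.sum_univ_succ] at hw hw'
  rw [Finset.sum_congr rfl fun k _ => h2 k] at hw
  linarith

/-- A point of a nondegenerate facet that lies in the face spanned by the vertices with indices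
in `S` has vanishing barycentric coordinates outside `S`. -/
theorem mem_of_mem_convexHull_image {n d : ℕ} {p : Fin (n + 1) → Vec d}
    (hp : AffineIndependent ℝ p) {S : Set (Fin (n + 1))} {w : Fin (n + 1) → ℝ}
    (hw : ∑ i, w i = 1) (h : ∑ i, w i • p i ∈ convexHull ℝ (p '' S)) {i : Fin (n + 1)}
    (hi : w i ≠ 0) : i ∈ S := by
  classical
  by_contra hiS
  have himg : p '' S = Fintype.linearCombination ℝ p '' ((fun k => Pi.single k (1 : ℝ)) '' S) := by
    rw [image_image]
    refine image_congr fun k _ => ?_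
    simp
  rw [himg, ← LinearMap.image_convexHull] at h
  obtain ⟨w', hw', heq⟩ := h
  have hsub : convexHull ℝ ((fun k => Pi.single k (1 : ℝ)) '' S) ⊆
      {v : Fin (n + 1) → ℝ | ∑ k, v k = 1 ∧ v i = 0} := by
    refine convexHull_min ?_ ?_
    · rintro _ ⟨k, hk, rfl⟩
      refine ⟨by simp, ?_⟩
      have : i ≠ k := fun h => hiS (h ▸ hk)
      simp [this]
    · intro v hv v' hv' a b _ _ hab
      refine ⟨?_, ?_⟩
      · simp only [Pi.add_apply, Pi.smul_apply, smul_eq_mul, Finset.sum_add_distrib,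
          ← Finset.mul_sum, hv.1, hv'.1]
        linarith
      · simp [hv.2, hv'.2]
  have hw'' := hsub hw'
  rw [Fintype.linearCombination_apply] at heq
  have := barycentric_unique hp hw''.1 hw heq
  exact hi (this ▸ hw''.2)

section

variable {n K J : ℕ} {facet : Fin J → Fin (n + 1) → Fin K} {q : Fin K → Vec (n + 1)}
  {Ω : Set (Vec (n + 1))}

theorem IsPolyhedralInterface.facet_injective (h : IsPolyhedralInterface facet q Ω) (j : Fin J) :
    Function.Injective (facet j) := fun a b hab =>
  (h.nondegenerate j).injective (by simp only [hab])

/-- If a point of the `j`-th facet lies in the `i`-th facet as well, then all vertices of the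
smallest face of the `j`-th facet that contains it are vertices of the `i`-th facet. -/
theorem IsPolyhedralInterface.vertex_mem_of_mem (h : IsPolyhedralInterface facet q Ω)
    {i j : Fin J} {w : Fin (n + 1) → ℝ} (hw0 : ∀ k, 0 ≤ w k) (hw : ∑ k, w k = 1)
    (hx : ∑ k, w k • q (facet j k) ∈ closedFacet facet q i) {k : Fin (n + 1)} (hk : w k ≠ 0) :
    facet j k ∈ range (facet i) := by
  have hxj : ∑ k, w k • q (facet j k) ∈ closedFacet facet q j :=
    (convex_convexHull ℝ _).sum_mem (fun i _ => hw0 i) hw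
      fun i _ => subset_convexHull ℝ _ (mem_range_self i)
  have h1 : ∑ k, w k • q (facet j k) ∈
      convexHull ℝ (q '' (range (facet j) ∩ range (facet i))) := by
    rw [← h.conforming]; exact ⟨hxj, hx⟩
  have h2 : q '' (range (facet j) ∩ range (facet i)) =
      (fun k => q (facet j k)) '' {k | facet j k ∈ range (facet i)} := by
    ext z
    constructor
    · rintro ⟨_, ⟨⟨k, rfl⟩, hk⟩, rfl⟩; exact ⟨k, hk, rfl⟩
    · rintro ⟨k, hk, rfl⟩; exact ⟨_, ⟨⟨k, rfl⟩, hk⟩, rfl⟩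
  rw [h2] at h1
  exact mem_of_mem_convexHull_image (h.nondegenerate j) hw h1 hk

theorem IsPolyhedralInterface.eq_of_mem_openFacet (h : IsPolyhedralInterface facet q Ω)
    {i j : Fin J} {x : Vec (n + 1)} (hx : x ∈ openFacet facet q j)
    (hxi : x ∈ closedFacet facet q i) : i = j := by
  by_contra hne
  have hx' := hx
  obtain ⟨w, hw, hsum, rfl⟩ := hx
  have hmem : ∀ k, facet j k ∈ range (facet i) := fun k =>
    h.vertex_mem_of_mem (fun k => (hw k).le) hsum hxi (hw k).ne'
  choose σ hσ using hmem
  have hσi : Function.Injective σ := fun a b hab =>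
    h.facet_injective j (by rw [← hσ a, ← hσ b, hab])
  let e : Fin (n + 1) ≃ Fin (n + 1) := Equiv.ofBijective σ (Finite.injective_iff_bijective.1 hσi)
  refine (h.disjoint i j hne).notMem_of_mem_right hx' ?_
  refine ⟨fun k => w (e.symm k), fun k => hw _, ?_, ?_⟩
  · rw [Equiv.sum_comp e.symm w, hsum]
  · rw [← Equiv.sum_comp e fun k => w (e.symm k) • q (facet i k)]
    refine Finset.sum_congr rfl fun k _ => ?_
    rw [Equiv.symm_apply_apply]
    change _ = w k • q (facet i (σ k))
    rw [hσ]

/-! ### Local structure of the interface at a facet -/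

theorem inner_sub_eq_zero_of_mem_closedFacet {ν : Vec (n + 1)} {j : Fin J}
    (horth : ∀ i i', inner ℝ ν (q (facet j i) - q (facet j i')) = 0) {x y : Vec (n + 1)}
    (hx : x ∈ closedFacet facet q j) (hy : y ∈ closedFacet facet q j) :
    inner ℝ ν (x - y) = 0 := by
  have key : ∀ x ∈ closedFacet facet q j, inner ℝ ν x = inner ℝ ν (q (facet j 0)) := by
    intro x hx
    rw [closedFacet, convexHull_range_eq_image] at hx
    obtain ⟨w, -, rfl⟩ := hx
    rw [facetMap_apply, inner_add_right, inner_sum]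
    simp [inner_smul_right, horth]
  rw [inner_sub_right, key x hx, key y hy, sub_self]

/-- In a ball that meets only the `j`-th facet, the two sides of the facet belong to the exterior
and to the interior of the interface, respectively. Each side is a convex set that avoids the
interface. -/
theorem IsPolyhedralInterface.sides (h : IsPolyhedralInterface facet q Ω) {ν : Vec (n + 1)}
    (hν : ‖ν‖ = 1) {j : Fin J}
    (horth : ∀ i i', inner ℝ ν (q (facet j i) - q (facet j i')) = 0) {c x : Vec (n + 1)} {r : ℝ}
    (hball : ∀ i, i ≠ j → Disjoint (Metric.ball c r) (closedFacet facet q i))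
    (hx : x ∈ openFacet facet q j) (hxr : x ∈ Metric.ball c r)
    (hout : ∀ᶠ ε : ℝ in 𝓝[>] 0, x + ε • ν ∈ outside facet q) :
    (∀ z ∈ Metric.ball c r, 0 < inner ℝ ν (z - x) → z ∈ outside facet q) ∧
      ∀ z ∈ Metric.ball c r, inner ℝ ν (z - x) < 0 → z ∈ inside facet q := by
  have hxc := openFacet_subset_closedFacet facet q j hx
  have hin1 : inner ℝ ν ν = (1 : ℝ) := by rw [real_inner_self_eq_norm_sq, hν]; norm_num
  have hoff : ∀ z ∈ Metric.ball c r, inner ℝ ν (z - x) ≠ 0 → z ∈ (surface facet q)ᶜ := by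
    intro z hz hne hzs
    obtain ⟨i, hi⟩ := mem_iUnion.1 hzs
    by_cases hij : i = j
    · subst hij
      exact hne (inner_sub_eq_zero_of_mem_closedFacet horth hi hxc)
    · exact disjoint_left.1 (hball i hij) hz hi
  have hlin : ∀ z : Vec (n + 1), inner ℝ ν (z - x) = innerSL ℝ ν z - innerSL ℝ ν x := fun z => by
    simp [inner_sub_right]
  have hconv1 : Convex ℝ (Metric.ball c r ∩ {z | 0 < inner ℝ ν (z - x)}) := by
    refine (convex_ball c r).inter ?_
    have : {z : Vec (n + 1) | 0 < inner ℝ ν (z - x)} = {z | innerSL ℝ ν x < innerSL ℝ ν z} := by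
      ext z; simp only [mem_ofPred_eq, hlin, sub_pos]
    rw [this]
    exact convex_halfSpace_gt (innerSL ℝ ν).toLinearMap.isLinear _
  have hconv2 : Convex ℝ (Metric.ball c r ∩ {z | inner ℝ ν (z - x) < 0}) := by
    refine (convex_ball c r).inter ?_
    have : {z : Vec (n + 1) | inner ℝ ν (z - x) < 0} = {z | innerSL ℝ ν z < innerSL ℝ ν x} := by
      ext z; simp only [mem_ofPred_eq, hlin, sub_neg]
    rw [this]
    exact convex_halfSpace_lt (innerSL ℝ ν).toLinearMap.isLinear _
  have htend : ∀ z : Vec (n + 1), Tendsto (fun ε : ℝ => z + ε • ν) (𝓝[>] 0) (𝓝 z) := by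
    intro z
    have : Continuous fun ε : ℝ => z + ε • ν := by fun_prop
    have h2 := this.tendsto 0
    simp only [zero_smul, add_zero] at h2
    exact h2.mono_left nhdsWithin_le_nhds
  have hplus : ∀ z ∈ Metric.ball c r, 0 < inner ℝ ν (z - x) → z ∈ outside facet q := by
    intro z hz hzp
    obtain ⟨ε, ⟨h1, h2⟩, h3⟩ := ((hout.and ((htend x).eventually
      (Metric.isOpen_ball.mem_nhds hxr))).and self_mem_nhdsWithin).exists
    refine mem_outside_of_connected hconv1.isPreconnected (fun y hy => hoff y hy.1 hy.2.ne')
      (x := x + ε • ν) ⟨h2, ?_⟩ ⟨hz, hzp⟩ h1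
    simp only [mem_ofPred_eq, add_sub_cancel_left, inner_smul_right, hin1, mul_one]
    exact h3
  refine ⟨hplus, fun z hz hzn => ?_⟩
  -- the interior accumulates at `x`, and a nearby interior point must lie on the other side
  have hxcl : x ∈ closure (inside facet q) := by
    have : x ∈ frontier (inside facet q) := by
      rw [← h.eq_frontier]; exact closedFacet_subset_surface facet q j hxc
    exact this.1
  obtain ⟨y, hyr, hy⟩ := mem_closure_iff.1 hxcl _ Metric.isOpen_ball hxr
  have hyn : inner ℝ ν (y - x) < 0 := by
    by_contra hcon
    rw [not_lt] at hcon
    obtain ⟨ε, ⟨h1, h2⟩, h3⟩ := ((((htend y).eventually ((isOpen_inside facet q).mem_nhds hy)).and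
      ((htend y).eventually (Metric.isOpen_ball.mem_nhds hyr))).and self_mem_nhdsWithin).exists
    refine disjoint_left.1 (disjoint_inside_outside facet q) h1 (hplus _ h2 ?_)
    rw [add_sub_right_comm, inner_add_right, inner_smul_right, hin1, mul_one]
    exact add_pos_of_nonneg_of_pos hcon h3
  exact mem_inside_of_connected hconv2.isPreconnected (fun y hy => hoff y hy.1 hy.2.ne)
    (x := y) ⟨hyr, hyn⟩ ⟨hz, hzn⟩ hy

/-- A point in the relative interior of a facet has positive distance to the other facets. -/
theorem IsPolyhedralInterface.exists_ball (h : IsPolyhedralInterface facet q Ω) {j : Fin J}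
    {x : Vec (n + 1)} (hx : x ∈ openFacet facet q j) :
    ∃ r > 0, ∀ i, i ≠ j → Disjoint (Metric.ball x r) (closedFacet facet q i) := by
  have hcl : IsClosed (⋃ i ∈ {i | i ≠ j}, closedFacet facet q i) :=
    (toFinite _).isClosed_biUnion fun i _ => (isCompact_closedFacet facet q i).isClosed
  have hxn : x ∈ (⋃ i ∈ {i | i ≠ j}, closedFacet facet q i)ᶜ := by
    intro hxm
    simp only [mem_iUnion] at hxm
    obtain ⟨i, hi, hxi⟩ := hxm
    exact hi (h.eq_of_mem_openFacet hx hxi)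
  obtain ⟨r, hr, hsub⟩ := Metric.isOpen_iff.1 hcl.isOpen_compl x hxn
  refine ⟨r, hr, fun i hi => disjoint_left.2 fun z hz hzi => hsub hz ?_⟩
  exact mem_iUnion₂.2 ⟨i, hi, hzi⟩

end

/-! ### The divergence theorem on the interior of an interface -/

/-- `m` is the unit normal of the `j`-th facet that points into the exterior. -/
structure IsFacetNormal {d K J : ℕ} (facet : Fin J → Fin d → Fin K) (q : Fin K → Vec d) (j : Fin J)
    (m : Vec d) : Prop where
  norm_eq : ‖m‖ = 1
  orth : ∀ i i', inner ℝ m (q (facet j i) - q (facet j i')) = 0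
  outward : ∀ x ∈ openFacet facet q j, ∀ᶠ ε : ℝ in 𝓝[>] 0, x + ε • m ∈ outside facet q

theorem IsOuterNormal.exists_facetNormal {d K J : ℕ} {facet : Fin J → Fin d → Fin K}
    {q : Fin K → Vec d} {ν : Vec d → Vec d} (h : IsOuterNormal facet q ν) :
    ∃ N : Fin J → Vec d, (∀ j, IsFacetNormal facet q j (N j)) ∧
      ∀ j, ∀ x ∈ openFacet facet q j, ν x = N j := by
  choose N h1 h2 h3 using h
  exact ⟨N, fun j => ⟨h1 j, h2 j, fun x hx => (h3 j x hx).2⟩, fun j x hx => (h3 j x hx).1⟩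

section

variable {n K J : ℕ} {facet : Fin J → Fin (n + 1) → Fin K} {q : Fin K → Vec (n + 1)}
  {Ω : Set (Vec (n + 1))}

theorem IsPolyhedralInterface.surface_subset_closure (h : IsPolyhedralInterface facet q Ω) :
    surface facet q ⊆ closure (inside facet q) := by
  rw [h.eq_frontier]; exact frontier_subset_closure

theorem integrableOn_facetMap {g : Vec (n + 1) → ℝ} (hg : ContinuousOn g (surface facet q))
    (j : Fin J) :
    IntegrableOn (fun w => g (facetMap (fun i => q (facet j i)) w)) (baryDomain n) := by
  refine integrableOn_baryDomain (hg.comp (continuous_facetMap _).continuousOn fun w hw => ?_)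
  refine closedFacet_subset_surface facet q j ?_
  rw [closedFacet, convexHull_range_eq_image]
  exact mem_image_of_mem _ hw

/-- The jumps of the characteristic function of the interior along a line that is parallel to an
axis and in general position with respect to the facets: it misses the relative boundaries of all
facets (`hbd`) and the facets parallel to the axis (`hpar`). A crossing of the `j`-th facet in the
direction of its normal leaves the interior. -/
theorem IsPolyhedralInterface.exists_jump (h : IsPolyhedralInterface facet q Ω)
    {N : Fin J → Vec (n + 1)} (hN : ∀ j, IsFacetNormal facet q j (N j)) (i : Fin (n + 1))
    {y : Fin n → ℝ} {I : Finset (Fin J)}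
    (hI : ∀ j, j ∈ I ↔ conormal (fun k => q (facet j k)) (unitVec i) ≠ 0 ∧
      y ∈ facetShadow (fun k => q (facet j k)) i)
    (hbd : ∀ j s, linePt i y s ∉
      facetMap (fun k => q (facet j k)) '' (closedBaryDomain n \ baryDomain n))
    (hpar : ∀ j, conormal (fun k => q (facet j k)) (unitVec i) = 0 →
      ∀ s w, linePt i y s ≠ facetMap (fun k => q (facet j k)) w) (x : ℝ) :
    ∃ l r : ℝ,
      (∀ᶠ z in 𝓝[<] x, {s | linePt i y s ∈ inside facet q}.indicator (fun _ => (1 : ℝ)) z = l) ∧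
      (∀ᶠ z in 𝓝[>] x, {s | linePt i y s ∈ inside facet q}.indicator (fun _ => (1 : ℝ)) z = r) ∧
      l - r = ∑ j ∈ I, if facetHeight (fun k => q (facet j k)) i y = x then
        (SignType.sign (N j i) : ℝ) else 0 := by
  have hmemI : ∀ j ∈ I, facetHeight (fun k => q (facet j k)) i y = x →
      linePt i y x ∈ openFacet facet q j := by
    intro j hj hx
    obtain ⟨hc, w, hw, rfl⟩ := (hI j).1 hj
    rw [openFacet_eq_image, ← hx]
    exact ⟨w, hw, (linePt_facetHeight _ hc w).symm⟩
  have hcont := continuous_linePt i y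
  by_cases hxs : linePt i y x ∈ surface facet q
  · obtain ⟨j, hj⟩ := mem_iUnion.1 hxs
    rw [closedFacet, convexHull_range_eq_image] at hj
    obtain ⟨w, hw, hwx⟩ := hj
    have hwo : w ∈ baryDomain n := by
      by_contra hcon
      exact hbd j x ⟨w, ⟨hw, hcon⟩, hwx⟩
    have hc : conormal (fun k => q (facet j k)) (unitVec i) ≠ 0 := fun hc =>
      hpar j hc x w hwx.symm
    have hopen : linePt i y x ∈ openFacet facet q j := by
      rw [openFacet_eq_image]; exact ⟨w, hwo, hwx⟩
    have hjI : j ∈ I := (hI j).2 ⟨hc, w, hwo, by simp only [hwx, dropCoord_linePt]⟩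
    have hheight : facetHeight (fun k => q (facet j k)) i y = x := by
      have := facetMap_coord_eq_height (fun k => q (facet j k)) hc w
      rw [hwx, dropCoord_linePt, linePt_same] at this
      exact this.symm
    have hsum : (∑ j ∈ I, if facetHeight (fun k => q (facet j k)) i y = x then
        (SignType.sign (N j i) : ℝ) else 0) = (SignType.sign (N j i) : ℝ) := by
      rw [Finset.sum_eq_single_of_mem j hjI, if_pos hheight]
      intro k hk hkj
      rw [if_neg]
      intro hkx
      exact hkj (h.eq_of_mem_openFacet hopen (openFacet_subset_closedFacet _ _ _ (hmemI k hk hkx)))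
    rw [hsum]
    have hNi : N j i ≠ 0 := by
      intro h0
      rw [conormal_eq_mul_inner (h.nondegenerate j) (hN j).norm_eq (hN j).orth] at hc
      refine hc ?_
      rw [EuclideanSpace.inner_single_right]
      simp [h0]
    obtain ⟨r, hr, hball⟩ := h.exists_ball hopen
    obtain ⟨hs1, hs2⟩ := h.sides (hN j).norm_eq (hN j).orth hball hopen
      (Metric.mem_ball_self hr) ((hN j).outward _ hopen)
    have hnear : ∀ᶠ s in 𝓝 x, linePt i y s ∈ Metric.ball (linePt i y x) r :=
      hcont.continuousAt.eventually (Metric.ball_mem_nhds _ hr)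
    have hinner : ∀ s, inner ℝ (N j) (linePt i y s - linePt i y x) = (s - x) * N j i := by
      intro s
      rw [linePt_eq_add i y s x, add_sub_cancel_left, inner_smul_right,
        EuclideanSpace.inner_single_right]
      simp
    have hout : ∀ s, linePt i y s ∈ outside facet q →
        {s | linePt i y s ∈ inside facet q}.indicator (fun _ => (1 : ℝ)) s = 0 := fun s hs =>
      indicator_of_notMem (s := {s | linePt i y s ∈ inside facet q})
        (fun hs' => disjoint_left.1 (disjoint_inside_outside facet q) hs' hs) _
    have hin : ∀ s, linePt i y s ∈ inside facet q →
        {s | linePt i y s ∈ inside facet q}.indicator (fun _ => (1 : ℝ)) s = 1 := fun s hs =>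
      indicator_of_mem (s := {s | linePt i y s ∈ inside facet q}) hs _
    -- for `N j i < 0` the line enters the interior at `x`, otherwise it leaves it
    rcases lt_or_gt_of_ne hNi with hneg | hpos
    · refine ⟨0, 1, ?_, ?_, by simp [sign_neg hneg]⟩
      · filter_upwards [hnear.filter_mono nhdsWithin_le_nhds, self_mem_nhdsWithin] with s hs hsx
        refine hout s (hs1 _ hs ?_)
        rw [hinner]
        exact mul_pos_of_neg_of_neg (sub_neg.2 hsx) hneg
      · filter_upwards [hnear.filter_mono nhdsWithin_le_nhds, self_mem_nhdsWithin] with s hs hsx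
        refine hin s (hs2 _ hs ?_)
        rw [hinner]
        exact mul_neg_of_pos_of_neg (sub_pos.2 hsx) hneg
    · refine ⟨1, 0, ?_, ?_, by simp [sign_pos hpos]⟩
      · filter_upwards [hnear.filter_mono nhdsWithin_le_nhds, self_mem_nhdsWithin] with s hs hsx
        refine hin s (hs2 _ hs ?_)
        rw [hinner]
        exact mul_neg_of_neg_of_pos (sub_neg.2 hsx) hpos
      · filter_upwards [hnear.filter_mono nhdsWithin_le_nhds, self_mem_nhdsWithin] with s hs hsx
        refine hout s (hs1 _ hs ?_)
        rw [hinner]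
        exact mul_pos (sub_pos.2 hsx) hpos
  · have hsum : (∑ j ∈ I, if facetHeight (fun k => q (facet j k)) i y = x then
        (SignType.sign (N j i) : ℝ) else 0) = 0 := by
      refine Finset.sum_eq_zero fun j hj => if_neg fun hx => hxs ?_
      exact closedFacet_subset_surface _ _ j (openFacet_subset_closedFacet _ _ _ (hmemI j hj hx))
    rw [hsum]
    have hcompl : linePt i y x ∈ inside facet q ∪ outside facet q := by
      rw [inside_union_outside]; exact hxs
    rcases hcompl with hx | hx
    · have h1 : ∀ᶠ s in 𝓝 x,
          {s | linePt i y s ∈ inside facet q}.indicator (fun _ => (1 : ℝ)) s = 1 := by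
        filter_upwards [hcont.continuousAt.eventually ((isOpen_inside facet q).mem_nhds hx)]
          with s hs
        exact indicator_of_mem (s := {s | linePt i y s ∈ inside facet q}) hs _
      exact ⟨1, 1, h1.filter_mono nhdsWithin_le_nhds, h1.filter_mono nhdsWithin_le_nhds, sub_self _⟩
    · have h1 : ∀ᶠ s in 𝓝 x,
          {s | linePt i y s ∈ inside facet q}.indicator (fun _ => (1 : ℝ)) s = 0 := by
        filter_upwards [hcont.continuousAt.eventually ((isOpen_outside facet q).mem_nhds hx)]
          with s hs
        exact indicator_of_notMem (s := {s | linePt i y s ∈ inside facet q})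
          (fun hs' => disjoint_left.1 (disjoint_inside_outside facet q) hs' hs) _
      exact ⟨0, 0, h1.filter_mono nhdsWithin_le_nhds, h1.filter_mono nhdsWithin_le_nhds, sub_self _⟩

/-- Divergence theorem for one partial derivative. It is enough that `g'` is the derivative of `g`
in the direction of the `i`-th axis off a countable set on almost every line parallel to this axis,
and that `g` is continuous up to the boundary. The right hand side is `∫ g ν_i` over the interface,
written in barycentric coordinates. -/
theorem IsPolyhedralInterface.setIntegral_inside (h : IsPolyhedralInterface facet q Ω)
    {N : Fin J → Vec (n + 1)} (hN : ∀ j, IsFacetNormal facet q j (N j))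
    (hb : Bornology.IsBounded (inside facet q)) (i : Fin (n + 1)) {g g' : Vec (n + 1) → ℝ}
    (hg : ContinuousOn g (closure (inside facet q))) (hg' : IntegrableOn g' (inside facet q))
    (hderiv : ∀ᵐ y, ∃ C : Set ℝ, C.Countable ∧ ∀ s ∉ C, linePt i y s ∈ inside facet q →
      HasDerivAt (fun s => g (linePt i y s)) (g' (linePt i y s)) s) :
    ∫ x in inside facet q, g' x = ∑ j, N j i * |conormal (fun k => q (facet j k)) (N j)| *
      ∫ w in baryDomain n, g (facetMap (fun k => q (facet j k)) w) := by
  classical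
  set p : Fin J → Fin (n + 1) → Vec (n + 1) := fun j k => q (facet j k) with hp
  have hmeas := (isOpen_inside facet q).measurableSet
  have hint : Integrable ((inside facet q).indicator g') := (integrable_indicator_iff hmeas).2 hg'
  rw [← integral_indicator hmeas, integral_eq_integral_linePt i hint]
  -- the contribution of the `j`-th facet to the integral along the line over `y`
  set G : Fin J → (Fin n → ℝ) → ℝ := fun j =>
    if conormal (p j) (unitVec i) = 0 then 0 else
      (facetShadow (p j) i).indicator fun y =>
        (SignType.sign (N j i) : ℝ) * g (linePt i y (facetHeight (p j) i y)) with hG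
  have hslice : ∀ᵐ y, ∫ s, (inside facet q).indicator g' (linePt i y s) = ∑ j, G j y := by
    have e1 : ∀ᵐ y, ∀ j, ∀ s, linePt i y s ∉
        facetMap (p j) '' (closedBaryDomain n \ baryDomain n) :=
      ae_all_iff.2 fun j => ae_linePt_notMem_of_null (p j) i (volume_closedBaryDomain_diff n)
    have e2 : ∀ᵐ y, ∀ j, conormal (p j) (unitVec i) = 0 → ∀ s w, linePt i y s ≠ facetMap (p j) w :=
      ae_all_iff.2 fun j => by
        by_cases hc : conormal (p j) (unitVec i) = 0
        · filter_upwards [ae_linePt_notMem_of_parallel (p j) hc] with y hy _ using hy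
        · exact Eventually.of_forall fun y hc' => absurd hc' hc
    filter_upwards [e1, e2, ae_integrable_linePt i hint, hderiv] with y h1 h2 h3 h4
    obtain ⟨C, hC, hCd⟩ := h4
    set S : Set ℝ := {s | linePt i y s ∈ inside facet q} with hS
    have hSo : IsOpen S := (isOpen_inside facet q).preimage (continuous_linePt i y)
    have hSb : Bornology.IsBounded S := (isometry_linePt i y).antilipschitz.isBounded_preimage hb
    have hind : (fun s => (inside facet q).indicator g' (linePt i y s)) =
        S.indicator fun s => g' (linePt i y s) := rfl
    rw [hind] at h3 ⊢
    rw [integral_indicator hSo.measurableSet]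
    set I : Finset (Fin J) := Finset.univ.filter fun j =>
      conormal (p j) (unitVec i) ≠ 0 ∧ y ∈ facetShadow (p j) i with hI
    have hcl : ContinuousOn (fun s => g (linePt i y s)) (closure S) :=
      hg.comp (continuous_linePt i y).continuousOn
        ((continuous_linePt i y).closure_preimage_subset _)
    rw [setIntegral_eq_sum_jumps I (fun j => facetHeight (p j) i y)
      (fun j => (SignType.sign (N j i) : ℝ)) hSo hSb hcl hC (fun s hs => hCd s hs.2 hs.1)
      ((integrable_indicator_iff hSo.measurableSet).1 h3)
      (h.exists_jump hN i (fun j => by simp [hI, hp]) h1 h2), hI, Finset.sum_filter]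
    refine Finset.sum_congr rfl fun j _ => ?_
    by_cases hc : conormal (p j) (unitVec i) = 0
    · simp [hG, hc]
    · by_cases hy : y ∈ facetShadow (p j) i
      · simp [hG, hc, hy]
      · simp [hG, hc, hy]
  have hgs : ContinuousOn g (surface facet q) := hg.mono h.surface_subset_closure
  have hGint : ∀ j, Integrable (G j) := by
    intro j
    by_cases hc : conormal (p j) (unitVec i) = 0
    · simp only [hG, hc, if_true]; exact integrable_zero _ _ _
    · simp only [hG, hc, if_false]
      exact (integrable_indicator_iff (measurableSet_facetShadow (p j) hc)).2
        ((integrableOn_facetShadow (p j) hc (integrableOn_facetMap hgs j)).const_mul _)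
  rw [integral_congr_ae hslice, integral_finsetSum _ fun j _ => hGint j]
  refine Finset.sum_congr rfl fun j _ => ?_
  have hcN : conormal (p j) (unitVec i) = conormal (p j) (N j) * N j i := by
    rw [conormal_eq_mul_inner (p := p j) (h.nondegenerate j) (hN j).norm_eq (hN j).orth,
      EuclideanSpace.inner_single_right]
    simp
  by_cases hc : conormal (p j) (unitVec i) = 0
  · have hNi : N j i = 0 := by
      rw [hcN] at hc
      exact (mul_eq_zero.1 hc).resolve_left
        (conormal_ne_zero (h.nondegenerate j) (hN j).norm_eq (hN j).orth)
    simp [hG, hc, hNi]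
  · simp only [hG, hc, if_false]
    rw [integral_indicator (measurableSet_facetShadow (p j) hc), integral_const_mul,
      setIntegral_facetShadow (p j) hc g, hcN, abs_mul]
    have := sign_mul_abs (N j i)
    calc _ = ((SignType.sign (N j i) : ℝ) * |N j i|) * |conormal (p j) (N j)| *
        ∫ w in baryDomain n, g (facetMap (p j) w) := by ring
      _ = _ := by rw [this]

end

/-! ### Surface integrals and mass lumping -/

section

variable {n K J : ℕ} {facet : Fin J → Fin (n + 1) → Fin K} {q : Fin K → Vec (n + 1)}
  {Ω : Set (Vec (n + 1))}

theorem vertex_mem_closure_openFacet (facet : Fin J → Fin (n + 1) → Fin K)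
    (q : Fin K → Vec (n + 1)) (j : Fin J) (i : Fin (n + 1)) :
    q (facet j i) ∈ closure (openFacet facet q j) := by
  classical
  -- move from the vertex towards the barycentre
  let W : ℝ → Fin (n + 1) → ℝ := fun ε k => (1 - ε) * (if k = i then 1 else 0) + ε * (n + 1 : ℝ)⁻¹
  have hcont : Continuous fun ε => ∑ k, W ε k • q (facet j k) := by
    simp only [W]; fun_prop
  have h0 : ∑ k, W 0 k • q (facet j k) = q (facet j i) := by simp [W]
  have htend : Tendsto (fun ε => ∑ k, W ε k • q (facet j k)) (𝓝[>] 0) (𝓝 (q (facet j i))) := by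
    rw [← h0]; exact (hcont.tendsto 0).mono_left nhdsWithin_le_nhds
  refine mem_closure_of_tendsto htend ?_
  filter_upwards [Ioo_mem_nhdsGT (zero_lt_one' ℝ)] with ε hε
  refine ⟨W ε, fun k => ?_, ?_, rfl⟩
  · have h1 : 0 ≤ (1 - ε) * (if k = i then (1 : ℝ) else 0) :=
      mul_nonneg (by linarith [hε.2]) (by split_ifs <;> norm_num)
    have h2 : 0 < ε * (n + 1 : ℝ)⁻¹ := mul_pos hε.1 (by positivity)
    exact add_pos_of_nonneg_of_pos h1 h2
  · have hn : (n : ℝ) + 1 ≠ 0 := by positivity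
    simp only [W, Finset.sum_add_distrib, ← Finset.mul_sum, Finset.sum_ite_eq', Finset.mem_univ,
      if_true, Finset.sum_const, Finset.card_univ, Fintype.card_fin, nsmul_eq_mul]
    push_cast
    field_simp
    ring

theorem openFacet_ae_eq_closedFacet {j : Fin J} {m : Vec (n + 1)}
    (hm : IsFacetNormal facet q j m) :
    openFacet facet q j =ᵐ[(μHE[n] : Measure (Vec (n + 1)))] closedFacet facet q j := by
  refine (openFacet_subset_closedFacet facet q j).eventuallyLE.antisymm ?_
  rw [ae_le_set]
  have hsub : closedFacet facet q j \ openFacet facet q j ⊆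
      facetMap (fun i => q (facet j i)) '' (closedBaryDomain n \ baryDomain n) := by
    rw [closedFacet, convexHull_range_eq_image, openFacet_eq_image]
    rintro x ⟨⟨w, hw, rfl⟩, hx⟩
    exact ⟨w, ⟨hw, fun hw' => hx ⟨w, hw', rfl⟩⟩, rfl⟩
  refine measure_mono_null hsub ?_
  rw [hausdorff_facetMap_image _ hm.norm_eq hm.orth, volume_closedBaryDomain_diff, mul_zero]

/-- Surface integral of a function whose restriction to each open facet extends continuously to the
closed facet. -/
theorem IsPolyhedralInterface.setIntegral_surface (h : IsPolyhedralInterface facet q Ω)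
    {N : Fin J → Vec (n + 1)} (hN : ∀ j, IsFacetNormal facet q j (N j)) {f : Vec (n + 1) → ℝ}
    {G : Fin J → Vec (n + 1) → ℝ} (hfG : ∀ j, EqOn f (G j) (openFacet facet q j))
    (hG : ∀ j, ContinuousOn (G j) (closedFacet facet q j)) :
    ∫ x in surface facet q, f x ∂(μHE[n] : Measure (Vec (n + 1))) =
      ∑ j, |conormal (fun i => q (facet j i)) (N j)| *
        ∫ w in baryDomain n, G j (facetMap (fun i => q (facet j i)) w) := by
  have hmeas : ∀ j, MeasurableSet (openFacet facet q j) := fun j => by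
    rw [openFacet_eq_image]
    exact ((continuous_facetMap _).measurableEmbedding
      (facetMap_injective (h.nondegenerate j))).measurableSet_image.2
        (isOpen_baryDomain n).measurableSet
  have hfin : ∀ j, (μHE[n] : Measure (Vec (n + 1))) (closedFacet facet q j) < ⊤ := fun j => by
    rw [closedFacet, convexHull_range_eq_image,
      hausdorff_facetMap_image _ (hN j).norm_eq (hN j).orth]
    exact ENNReal.mul_lt_top ENNReal.ofReal_lt_top (isCompact_closedBaryDomain n).measure_lt_top
  have hint : ∀ j, IntegrableOn f (openFacet facet q j)
      (μHE[n] : Measure (Vec (n + 1))) := fun j => by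
    refine IntegrableOn.congr_fun ?_ (hfG j).symm (hmeas j)
    obtain ⟨C, hC⟩ := (isCompact_closedFacet facet q j).exists_bound_of_continuousOn (hG j)
    have hcl := (isCompact_closedFacet facet q j).isClosed.measurableSet
    refine IntegrableOn.mono_set (t := closedFacet facet q j) ?_
      (openFacet_subset_closedFacet _ _ _)
    have : IsFiniteMeasure ((μHE[n] : Measure (Vec (n + 1))).restrict (closedFacet facet q j)) :=
      ⟨by rw [Measure.restrict_apply_univ]; exact hfin j⟩
    refine Integrable.of_bound ((hG j).aestronglyMeasurable hcl) C ?_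
    exact (ae_restrict_iff' hcl).2 (Eventually.of_forall hC)
  have hae : surface facet q =ᵐ[(μHE[n] : Measure (Vec (n + 1)))] ⋃ j, openFacet facet q j :=
    Filter.EventuallyEq.countable_iUnion fun j => (openFacet_ae_eq_closedFacet (hN j)).symm
  rw [setIntegral_congr_set hae, integral_iUnion_fintype hmeas
    (fun i j hij => h.disjoint i j hij) hint]
  refine Finset.sum_congr rfl fun j _ => ?_
  rw [setIntegral_congr_fun (hmeas j) (hfG j), openFacet_eq_image,
    setIntegral_facetMap_image (h.nondegenerate j) (hN j).norm_eq (hN j).orth]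

theorem IsPolyhedralInterface.surfaceInner_normal (h : IsPolyhedralInterface facet q Ω)
    {N : Fin J → Vec (n + 1)} (hN : ∀ j, IsFacetNormal facet q j (N j))
    {ν v : Vec (n + 1) → Vec (n + 1)} (hν : ∀ j, ∀ x ∈ openFacet facet q j, ν x = N j)
    (hv : ContinuousOn v (surface facet q)) :
    surfaceInner facet q v ν = ∑ j, |conormal (fun i => q (facet j i)) (N j)| *
      ∫ w in baryDomain n, inner ℝ (v (facetMap (fun i => q (facet j i)) w)) (N j) :=
  h.setIntegral_surface hN (G := fun j x => inner ℝ (v x) (N j))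
    (fun j x hx => by simp only [hν j x hx])
    fun j => (hv.mono (closedFacet_subset_surface facet q j)).inner continuousOn_const

theorem MemSurfaceP1.exists_affine {v : Vec (n + 1) → Vec (n + 1)} (hv : MemSurfaceP1 facet q v)
    (j : Fin J) : ∃ A : Vec (n + 1) →ᵃ[ℝ] Vec (n + 1), EqOn v A (openFacet facet q j) ∧
      ∀ i, A (q (facet j i)) = v (q (facet j i)) := by
  obtain ⟨A, hA⟩ := hv.2 j
  refine ⟨A, hA, fun i => ?_⟩
  have hcl := vertex_mem_closure_openFacet facet q j i
  have hne : (𝓝[openFacet facet q j] (q (facet j i))).NeBot :=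
    mem_closure_iff_nhdsWithin_neBot.1 hcl
  have hqs : q (facet j i) ∈ surface facet q := closedFacet_subset_surface facet q j
    (subset_convexHull ℝ _ (mem_range_self i))
  have h1 : Tendsto v (𝓝[openFacet facet q j] (q (facet j i))) (𝓝 (v (q (facet j i)))) :=
    (hv.1 _ hqs).mono_left (nhdsWithin_mono _
      ((openFacet_subset_closedFacet _ _ _).trans (closedFacet_subset_surface _ _ j)))
  have h2 : Tendsto v (𝓝[openFacet facet q j] (q (facet j i))) (𝓝 (A (q (facet j i)))) :=
    ((A.continuous_of_finiteDimensional.tendsto _).mono_left nhdsWithin_le_nhds).congr'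
      (by filter_upwards [self_mem_nhdsWithin] with x hx using (hA hx).symm)
  exact tendsto_nhds_unique h2 h1

/-- The flux of a piecewise affine field through the interface in terms of its vertex values. -/
theorem IsPolyhedralInterface.surfaceInner_normal_of_affine (h : IsPolyhedralInterface facet q Ω)
    {N : Fin J → Vec (n + 1)} (hN : ∀ j, IsFacetNormal facet q j (N j))
    {ν v : Vec (n + 1) → Vec (n + 1)} (hν : ∀ j, ∀ x ∈ openFacet facet q j, ν x = N j)
    (hv : MemSurfaceP1 facet q v) :
    surfaceInner facet q v ν = volume.real (baryDomain n) / (n + 1) *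
      ∑ j, |conormal (fun i => q (facet j i)) (N j)| * ∑ i, inner ℝ (v (q (facet j i))) (N j) := by
  rw [h.surfaceInner_normal hN hν hv.1, Finset.mul_sum]
  refine Finset.sum_congr rfl fun j _ => ?_
  obtain ⟨A, hA, hAv⟩ := hv.exists_affine j
  let B : Vec (n + 1) →ᵃ[ℝ] ℝ := (innerSL ℝ (N j)).toLinearMap.toAffineMap.comp A
  have hB : ∀ x, B x = inner ℝ (A x) (N j) := fun x => by simp [B, real_inner_comm]
  have h1 : ∫ w in baryDomain n, inner ℝ (v (facetMap (fun i => q (facet j i)) w)) (N j) =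
      ∫ w in baryDomain n, B (facetMap (fun i => q (facet j i)) w) := by
    refine setIntegral_congr_fun (isOpen_baryDomain n).measurableSet fun w hw => ?_
    have hm : facetMap (fun i => q (facet j i)) w ∈ openFacet facet q j := by
      rw [openFacet_eq_image]; exact mem_image_of_mem _ hw
    simp only [hB, hA hm]
  rw [h1, integral_affine_facetMap]
  simp only [hB, hAv]
  ring

/-- Mass lumping is exact for the normal component of a piecewise affine field. -/
theorem IsPolyhedralInterface.lumpedInner_normal (h : IsPolyhedralInterface facet q Ω)
    {ν v : Vec (n + 1) → Vec (n + 1)} (hν : IsOuterNormal facet q ν)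
    (hv : MemSurfaceP1 facet q v) :
    lumpedInner facet q v ν = surfaceInner facet q v ν := by
  obtain ⟨N, hN, hν⟩ := hν.exists_facetNormal
  rw [h.surfaceInner_normal_of_affine hN hν hv, lumpedInner, Finset.mul_sum, Finset.mul_sum]
  refine Finset.sum_congr rfl fun j _ => ?_
  obtain ⟨A, hA, hAv⟩ := hv.exists_affine j
  have harea : (μHE[n + 1 - 1] : Measure (Vec (n + 1))).real (openFacet facet q j) =
      |conormal (fun i => q (facet j i)) (N j)| * volume.real (baryDomain n) := by
    rw [Nat.add_sub_cancel, openFacet_eq_image, Measure.real,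
      hausdorff_facetMap_image _ (hN j).norm_eq (hN j).orth, ENNReal.toReal_mul,
      ENNReal.toReal_ofReal (abs_nonneg _)]
    rfl
  have hlim : ∀ i, limUnder (𝓝[openFacet facet q j] (q (facet j i)))
      (fun x => inner ℝ (v x) (ν x)) =
      inner ℝ (v (q (facet j i))) (N j) := fun i => ?_
  · rw [harea, Finset.sum_congr rfl fun i _ => hlim i]
    push_cast
    ring
  have hne : (𝓝[openFacet facet q j] (q (facet j i))).NeBot :=
    mem_closure_iff_nhdsWithin_neBot.1 (vertex_mem_closure_openFacet facet q j i)
  refine Tendsto.limUnder_eq ?_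
  have hc : Continuous fun x => inner ℝ (A x) (N j) :=
    A.continuous_of_finiteDimensional.inner continuous_const
  rw [← hAv]
  refine ((hc.tendsto (q (facet j i))).mono_left nhdsWithin_le_nhds).congr' ?_
  filter_upwards [self_mem_nhdsWithin] with x hx
  rw [hA hx, hν j x hx]

end

/-! ### Piecewise polynomial fields on a bulk mesh -/

theorem simplex_interior_eq {n : ℕ} (s : Affine.Simplex ℝ (Vec (n + 1)) (n + 1)) :
    s.interior = _root_.interior s.closedInterior := by
  have htop : affineSpan ℝ (range s.points) = ⊤ :=
    s.independent.affineSpan_eq_top_iff_card_eq_finrank_add_one.2 (by simp)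
  let b : AffineBasis (Fin (n + 1 + 1)) ℝ (Vec (n + 1)) := ⟨s.points, s.independent, htop⟩
  have hb : range b = range s.points := rfl
  rw [← s.convexHull_eq_closedInterior, ← hb, b.interior_convexHull]
  ext x
  have hx : Finset.univ.affineCombination ℝ s.points (fun i => b.coord i x) = x :=
    b.affineCombination_coord_eq_self x
  have hsum : ∑ i, b.coord i x = 1 := b.sum_coord_apply_eq_one x
  rw [← hx, s.affineCombination_mem_interior_iff hsum, hx]
  refine ⟨fun h i => (h i).1, fun h i => ⟨h i, ?_⟩⟩
  obtain ⟨i', hi'⟩ := exists_ne i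
  rw [← hsum]
  exact Finset.single_lt_sum hi' (Finset.mem_univ i) (Finset.mem_univ i') (h i')
    fun k _ _ => (h k).le

theorem BulkMesh.isCompact_closure {n : ℕ} {Ω : Set (Vec (n + 1))} (mesh : BulkMesh (n + 1) Ω) :
    IsCompact (closure Ω) := by
  rw [← mesh.cover]
  exact isCompact_iUnion fun j => (mesh.simplex j).isCompact_closedInterior

section

variable {n : ℕ} {Ω : Set (Vec (n + 1))} (mesh : BulkMesh (n + 1) Ω)

theorem BulkMesh.isOpen_interior (j : Fin mesh.n) : IsOpen (mesh.simplex j).interior := by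
  rw [simplex_interior_eq]; exact _root_.isOpen_interior

theorem BulkMesh.ae_mem_interior :
    ∀ᵐ x ∂(volume : Measure (Vec (n + 1))), x ∈ closure Ω → ∃ j, x ∈ (mesh.simplex j).interior := by
  have h : ∀ j, ∀ᵐ x, x ∉ frontier (mesh.simplex j).closedInterior := fun j => by
    refine measure_eq_zero_iff_ae_notMem.1 ?_
    rw [← (mesh.simplex j).convexHull_eq_closedInterior]
    exact (convex_convexHull ℝ _).addHaar_frontier _
  filter_upwards [ae_all_iff.2 h] with x hx hxΩ
  rw [← mesh.cover] at hxΩ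
  obtain ⟨j, hj⟩ := mem_iUnion.1 hxΩ
  refine ⟨j, ?_⟩
  rw [simplex_interior_eq]
  by_contra hcon
  exact hx j ⟨subset_closure hj, hcon⟩

/-- Almost every line parallel to an axis leaves the open elements only at countably many points. -/
theorem BulkMesh.ae_linePt_mem_interior (i : Fin (n + 1)) :
    ∀ᵐ y, ∃ C : Set ℝ, C.Countable ∧ ∀ s ∉ C, linePt i y s ∈ closure Ω →
      ∃ j, linePt i y s ∈ (mesh.simplex j).interior := by
  have h : ∀ᵐ y, ∀ (j : Fin mesh.n) (k : Fin (n + 1 + 1)),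
      {s | linePt i y s ∈ ((mesh.simplex j).faceOpposite k).closedInterior}.Subsingleton := by
    refine ae_all_iff.2 fun j => ae_all_iff.2 fun k => ?_
    have := ae_linePt_subsingleton ((mesh.simplex j).faceOpposite k).points i
    rw [Affine.Simplex.convexHull_eq_closedInterior] at this
    exact this
  filter_upwards [h] with y hy
  refine ⟨⋃ j, ⋃ k, {s | linePt i y s ∈ ((mesh.simplex j).faceOpposite k).closedInterior},
    countable_iUnion fun j => countable_iUnion fun k => (hy j k).countable, fun s hs hsΩ => ?_⟩
  rw [← mesh.cover] at hsΩ
  obtain ⟨j, hj⟩ := mem_iUnion.1 hsΩ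
  refine ⟨j, ?_⟩
  rw [Affine.Simplex.closedInterior_eq_interior_union] at hj
  refine hj.resolve_right fun hk => hs ?_
  obtain ⟨k, hk⟩ := mem_iUnion.1 hk
  exact mem_iUnion₂.2 ⟨j, k, hk⟩

variable {mesh} {u : Vec (n + 1) → Vec (n + 1)} {deg : ℕ}

theorem MemSkVec.continuousOn (hu : MemSkVec mesh deg u) : ContinuousOn u (closure Ω) := by
  have h : ContinuousOn (fun x => WithLp.ofLp (u x)) (closure Ω) :=
    continuousOn_pi.2 fun i => (hu i).1
  exact (PiLp.continuous_toLp 2 _).comp_continuousOn h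

theorem MemSkVec.exists_smooth (hu : MemSkVec mesh deg u) (j : Fin mesh.n) :
    ∃ P : Vec (n + 1) → Vec (n + 1), ContDiff ℝ ∞ P ∧ EqOn u P (mesh.simplex j).interior := by
  choose p hp using fun i => (hu i).2 j
  refine ⟨fun x => WithLp.toLp 2 fun i => MvPolynomial.eval (fun k => x k) (p i), ?_,
    fun x hx => ?_⟩
  · refine contDiff_euclidean.2 fun i => ?_
    have h := AnalyticOnNhd.eval_continuousLinearMap
      (EuclideanSpace.equiv (Fin (n + 1)) ℝ).toContinuousLinearMap (p i)
    exact h.contDiff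
  · ext i
    exact (hp i).2 x hx

theorem MemSkVec.differentiableAt (hu : MemSkVec mesh deg u) {j : Fin mesh.n} {x : Vec (n + 1)}
    (hx : x ∈ (mesh.simplex j).interior) : DifferentiableAt ℝ u x := by
  obtain ⟨P, hP, heq⟩ := hu.exists_smooth j
  exact ((hP.differentiable (by simp)) x).congr_of_eventuallyEq
    (heq.eventuallyEq_of_mem ((mesh.isOpen_interior j).mem_nhds hx))

theorem MemSkVec.exists_fderiv_bound (hu : MemSkVec mesh deg u) :
    ∃ M, ∀ᵐ x ∂(volume : Measure (Vec (n + 1))), x ∈ closure Ω → ‖fderiv ℝ u x‖ ≤ M := by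
  have h : ∀ j, ∃ M, ∀ x ∈ (mesh.simplex j).interior, ‖fderiv ℝ u x‖ ≤ M := fun j => by
    obtain ⟨P, hP, heq⟩ := hu.exists_smooth j
    obtain ⟨M, hM⟩ := (mesh.simplex j).isCompact_closedInterior.exists_bound_of_continuousOn
      (hP.continuous_fderiv (by simp)).continuousOn
    refine ⟨M, fun x hx => ?_⟩
    have : u =ᶠ[𝓝 x] P := heq.eventuallyEq_of_mem ((mesh.isOpen_interior j).mem_nhds hx)
    rw [this.fderiv_eq]
    exact hM x ((mesh.simplex j).interior_subset_closedInterior hx)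
  choose M hM using h
  refine ⟨∑ j, |M j|, ?_⟩
  filter_upwards [mesh.ae_mem_interior] with x hx hxΩ
  obtain ⟨j, hj⟩ := hx hxΩ
  exact (hM j x hj).trans ((le_abs_self _).trans
    (Finset.single_le_sum (f := fun j => |M j|) (fun k _ => abs_nonneg _) (Finset.mem_univ j)))

theorem MemSkVec.integrableOn_fderiv (hu : MemSkVec mesh deg u) (hΩ : IsOpen Ω) :
    IntegrableOn (fderiv ℝ u) Ω := by
  obtain ⟨M, hM⟩ := hu.exists_fderiv_bound
  have hfin : IsFiniteMeasure ((volume : Measure (Vec (n + 1))).restrict Ω) :=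
    ⟨by rw [Measure.restrict_apply_univ]
        exact (measure_mono subset_closure).trans_lt mesh.isCompact_closure.measure_lt_top⟩
  refine Integrable.of_bound (measurable_fderiv ℝ u).aestronglyMeasurable M ?_
  rw [ae_restrict_iff' hΩ.measurableSet]
  filter_upwards [hM] with x hx hxΩ using hx (subset_closure hxΩ)

/-- The trace as a continuous linear functional. -/
noncomputable def traceCLM (d : ℕ) : (Vec d →L[ℝ] Vec d) →L[ℝ] ℝ :=
  ∑ i : Fin d, (EuclideanSpace.proj i).comp (ContinuousLinearMap.apply ℝ (Vec d) (unitVec i))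

theorem traceCLM_fderiv {d : ℕ} (u : Vec d → Vec d) (x : Vec d) :
    traceCLM d (fderiv ℝ u x) = divergence u x := by
  simp [traceCLM, divergence]

theorem integrableOn_fderiv_coord (hu : MemSkVec mesh deg u) (hΩ : IsOpen Ω) (v : Vec (n + 1))
    (i : Fin (n + 1)) : IntegrableOn (fun x => (fderiv ℝ u x v) i) Ω :=
  ((EuclideanSpace.proj i : Vec (n + 1) →L[ℝ] ℝ).comp
    (ContinuousLinearMap.apply ℝ (Vec (n + 1)) v)).integrable_comp (hu.integrableOn_fderiv hΩ)

end

section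

variable {n K J : ℕ} {facet : Fin J → Fin (n + 1) → Fin K} {q : Fin K → Vec (n + 1)}
  {Ω : Set (Vec (n + 1))}

/-- The divergence theorem for finite element fields: the interface may cut through the elements of
the bulk mesh in an arbitrary manner. -/
theorem IsPolyhedralInterface.setIntegral_divergence (h : IsPolyhedralInterface facet q Ω)
    (hΩ : IsOpen Ω) {mesh : BulkMesh (n + 1) Ω} {ν u : Vec (n + 1) → Vec (n + 1)} {deg : ℕ}
    (hν : IsOuterNormal facet q ν) (hu : MemSkVec mesh deg u) :
    ∫ x in inside facet q, divergence u x = surfaceInner facet q u ν := by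
  obtain ⟨N, hN, hν⟩ := hν.exists_facetNormal
  have hcl : closure (inside facet q) ⊆ closure Ω := closure_mono h.inside_subset
  have hb : Bornology.IsBounded (inside facet q) :=
    mesh.isCompact_closure.isBounded.subset (subset_closure.trans hcl)
  have hus : ContinuousOn u (surface facet q) :=
    hu.continuousOn.mono (h.surface_subset_closure.trans hcl)
  have hint : ∀ i, IntegrableOn (fun x => (fderiv ℝ u x (unitVec i)) i) (inside facet q) := fun i =>
    (integrableOn_fderiv_coord hu hΩ _ i).mono_set h.inside_subset
  have hcomp : ∀ i, ∫ x in inside facet q, (fderiv ℝ u x (unitVec i)) i =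
      ∑ j, N j i * |conormal (fun k => q (facet j k)) (N j)| *
        ∫ w in baryDomain n, u (facetMap (fun k => q (facet j k)) w) i := fun i => by
    refine h.setIntegral_inside hN hb i ((hu i).1.mono hcl) (hint i) ?_
    filter_upwards [mesh.ae_linePt_mem_interior i] with y hy
    obtain ⟨C, hC, hCs⟩ := hy
    refine ⟨C, hC, fun s hs hsi => ?_⟩
    obtain ⟨j, hj⟩ := hCs s hs (hcl (subset_closure hsi))
    have h1 := (hu.differentiableAt hj).hasFDerivAt
    have h3 := h1.comp_hasDerivAt s (hasDerivAt_linePt i y s)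
    exact (EuclideanSpace.proj i : Vec (n + 1) →L[ℝ] ℝ).hasFDerivAt.comp_hasDerivAt
      s h3
  simp only [divergence]
  rw [integral_finsetSum _ fun i _ => hint i, Finset.sum_congr rfl fun i _ => hcomp i,
    Finset.sum_comm, h.surfaceInner_normal hN hν hus]
  refine Finset.sum_congr rfl fun j _ => ?_
  have hinner : ∀ w, inner ℝ (u (facetMap (fun k => q (facet j k)) w)) (N j) =
      ∑ i, N j i * u (facetMap (fun k => q (facet j k)) w) i := fun w => by
    simp [PiLp.inner_apply]
  simp only [hinner]
  rw [integral_finsetSum _ fun i _ => ((integrableOn_facetMap (g := fun x => u x i)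
    (((hu i).1.mono (h.surface_subset_closure.trans hcl))) j).const_mul _), Finset.mul_sum]
  refine Finset.sum_congr rfl fun i _ => ?_
  rw [integral_const_mul]
  ring

end

/-! ### Vanishing mean of the divergence of an `H¹₀` field -/

/-- Convergence in `L²` of a finite measure implies weak convergence against bounded functions. -/
theorem tendsto_integral_smul_of_L2 {α E : Type*} [MeasurableSpace α] {μ : Measure α}
    [IsFiniteMeasure μ] [NormedAddCommGroup E] [NormedSpace ℝ E] {ψ : α → ℝ} {C : ℝ}
    (hψ : ∀ x, ‖ψ x‖ ≤ C) (hψm : AEStronglyMeasurable ψ μ) {φ : ℕ → α → E} {u : α → E}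
    (hφ : ∀ n, MemLp (φ n) 2 μ) (hu : MemLp u 2 μ)
    (h : Tendsto (fun n => eLpNorm (φ n - u) 2 μ) atTop (𝓝 0)) :
    Tendsto (fun n => ∫ x, ψ x • φ n x ∂μ) atTop (𝓝 (∫ x, ψ x • u x ∂μ)) := by
  refine tendsto_integral_of_L1' (fun x => ψ x • u x) (hψm.smul hu.1)
    (Eventually.of_forall fun n => ?_) ?_
  · exact ((hφ n).integrable one_le_two).bdd_smul C hψm (Eventually.of_forall hψ)
  · have hbound : ∀ n, eLpNorm ((fun x => ψ x • φ n x) - fun x => ψ x • u x) 1 μ ≤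
        ENNReal.ofReal C * (μ univ ^ (1 / (1 : ENNReal).toReal - 1 / (2 : ENNReal).toReal)) *
          eLpNorm (φ n - u) 2 μ := fun n => by
      have h1 : eLpNorm ((fun x => ψ x • φ n x) - fun x => ψ x • u x) 1 μ ≤
          ENNReal.ofReal C * eLpNorm (φ n - u) 1 μ := by
        refine eLpNorm_le_mul_eLpNorm_of_ae_le_mul (Eventually.of_forall fun x => ?_) 1
        simp only [Pi.sub_apply, ← smul_sub, norm_smul]
        exact mul_le_mul_of_nonneg_right (hψ x) (norm_nonneg _)
      have h2 := eLpNorm_le_eLpNorm_mul_rpow_measure_univ (μ := μ) (f := φ n - u) one_le_two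
        ((hφ n).1.sub hu.1)
      calc _ ≤ _ := h1
        _ ≤ ENNReal.ofReal C * (eLpNorm (φ n - u) 2 μ *
            μ univ ^ (1 / (1 : ENNReal).toReal - 1 / (2 : ENNReal).toReal)) := by gcongr
        _ = _ := by ring
    refine tendsto_of_tendsto_of_tendsto_of_le_of_le tendsto_const_nhds ?_ (fun _ => zero_le) hbound
    have hfin : ENNReal.ofReal C *
        (μ univ ^ (1 / (1 : ENNReal).toReal - 1 / (2 : ENNReal).toReal)) ≠ ⊤ :=
      ENNReal.mul_ne_top ENNReal.ofReal_ne_top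
        (ENNReal.rpow_ne_top_of_nonneg (by norm_num) (measure_ne_top μ _))
    simpa using ENNReal.Tendsto.const_mul h (Or.inr hfin)

theorem integral_fderiv_eq_zero_of_hasCompactSupport {d : ℕ} {φ : Vec d → Vec d}
    (hφ : ContDiff ℝ ∞ φ) (hs : HasCompactSupport φ) : ∫ x, fderiv ℝ φ x = 0 := by
  have hc : Continuous (fderiv ℝ φ) := hφ.continuous_fderiv (by simp)
  have hint : Integrable (fderiv ℝ φ) := hc.integrable_of_hasCompactSupport (hs.fderiv ℝ)
  ext1 v
  rw [ContinuousLinearMap.integral_apply hint]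
  have h := integral_smul_fderiv_eq_neg_fderiv_smul_of_integrable (μ := volume)
    (f := fun _ : Vec d => (1 : ℝ)) (g := φ) (v := v) (by simp)
    (by simpa using hint.apply_continuousLinearMap v)
    (by simpa using hφ.continuous.integrable_of_hasCompactSupport hs)
    (fun x _ => differentiableAt_const _) (fun x _ => hφ.differentiable (by simp) x)
  simpa using h

section

variable {n : ℕ} {Ω : Set (Vec (n + 1))} {mesh : BulkMesh (n + 1) Ω}
  {u : Vec (n + 1) → Vec (n + 1)} {deg : ℕ}

/-- On the open elements the weak gradient `G` of a piecewise polynomial field is its classical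
gradient, and the mean of the weak gradient of an `H¹₀` field vanishes. -/
theorem integral_fderiv_eq_zero_of_memH10 (hu : MemSkVec mesh deg u) (hΩ : IsOpen Ω)
    (h0 : MemH10 Ω u) : ∫ x in Ω, fderiv ℝ u x = 0 := by
  obtain ⟨hu2, G, hG2, φ, hφ, hφu, hφG⟩ := h0
  have hfin : IsFiniteMeasure ((volume : Measure (Vec (n + 1))).restrict Ω) :=
    ⟨by rw [Measure.restrict_apply_univ]
        exact (measure_mono subset_closure).trans_lt mesh.isCompact_closure.measure_lt_top⟩
  have hφ2 : ∀ k, MemLp (φ k) 2 (volume.restrict Ω) := fun k =>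
    ((hφ k).1.continuous.memLp_of_hasCompactSupport (hφ k).2.1).restrict _
  have hφd : ∀ k, Continuous (fderiv ℝ (φ k)) := fun k => (hφ k).1.continuous_fderiv (by simp)
  have hφd2 : ∀ k, MemLp (fderiv ℝ (φ k)) 2 (volume.restrict Ω) := fun k =>
    ((hφd k).memLp_of_hasCompactSupport ((hφ k).2.1.fderiv ℝ)).restrict _
  have hui := hu.integrableOn_fderiv hΩ
  have hGi : IntegrableOn G Ω := hG2.integrable one_le_two
  have hG0 : ∫ x in Ω, G x = 0 := by
    have h1 := tendsto_integral_smul_of_L2 (ψ := fun _ => (1 : ℝ)) (C := 1) (by simp)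
      aestronglyMeasurable_const hφd2 hG2 hφG
    have h2 : ∀ k, ∫ x in Ω, fderiv ℝ (φ k) x = 0 := fun k => by
      rw [setIntegral_eq_integral_of_forall_compl_eq_zero,
        integral_fderiv_eq_zero_of_hasCompactSupport (hφ k).1 (hφ k).2.1]
      intro x hx
      exact image_eq_zero_of_notMem_tsupport fun hx' =>
        hx ((hφ k).2.2 (tsupport_fderiv_subset ℝ hx'))
    simp only [one_smul, h2] at h1
    exact (tendsto_nhds_unique h1 tendsto_const_nhds)
  -- on each element `u` is smooth, so that integration by parts identifies its gradient with `G`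
  have hweak : ∀ j, ∀ᵐ x, x ∈ (mesh.simplex j).interior → fderiv ℝ u x - G x = 0 := by
    intro j
    refine (mesh.isOpen_interior j).ae_eq_zero_of_integral_contDiff_smul_eq_zero
      (((hui.sub hGi).mono_set (mesh.subset j)).locallyIntegrableOn) fun ψ hψ hψc hψs => ?_
    have hψΩ : tsupport ψ ⊆ Ω := hψs.trans (mesh.subset j)
    have hψ0 : ∀ x ∉ Ω, ψ x = 0 := fun x hx =>
      image_eq_zero_of_notMem_tsupport fun hx' => hx (hψΩ hx')
    obtain ⟨C, hC⟩ := hψ.continuous.bounded_above_of_compact_support hψc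
    have hψm : AEStronglyMeasurable ψ (volume.restrict Ω) :=
      hψ.continuous.aestronglyMeasurable
    rw [← setIntegral_eq_integral_of_forall_compl_eq_zero (s := Ω)
      (fun x hx => by rw [hψ0 x hx]; exact zero_smul ℝ (fderiv ℝ u x - G x))]
    have hsplit : ∀ F : Vec (n + 1) → Vec (n + 1) →L[ℝ] Vec (n + 1), IntegrableOn F Ω →
        Integrable (fun x => ψ x • F x) (volume.restrict Ω) := fun F hF =>
      hF.bdd_smul C hψm (Eventually.of_forall hC)
    simp only [smul_sub]
    rw [integral_sub (hsplit _ hui) (hsplit _ hGi), sub_eq_zero]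
    ext1 v
    rw [ContinuousLinearMap.integral_apply (hsplit _ hui),
      ContinuousLinearMap.integral_apply (hsplit _ hGi)]
    simp only [_root_.smul_apply]
    have hψd : Continuous fun x => fderiv ℝ ψ x v :=
      (hψ.continuous_fderiv (by simp)).clm_apply continuous_const
    have hψdc : HasCompactSupport fun x => fderiv ℝ ψ x v := hψc.fderiv_apply ℝ v
    have hψd0 : ∀ x ∉ Ω, fderiv ℝ ψ x v = 0 := fun x hx => by
      have : fderiv ℝ ψ x = 0 := image_eq_zero_of_notMem_tsupport fun hx' =>
        hx (hψΩ (tsupport_fderiv_subset ℝ hx'))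
      rw [this]; rfl
    obtain ⟨C', hC'⟩ := hψd.bounded_above_of_compact_support hψdc
    have hparts : ∀ g : Vec (n + 1) → Vec (n + 1), IntegrableOn g Ω →
        IntegrableOn (fderiv ℝ g) Ω → (∀ x ∈ tsupport ψ, DifferentiableAt ℝ g x) →
        ∫ x in Ω, ψ x • fderiv ℝ g x v = -∫ x in Ω, fderiv ℝ ψ x v • g x := by
      intro g hg hg' hgd
      have key : ∀ (a : Vec (n + 1) → ℝ) (b : Vec (n + 1) → Vec (n + 1)) (M : ℝ),
          Continuous a → (∀ x, ‖a x‖ ≤ M) → (∀ x ∉ Ω, a x = 0) → IntegrableOn b Ω →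
          Integrable fun x => a x • b x := by
        intro a b M ha hM ha0 hb
        refine (integrableOn_iff_integrable_of_support_subset fun x hx => ?_).1
          (Integrable.bdd_smul (μ := volume.restrict Ω) hb M ha.aestronglyMeasurable
            (Eventually.of_forall hM))
        by_contra hxΩ
        exact hx (by simp only [ha0 x hxΩ, zero_smul])
      rw [setIntegral_eq_integral_of_forall_compl_eq_zero
          (fun x hx => by rw [hψ0 x hx, zero_smul]),
        setIntegral_eq_integral_of_forall_compl_eq_zero
          (fun x hx => by rw [hψd0 x hx, zero_smul])]
      exact integral_smul_fderiv_eq_neg_fderiv_smul_of_integrable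
        (key _ _ C' hψd hC' hψd0 hg) (key _ _ C hψ.continuous hC hψ0
          (hg'.apply_continuousLinearMap v)) (key _ _ C hψ.continuous hC hψ0 hg)
        (fun x _ => hψ.differentiable (by simp) x) hgd
    have hlim1 := tendsto_integral_smul_of_L2 hC' hψd.aestronglyMeasurable hφ2 hu2 hφu
    have hlim2 := tendsto_integral_smul_of_L2 hC hψm hφd2 hG2 hφG
    have hlim3 := ((ContinuousLinearMap.apply ℝ (Vec (n + 1)) v).continuous.tendsto _).comp hlim2
    have h1 : ∀ k, (ContinuousLinearMap.apply ℝ (Vec (n + 1)) v)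
        (∫ x in Ω, ψ x • fderiv ℝ (φ k) x) = -∫ x in Ω, fderiv ℝ ψ x v • φ k x := fun k => by
      have hi : IntegrableOn (fderiv ℝ (φ k)) Ω := (hφd2 k).integrable one_le_two
      rw [ContinuousLinearMap.apply_apply, ContinuousLinearMap.integral_apply (hsplit _ hi)]
      exact hparts _ ((hφ2 k).integrable one_le_two) hi
        fun x _ => (hφ k).1.differentiable (by simp) x
    simp only [Function.comp_def, h1] at hlim3
    have h2 := tendsto_nhds_unique hlim3 hlim1.neg
    rw [ContinuousLinearMap.apply_apply, ContinuousLinearMap.integral_apply (hsplit _ hGi)] at h2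
    simp only [_root_.smul_apply] at h2
    rw [h2]
    exact hparts u (hu2.integrable one_le_two) hui fun x hx => hu.differentiableAt (hψs hx)
  have hae : ∀ᵐ x ∂(volume.restrict Ω), fderiv ℝ u x = G x := by
    rw [ae_restrict_iff' hΩ.measurableSet]
    filter_upwards [ae_all_iff.2 hweak, mesh.ae_mem_interior] with x hx hx' hxΩ
    obtain ⟨j, hj⟩ := hx' (subset_closure hxΩ)
    exact sub_eq_zero.1 (hx j hj)
  rw [integral_congr_ae hae, hG0]

theorem integrableOn_divergence (hu : MemSkVec mesh deg u) (hΩ : IsOpen Ω) :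
    IntegrableOn (divergence u) Ω := by
  have := (traceCLM (n + 1)).integrable_comp (hu.integrableOn_fderiv hΩ)
  simp only [traceCLM_fderiv] at this
  exact this

theorem integral_divergence_eq_zero_of_memH10 (hu : MemSkVec mesh deg u) (hΩ : IsOpen Ω)
    (h0 : MemH10 Ω u) : ∫ x in Ω, divergence u x = 0 := by
  have h := (traceCLM (n + 1)).integral_comp_comm (hu.integrableOn_fderiv hΩ)
  rw [integral_fderiv_eq_zero_of_memH10 hu hΩ h0, map_zero] at h
  simpa only [traceCLM_fderiv] using h

/-- If the characteristic function of `A` is an admissible pressure, then a discretely divergence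
free velocity has no net flux out of `A`: its mean value over `Ω` can be subtracted from the
characteristic function since the velocity vanishes on the boundary of `Ω`. -/
theorem FESpaces.setIntegral_divergence_eq_zero {F : FESpaces (n + 1) Ω} (hΩ : IsOpen Ω)
    (hΩne : Ω.Nonempty) {A : Set (Vec (n + 1))} (hA : MeasurableSet A) (hAΩ : A ⊆ Ω)
    (hchar : F.CharMem A) (hu : u ∈ F.U)
    (hinc : ∀ φ ∈ F.P, ∫ x in Ω, φ x = 0 → ∫ x in Ω, divergence u x * φ x = 0) :
    ∫ x in A, divergence u x = 0 := by
  obtain ⟨χ, hχ, hχA⟩ := hchar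
  obtain ⟨e, he, he1⟩ := F.const_mem
  have hfin : volume Ω < ⊤ :=
    (measure_mono subset_closure).trans_lt F.mesh.isCompact_closure.measure_lt_top
  have hpos : volume.real Ω ≠ 0 :=
    (ENNReal.toReal_pos (hΩ.measure_pos volume hΩne).ne' hfin.ne).ne'
  have hdiv := integrableOn_divergence (F.U_piecewise u hu) hΩ
  -- the mean value of the characteristic function of `A` over `Ω`
  set m : ℝ := volume.real A / volume.real Ω
  have hae : ∀ᵐ x ∂(volume.restrict Ω), (χ - m • e : Lp ℝ 2 (volume.restrict Ω)) x =
      A.indicator (fun _ => (1 : ℝ)) x - m := by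
    filter_upwards [hχA, he1, Lp.coeFn_sub χ (m • e), Lp.coeFn_smul m e] with x h1 h2 h3 h4
    rw [h3, Pi.sub_apply, h4, Pi.smul_apply, h1, h2, smul_eq_mul, mul_one]
  have hind : ∀ g : Vec (n + 1) → ℝ, ∫ x in Ω, A.indicator g x = ∫ x in A, g x := fun g => by
    rw [setIntegral_indicator hA, inter_eq_right.2 hAΩ]
  have hfinm : IsFiniteMeasure ((volume : Measure (Vec (n + 1))).restrict Ω) :=
    ⟨by rwa [Measure.restrict_apply_univ]⟩
  have hmean : ∫ x in Ω, (χ - m • e : Lp ℝ 2 (volume.restrict Ω)) x = 0 := by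
    rw [integral_congr_ae hae, integral_sub ((integrable_const _).indicator hA)
      (integrable_const _), hind]
    simp only [integral_const, smul_eq_mul, mul_one, measureReal_restrict_apply_univ, m]
    field_simp
    ring
  have h := hinc _ (F.P.sub_mem hχ (F.P.smul_mem m he)) hmean
  have hae2 : ∀ᵐ x ∂(volume.restrict Ω),
      divergence u x * (χ - m • e : Lp ℝ 2 (volume.restrict Ω)) x =
        A.indicator (divergence u) x - divergence u x * m := by
    filter_upwards [hae] with x hx
    rw [hx]
    by_cases hxA : x ∈ A <;> simp [hxA, mul_sub]
  rw [integral_congr_ae hae2, integral_sub (hdiv.indicator hA) (hdiv.mul_const _), hind,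
    integral_mul_const, integral_divergence_eq_zero_of_memH10 (F.U_piecewise u hu) hΩ
      (F.U_H10 u hu), zero_mul, sub_zero] at h
  exact h

end

/-! ### The enclosed volume as a polynomial in the vertices -/

section

variable {n K J : ℕ} {facet : Fin J → Fin (n + 1) → Fin K} {q : Fin K → Vec (n + 1)}
  {Ω : Set (Vec (n + 1))}

/-- The orientation of a facet: the sign of the conormal functional, which depends on the numbering
of the vertices, on the given normal. -/
noncomputable def facetSign (facet : Fin J → Fin (n + 1) → Fin K) (q : Fin K → Vec (n + 1))
    (j : Fin J) (m : Vec (n + 1)) : ℝ :=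
  (SignType.sign (conormal (fun k => q (facet j k)) m) : ℝ)

theorem IsPolyhedralInterface.abs_conormal_mul_inner (h : IsPolyhedralInterface facet q Ω)
    {j : Fin J} {m : Vec (n + 1)} (hm : IsFacetNormal facet q j m) (v : Vec (n + 1)) :
    |conormal (fun k => q (facet j k)) m| * inner ℝ m v =
      facetSign facet q j m * conormal (fun k => q (facet j k)) v := by
  rw [conormal_eq_mul_inner (h.nondegenerate j) hm.norm_eq hm.orth v, facetSign, ← mul_assoc,
    sign_mul_self]

/-- The divergence theorem for continuously differentiable fields. -/
theorem IsPolyhedralInterface.setIntegral_divergence_of_contDiff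
    (h : IsPolyhedralInterface facet q Ω) {N : Fin J → Vec (n + 1)}
    (hN : ∀ j, IsFacetNormal facet q j (N j)) (hb : Bornology.IsBounded (inside facet q))
    {φ : Vec (n + 1) → Vec (n + 1)} (hφ : ContDiff ℝ 1 φ) :
    ∫ x in inside facet q, divergence φ x = ∑ j, facetSign facet q j (N j) *
      ∫ w in baryDomain n, conormal (fun k => q (facet j k))
        (φ (facetMap (fun k => q (facet j k)) w)) := by
  have hc : ∀ i, Continuous fun x => (fderiv ℝ φ x (unitVec i)) i := fun i =>
    (EuclideanSpace.proj i : Vec (n + 1) →L[ℝ] ℝ).continuous.comp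
      ((hφ.continuous_fderiv one_ne_zero).clm_apply continuous_const)
  have hint : ∀ i, IntegrableOn (fun x => (fderiv ℝ φ x (unitVec i)) i) (inside facet q) := fun i =>
    ((hc i).continuousOn.integrableOn_compact hb.isCompact_closure).mono_set subset_closure
  have hφi : ∀ i, Continuous fun x => φ x i := fun i =>
    (EuclideanSpace.proj i : Vec (n + 1) →L[ℝ] ℝ).continuous.comp hφ.continuous
  have hcomp : ∀ i, ∫ x in inside facet q, (fderiv ℝ φ x (unitVec i)) i =
      ∑ j, N j i * |conormal (fun k => q (facet j k)) (N j)| *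
        ∫ w in baryDomain n, φ (facetMap (fun k => q (facet j k)) w) i := fun i => by
    refine h.setIntegral_inside hN hb i (hφi i).continuousOn (hint i) ?_
    refine Eventually.of_forall fun y => ⟨∅, countable_empty, fun s _ _ => ?_⟩
    exact (EuclideanSpace.proj i : Vec (n + 1) →L[ℝ] ℝ).hasFDerivAt.comp_hasDerivAt s
      ((hφ.differentiable one_ne_zero _).hasFDerivAt.comp_hasDerivAt s (hasDerivAt_linePt i y s))
  simp only [divergence]
  rw [integral_finsetSum _ fun i _ => hint i, Finset.sum_congr rfl fun i _ => hcomp i,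
    Finset.sum_comm]
  refine Finset.sum_congr rfl fun j _ => ?_
  have hinner : ∀ w, facetSign facet q j (N j) * conormal (fun k => q (facet j k))
      (φ (facetMap (fun k => q (facet j k)) w)) =
      ∑ i, N j i * |conormal (fun k => q (facet j k)) (N j)| *
        φ (facetMap (fun k => q (facet j k)) w) i := fun w => by
    rw [← h.abs_conormal_mul_inner (hN j)]
    simp only [PiLp.inner_apply, Finset.mul_sum]
    refine Finset.sum_congr rfl fun i _ => ?_
    simp only [RCLike.inner_apply, conj_trivial]
    ring
  rw [← integral_const_mul]
  simp only [hinner]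
  rw [integral_finsetSum _ fun i _ => ((integrableOn_facetMap (g := fun x => φ x i)
    (hφi i).continuousOn j).const_mul _)]
  refine Finset.sum_congr rfl fun i _ => ?_
  rw [integral_const_mul]

/-- The volume enclosed by the interface, as the signed volume of the cones over the facets. -/
theorem IsPolyhedralInterface.volume_inside (h : IsPolyhedralInterface facet q Ω)
    {N : Fin J → Vec (n + 1)} (hN : ∀ j, IsFacetNormal facet q j (N j))
    (hb : Bornology.IsBounded (inside facet q)) :
    volume.real (inside facet q) = volume.real (baryDomain n) / (n + 1) *
      ∑ j, facetSign facet q j (N j) * conormal (fun k => q (facet j k)) (q (facet j 0)) := by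
  have hdiv := h.setIntegral_divergence_of_contDiff hN hb (φ := id) contDiff_id
  have h1 : ∀ x : Vec (n + 1), divergence id x = (n + 1 : ℝ) := fun x => by
    simp [divergence]
  simp only [h1, integral_const, smul_eq_mul, measureReal_restrict_apply_univ, id_eq] at hdiv
  have h2 : ∀ j w, conormal (fun k => q (facet j k)) (facetMap (fun k => q (facet j k)) w) =
      conormal (fun k => q (facet j k)) (q (facet j 0)) := fun j w => by
    rw [facetMap, map_add, conormal_edgeMap, add_zero]
  simp only [h2, integral_const, smul_eq_mul, measureReal_restrict_apply_univ] at hdiv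
  have hn : (n : ℝ) + 1 ≠ 0 := by positivity
  rw [div_mul_eq_mul_div, eq_div_iff hn, hdiv, Finset.mul_sum]
  exact Finset.sum_congr rfl fun j _ => by ring

/-- The flux of a piecewise affine field in a form that is polynomial in the vertices. -/
theorem IsPolyhedralInterface.surfaceInner_normal_eq_conormal (h : IsPolyhedralInterface facet q Ω)
    {N : Fin J → Vec (n + 1)} (hN : ∀ j, IsFacetNormal facet q j (N j))
    {ν v : Vec (n + 1) → Vec (n + 1)} (hν : ∀ j, ∀ x ∈ openFacet facet q j, ν x = N j)
    (hv : MemSurfaceP1 facet q v) :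
    surfaceInner facet q v ν = volume.real (baryDomain n) / (n + 1) *
      ∑ j, facetSign facet q j (N j) *
        ∑ i, conormal (fun k => q (facet j k)) (v (q (facet j i))) := by
  rw [h.surfaceInner_normal_of_affine hN hν hv]
  congr 1
  refine Finset.sum_congr rfl fun j _ => ?_
  rw [Finset.mul_sum, Finset.mul_sum]
  refine Finset.sum_congr rfl fun i _ => ?_
  rw [real_inner_comm, h.abs_conormal_mul_inner (hN j)]

end

/-! ### Stability of the orientation -/

section

variable {d K J : ℕ} {facet : Fin J → Fin d → Fin K}

theorem closedFacet_subset_thickening {q q' : Fin K → Vec d} {ε : ℝ}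
    (hq : ∀ k, dist (q k) (q' k) < ε) (j : Fin J) :
    closedFacet facet q j ⊆ Metric.thickening ε (closedFacet facet q' j) := by
  refine convexHull_min ?_ ((convex_convexHull ℝ _).thickening ε)
  rintro _ ⟨i, rfl⟩
  exact Metric.mem_thickening_iff.2 ⟨q' (facet j i), subset_convexHull ℝ _ (mem_range_self i), hq _⟩

theorem eventually_dist_lt (q : Fin K → Vec d) {ε : ℝ} (hε : 0 < ε) :
    ∀ᶠ q' in 𝓝 q, ∀ k, dist (q' k) (q k) < ε := by
  filter_upwards [Metric.ball_mem_nhds q hε] with q' hq' k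
  exact (dist_le_pi_dist q' q k).trans_lt hq'

/-- A point of the exterior remains in the exterior under small perturbations of the vertices, since
a path to infinity that avoids the interface still avoids the perturbed interface. -/
theorem eventually_mem_outside {q : Fin K → Vec d} {z : Vec d} (hz : z ∈ outside facet q) :
    ∀ᶠ q' in 𝓝 q, z ∈ outside facet q' := by
  have hop : IsOpen (surface facet q)ᶜ := (isCompact_surface facet q).isClosed.isOpen_compl
  set C := connectedComponentIn (surface facet q)ᶜ z
  have hzC : z ∈ C := mem_connectedComponentIn hz.1
  have hCo : IsOpen C := hop.connectedComponentIn
  have hCp : IsPathConnected C :=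
    hCo.isConnected_iff_isPathConnected.1 ⟨⟨z, hzC⟩, isPreconnected_connectedComponentIn⟩
  obtain ⟨R, hR⟩ := (isCompact_surface facet q).isBounded.exists_norm_le
  obtain ⟨z', hz'C, hz'⟩ : ∃ z' ∈ C, |R| + 1 < ‖z'‖ := by
    by_contra hcon
    push Not at hcon
    exact hz.2 (isBounded_iff_forall_norm_le.2 ⟨|R| + 1, hcon⟩)
  obtain ⟨γ, hγ⟩ := hCp.joinedIn z hzC z' hz'C
  have hγc : IsCompact (range γ) := isCompact_range γ.continuous
  have hγd : Disjoint (range γ) (surface facet q) := by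
    refine disjoint_left.2 ?_
    rintro _ ⟨t, rfl⟩ ht
    exact connectedComponentIn_subset _ _ (hγ t) ht
  obtain ⟨δ, hδ, hdisj⟩ := hγd.exists_thickenings hγc (isCompact_surface facet q).isClosed
  filter_upwards [eventually_dist_lt q (lt_min hδ one_pos)] with q' hq'
  have hsub : surface facet q' ⊆ Metric.thickening (min δ 1) (surface facet q) := by
    refine iUnion_subset fun j => (closedFacet_subset_thickening hq' j).trans ?_
    exact Metric.thickening_subset_of_subset _ (closedFacet_subset_surface facet q j)
  have hγq : range γ ⊆ (surface facet q')ᶜ := fun x hx hxs =>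
    disjoint_left.1 hdisj (Metric.self_subset_thickening hδ _ hx)
      (Metric.thickening_mono (min_le_left _ _) _ (hsub hxs))
  have hbound : ∀ x ∈ surface facet q', ‖x‖ < R + 1 := fun x hx => by
    obtain ⟨y, hy, hxy⟩ := Metric.mem_thickening_iff.1 (hsub hx)
    have h1 : ‖x - y‖ < 1 := by
      rw [← dist_eq_norm]; exact hxy.trans_le (min_le_right _ _)
    have h2 := hR y hy
    have h3 : ‖x‖ ≤ ‖x - y‖ + ‖y‖ := by simpa using norm_add_le (x - y) y
    linarith
  -- the ray from `z'` to infinity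
  have hray : (fun s : ℝ => s • z') '' Ici 1 ⊆ (surface facet q')ᶜ := by
    rintro _ ⟨s, hs, rfl⟩ hmem
    have h1 := hbound _ hmem
    rw [norm_smul, Real.norm_eq_abs, abs_of_nonneg (zero_le_one.trans hs)] at h1
    have h2 : ‖z'‖ ≤ s * ‖z'‖ := le_mul_of_one_le_left (norm_nonneg _) hs
    linarith [le_abs_self R]
  have hz'γ : z' ∈ range γ := ⟨1, γ.target⟩
  have hz'ray : z' ∈ (fun s : ℝ => s • z') '' Ici 1 := ⟨1, mem_Ici.2 le_rfl, one_smul _ _⟩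
  have hconn : IsPreconnected (range γ ∪ (fun s : ℝ => s • z') '' Ici 1) :=
    (isPreconnected_range γ.continuous).union z' hz'γ hz'ray
      (isPreconnected_Ici.image _ (by fun_prop))
  have hzγ : z ∈ range γ := ⟨0, γ.source⟩
  refine ⟨hγq hzγ, fun hbdd => ?_⟩
  have hsubC := hconn.subset_connectedComponentIn (Or.inl hzγ) (union_subset hγq hray)
  obtain ⟨B, hB⟩ := (hbdd.subset (subset_union_right.trans hsubC)).exists_norm_le
  have hz'pos : 0 < ‖z'‖ := (by positivity : (0 : ℝ) < |R| + 1).trans hz'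
  have h1 := hB ((|B| / ‖z'‖ + 1) • z')
    ⟨_, by simp only [mem_Ici, le_add_iff_nonneg_left]; positivity, rfl⟩
  rw [norm_smul, Real.norm_eq_abs, abs_of_nonneg (by positivity), add_mul,
    div_mul_cancel₀ _ hz'pos.ne'] at h1
  linarith [le_abs_self B]

end

section

variable {n K J : ℕ} {facet : Fin J → Fin (n + 1) → Fin K} {q : Fin K → Vec (n + 1)}
  {Ω : Set (Vec (n + 1))}

theorem continuous_conormal (facet : Fin J → Fin (n + 1) → Fin K) (j : Fin J)
    {v : (Fin K → Vec (n + 1)) → Vec (n + 1)} (hv : Continuous v) :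
    Continuous fun q : Fin K → Vec (n + 1) => conormal (fun k => q (facet j k)) (v q) := by
  simp only [conormal_apply]
  refine Continuous.matrix_det (continuous_matrix fun a b => ?_)
  refine Fin.cases ?_ (fun a => ?_) a
  · simp only [Matrix.of_apply, Fin.cons_zero]
    fun_prop
  · simp only [Matrix.of_apply, Fin.cons_succ]
    fun_prop

/-- The orientations of the facets are locally constant along a family of interfaces: near the
barycentre of a facet the exterior side is stable, and the other side is then the interior side. -/
theorem IsPolyhedralInterface.eventually_facetSign_eq (h : IsPolyhedralInterface facet q Ω)
    {j : Fin J} {m : Vec (n + 1)} (hm : IsFacetNormal facet q j m) :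
    ∀ᶠ q' in 𝓝 q, IsPolyhedralInterface facet q' Ω → ∀ m', IsFacetNormal facet q' j m' →
      facetSign facet q' j m' = facetSign facet q j m := by
  let b : (Fin K → Vec (n + 1)) → Vec (n + 1) := fun q => ∑ i, (n + 1 : ℝ)⁻¹ • q (facet j i)
  have hbc : Continuous b := by fun_prop
  have hbm : ∀ q, b q ∈ openFacet facet q j := fun q => by
    have hn : (n : ℝ) + 1 ≠ 0 := by positivity
    refine ⟨fun _ => (n + 1 : ℝ)⁻¹, fun _ => by positivity, ?_, rfl⟩
    simp [hn]
  obtain ⟨r, hr, hball⟩ := h.exists_ball (hbm q)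
  have htend : Tendsto (fun ε : ℝ => b q + ε • m) (𝓝[>] 0) (𝓝 (b q)) := by
    have : Continuous fun ε : ℝ => b q + ε • m := by fun_prop
    have h2 := this.tendsto 0
    simp only [zero_smul, add_zero] at h2
    exact h2.mono_left nhdsWithin_le_nhds
  -- a point `z` of the exterior close to the barycentre, which remains in the exterior of the
  -- perturbed interface and on the same side of the `j`-th facet
  obtain ⟨ε, ⟨hzo, hzb⟩, hε⟩ := (((hm.outward _ (hbm q)).and (htend.eventually
    (Metric.ball_mem_nhds _ (half_pos hr)))).and self_mem_nhdsWithin).exists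
  have hε : 0 < ε := hε
  set z := b q + ε • m with hz
  have hne := conormal_ne_zero (h.nondegenerate j) hm.norm_eq hm.orth
  have hpos : 0 < conormal (fun k => q (facet j k)) (z - b q) *
      conormal (fun k => q (facet j k)) m := by
    rw [hz, add_sub_cancel_left, map_smul, smul_eq_mul, mul_assoc]
    exact mul_pos hε (mul_self_pos.2 hne)
  have hev : ∀ᶠ q' in 𝓝 q, 0 < conormal (fun k => q' (facet j k)) (z - b q') *
      conormal (fun k => q (facet j k)) m :=
    ((continuous_conormal facet j (v := fun q' => z - b q') (by fun_prop)).mul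
      continuous_const).continuousAt.eventually (lt_mem_nhds hpos)
  filter_upwards [hev, eventually_mem_outside hzo, eventually_dist_lt q (half_pos hr),
    hbc.continuousAt.eventually (Metric.ball_mem_nhds (b q) (half_pos hr))]
    with q' h1 h2 h3 h4 hq' m' hm'
  have hball' : ∀ i, i ≠ j → Disjoint (Metric.ball (b q) (r / 2)) (closedFacet facet q' i) := by
    intro i hi
    refine disjoint_left.2 fun x hx hxi => ?_
    obtain ⟨y, hy, hxy⟩ := Metric.mem_thickening_iff.1 (closedFacet_subset_thickening h3 i hxi)
    refine disjoint_left.1 (hball i hi) ?_ hy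
    have h5 := dist_triangle_left y (b q) x
    rw [Metric.mem_ball] at hx ⊢
    linarith
  obtain ⟨-, hin⟩ := hq'.sides hm'.norm_eq hm'.orth hball' (hbm q') h4 (hm'.outward _ (hbm q'))
  have hc := conormal_eq_mul_inner (hq'.nondegenerate j) hm'.norm_eq hm'.orth (z - b q')
  rw [hc] at h1
  -- `z` lies on the outer side of the perturbed facet, since the inner side is in the interior
  have hip : 0 < inner ℝ m' (z - b q') := by
    rcases lt_trichotomy (inner ℝ m' (z - b q')) 0 with hlt | heq | hgt
    · exact absurd h2 (disjoint_left.1 (disjoint_inside_outside facet q') (hin z hzb hlt))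
    · rw [heq] at h1; simp at h1
    · exact hgt
  have hprod : 0 < conormal (fun k => q' (facet j k)) m' * conormal (fun k => q (facet j k)) m := by
    by_contra hcon
    have := mul_nonpos_of_nonpos_of_nonneg (not_lt.1 hcon) hip.le
    nlinarith
  rw [facetSign, facetSign]
  congr 1
  rcases pos_and_pos_or_neg_and_neg_of_mul_pos hprod with ⟨ha, hb⟩ | ⟨ha, hb⟩
  · rw [sign_pos ha, sign_pos hb]
  · rw [sign_neg ha, sign_neg hb]

end

/-! ### Divergence-free fields and integrals along edges -/

section

variable {d : ℕ}

/-- The field `(v · ∇ζ) a - (a · ∇ζ) v`, which is divergence free and whose flux through a facet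
involves tangential derivatives of `ζ` only. -/
noncomputable def curlField (ζ : Vec d → ℝ) (a v : Vec d) (x : Vec d) : Vec d :=
  fderiv ℝ ζ x v • a - fderiv ℝ ζ x a • v

theorem contDiff_curlField {ζ : Vec d → ℝ} (hζ : ContDiff ℝ ∞ ζ) (a v : Vec d) :
    ContDiff ℝ 1 (curlField ζ a v) := by
  have h : ∀ b : Vec d, ContDiff ℝ 1 fun x => fderiv ℝ ζ x b := fun b =>
    (hζ.fderiv_right (m := 1) (by norm_cast)).clm_apply contDiff_const
  exact ((h v).smul contDiff_const).sub ((h a).smul contDiff_const)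

theorem apply_eq_sum_unitVec (L : Vec d →L[ℝ] ℝ) (e : Vec d) :
    L e = ∑ i, e i * L (unitVec i) := by
  conv_lhs => rw [← (EuclideanSpace.basisFun (Fin d) ℝ).sum_repr e]
  simp [map_sum]

theorem divergence_curlField {ζ : Vec d → ℝ} (hζ : ContDiff ℝ ∞ ζ) (a v x : Vec d) :
    divergence (curlField ζ a v) x = 0 := by
  have hD : DifferentiableAt ℝ (fderiv ℝ ζ) x :=
    ((hζ.fderiv_right (m := 1) (by norm_cast)).differentiable one_ne_zero) x
  have h : ∀ b : Vec d, HasFDerivAt (fun x => fderiv ℝ ζ x b)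
      ((ContinuousLinearMap.apply ℝ ℝ b).comp (fderiv ℝ (fderiv ℝ ζ) x)) x := fun b =>
    (ContinuousLinearMap.apply ℝ ℝ b).hasFDerivAt.comp x hD.hasFDerivAt
  have hf := (((h v).smul_const a).sub ((h a).smul_const v)).fderiv
  have hs : fderiv ℝ (fderiv ℝ ζ) x a v = fderiv ℝ (fderiv ℝ ζ) x v a :=
    (hζ.contDiffAt.isSymmSndFDerivAt (by
      rw [minSmoothness_of_isRCLikeNormedField]
      exact WithTop.coe_le_coe.2 (le_top (a := (2 : ℕ∞))))) a v
  have h1 := apply_eq_sum_unitVec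
    ((ContinuousLinearMap.apply ℝ ℝ v).comp (fderiv ℝ (fderiv ℝ ζ) x)) a
  have h2 := apply_eq_sum_unitVec
    ((ContinuousLinearMap.apply ℝ ℝ a).comp (fderiv ℝ (fderiv ℝ ζ) x)) v
  rw [divergence]
  have hc : fderiv ℝ (curlField ζ a v) x = _ := hf
  simp only [ContinuousLinearMap.comp_apply, ContinuousLinearMap.apply_apply] at h1 h2
  simp only [hc, sub_apply, ContinuousLinearMap.smulRight_apply,
    ContinuousLinearMap.comp_apply, ContinuousLinearMap.apply_apply, PiLp.sub_apply,
    PiLp.smul_apply, smul_eq_mul, Finset.sum_sub_distrib]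
  rw [sub_eq_zero, Finset.sum_congr rfl fun i _ => mul_comm _ (a i), ← h1, hs, h2]
  exact Finset.sum_congr rfl fun i _ => mul_comm _ _

/-- The mean value of `ζ` over the segment between `p` and `p'`. -/
noncomputable def edgeMean (ζ : Vec d → ℝ) (p p' : Vec d) : ℝ :=
  ∫ s in (0 : ℝ)..1, ζ (p + s • (p' - p))

theorem edgeMean_comm (ζ : Vec d → ℝ) (p p' : Vec d) : edgeMean ζ p p' = edgeMean ζ p' p := by
  have := intervalIntegral.integral_comp_sub_left (a := 0) (b := 1)
    (fun s => ζ (p' + s • (p - p'))) (1 : ℝ)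
  simp only [sub_self, sub_zero] at this
  rw [edgeMean, edgeMean, ← this]
  congr 1 with s
  congr 1
  module

theorem integral_fderiv_segment {ζ : Vec d → ℝ} (hζ : ContDiff ℝ ∞ ζ) (x e : Vec d) (r : ℝ) :
    ∫ s in (0 : ℝ)..r, fderiv ℝ ζ (x + s • e) e = ζ (x + r • e) - ζ x := by
  have hd : ∀ s : ℝ, HasDerivAt (fun s : ℝ => ζ (x + s • e)) (fderiv ℝ ζ (x + s • e) e) s :=
    fun s => by
      have h1 : HasDerivAt (fun s : ℝ => x + s • e) e s := by
        simpa using ((hasDerivAt_id s).smul_const e).const_add x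
      exact (hζ.differentiable (by simp) _).hasFDerivAt.comp_hasDerivAt s h1
  have hc : Continuous fun s : ℝ => fderiv ℝ ζ (x + s • e) e :=
    ((hζ.continuous_fderiv (by simp)).comp (by fun_prop)).clm_apply continuous_const
  have := intervalIntegral.integral_eq_sub_of_hasDerivAt (fun s _ => hd s)
    (hc.intervalIntegrable 0 r)
  simpa using this

end

theorem integral_baryDomain_one (g : (Fin 1 → ℝ) → ℝ) :
    ∫ w in baryDomain 1, g w = ∫ s in (0 : ℝ)..1, g fun _ => s := by
  have h := (volume_preserving_funUnique (Fin 1) ℝ).setIntegral_preimage_emb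
    (MeasurableEquiv.measurableEmbedding _) (fun s => g fun _ => s) (Ioo 0 1)
  have hpre : MeasurableEquiv.funUnique (Fin 1) ℝ ⁻¹' Ioo 0 1 = baryDomain 1 := by
    ext w
    simp [baryDomain, MeasurableEquiv.funUnique, Fin.forall_fin_one]
  rw [hpre] at h
  rw [intervalIntegral.integral_of_le zero_le_one, integral_Ioc_eq_integral_Ioo, ← h]
  congr 1 with w
  congr 1 with i
  rw [Subsingleton.elim i 0]; rfl

section

variable {g : (Fin 2 → ℝ) → ℝ}

theorem integral_baryDomain_two_eq_prod (hg : Continuous g) :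
    Integrable ({z : ℝ × ℝ | 0 < z.1 ∧ 0 < z.2 ∧ z.1 + z.2 < 1}.indicator
      fun z => g ![z.1, z.2]) (volume.prod volume) ∧
    ∫ w in baryDomain 2, g w =
      ∫ z, {z : ℝ × ℝ | 0 < z.1 ∧ 0 < z.2 ∧ z.1 + z.2 < 1}.indicator
        (fun z => g ![z.1, z.2]) z ∂volume.prod volume := by
  have hS : IsOpen {z : ℝ × ℝ | 0 < z.1 ∧ 0 < z.2 ∧ z.1 + z.2 < 1} :=
    (isOpen_lt continuous_const continuous_fst).inter
      ((isOpen_lt continuous_const continuous_snd).inter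
        (isOpen_lt (continuous_fst.add continuous_snd) continuous_const))
  have hpre : MeasurableEquiv.finTwoArrow ⁻¹' {z : ℝ × ℝ | 0 < z.1 ∧ 0 < z.2 ∧ z.1 + z.2 < 1} =
      baryDomain 2 := by
    ext w
    simp [baryDomain, MeasurableEquiv.finTwoArrow, Fin.forall_fin_two, and_assoc]
  have hgw : ∀ w : Fin 2 → ℝ, g ![(MeasurableEquiv.finTwoArrow w).1,
      (MeasurableEquiv.finTwoArrow w).2] = g w := fun w => by
    congr 1 with i
    fin_cases i <;> rfl
  constructor
  · rw [integrable_indicator_iff hS.measurableSet]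
    have := ((volume_preserving_finTwoArrow ℝ).integrableOn_comp_preimage
      (MeasurableEquiv.measurableEmbedding _) (f := fun z => g ![z.1, z.2])
      (s := {z : ℝ × ℝ | 0 < z.1 ∧ 0 < z.2 ∧ z.1 + z.2 < 1})).1
    rw [hpre] at this
    refine this ?_
    simp only [Function.comp_def, hgw]
    exact integrableOn_baryDomain hg.continuousOn
  · rw [integral_indicator hS.measurableSet]
    have h := (volume_preserving_finTwoArrow ℝ).setIntegral_preimage_emb
      (MeasurableEquiv.measurableEmbedding _) (fun z => g ![z.1, z.2])
      {z : ℝ × ℝ | 0 < z.1 ∧ 0 < z.2 ∧ z.1 + z.2 < 1}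
    rw [hpre] at h
    simp only [hgw] at h
    exact h

theorem integral_eq_of_slices {A : ℝ → ℝ → ℝ} {B : ℝ → ℝ → ℝ}
    (h : ∀ y x, B y x = (Ioo (0 : ℝ) 1).indicator
      (fun y => (Ioo (0 : ℝ) (1 - y)).indicator (A y) x) y) :
    ∫ y, ∫ x, B y x = ∫ y in (0 : ℝ)..1, ∫ x in (0 : ℝ)..1 - y, A y x := by
  rw [intervalIntegral.integral_of_le zero_le_one, integral_Ioc_eq_integral_Ioo,
    ← integral_indicator measurableSet_Ioo]
  congr 1 with y
  simp only [h]
  by_cases hy : y ∈ Ioo (0 : ℝ) 1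
  · simp only [indicator_of_mem hy]
    rw [integral_indicator measurableSet_Ioo, ← integral_Ioc_eq_integral_Ioo,
      intervalIntegral.integral_of_le (by linarith [hy.2])]
  · simp [indicator_of_notMem hy]

theorem integral_baryDomain_two (hg : Continuous g) :
    ∫ w in baryDomain 2, g w = ∫ y in (0 : ℝ)..1, ∫ x in (0 : ℝ)..1 - y, g ![x, y] := by
  rw [(integral_baryDomain_two_eq_prod hg).2,
    integral_prod_symm _ (integral_baryDomain_two_eq_prod hg).1]
  refine integral_eq_of_slices fun y x => ?_
  simp only [indicator, mem_ofPred_eq, mem_Ioo]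
  grind

theorem integral_baryDomain_two_symm (hg : Continuous g) :
    ∫ w in baryDomain 2, g w = ∫ x in (0 : ℝ)..1, ∫ y in (0 : ℝ)..1 - x, g ![x, y] := by
  rw [(integral_baryDomain_two_eq_prod hg).2,
    integral_prod _ (integral_baryDomain_two_eq_prod hg).1]
  refine integral_eq_of_slices fun y x => ?_
  simp only [indicator, mem_ofPred_eq, mem_Ioo]
  grind

end

theorem conormal_plane (p : Fin 2 → Vec 2) (v : Vec 2) :
    conormal p v = v 0 * (p 1 - p 0) 1 - v 1 * (p 1 - p 0) 0 := by
  rw [conormal_apply, Matrix.det_fin_two]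
  rfl

theorem conormal_space (p : Fin 3 → Vec 3) (v : Vec 3) :
    conormal p v = v 0 * (p 1 - p 0) 1 * (p 2 - p 0) 2 - v 0 * (p 1 - p 0) 2 * (p 2 - p 0) 1 -
      v 1 * (p 1 - p 0) 0 * (p 2 - p 0) 2 + v 1 * (p 1 - p 0) 2 * (p 2 - p 0) 0 +
      v 2 * (p 1 - p 0) 0 * (p 2 - p 0) 1 - v 2 * (p 1 - p 0) 1 * (p 2 - p 0) 0 := by
  rw [conormal_apply, Matrix.det_fin_three]
  rfl

/-- The flux of a `curlField` through an edge in the plane. -/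
theorem integral_conormal_curlField_one {ζ : Vec 2 → ℝ} (hζ : ContDiff ℝ ∞ ζ)
    (p : Fin 2 → Vec 2) :
    ∫ w in baryDomain 1, conormal p (curlField ζ (unitVec 0) (unitVec 1) (facetMap p w)) =
      ζ (p 1) - ζ (p 0) := by
  have h1 : ∀ w : Fin 1 → ℝ,
      conormal p (curlField ζ (unitVec 0) (unitVec 1) (facetMap p w)) =
      fderiv ℝ ζ (p 0 + w 0 • (p 1 - p 0)) (p 1 - p 0) := fun w => by
    rw [apply_eq_sum_unitVec (fderiv ℝ ζ _) (p 1 - p 0)]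
    simp [conormal_plane, curlField, facetMap_apply]
    ring
  simp only [h1]
  rw [integral_baryDomain_one, integral_fderiv_segment hζ]
  congr 2
  module

/-- The flux of a `curlField` through a triangle in space, by Stokes' theorem. -/
theorem integral_conormal_curlField_two {ζ : Vec 3 → ℝ} (hζ : ContDiff ℝ ∞ ζ)
    (p : Fin 3 → Vec 3) (l : Fin 3) :
    ∫ w in baryDomain 2,
      conormal p (curlField ζ (unitVec (l + 1)) (unitVec (l + 2)) (facetMap p w)) =
      ∑ i : Fin 3, edgeMean ζ (p i) (p (i + 1)) * (p (i + 1) - p i) l := by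
  have h1 : ∀ w : Fin 2 → ℝ,
      conormal p (curlField ζ (unitVec (l + 1)) (unitVec (l + 2)) (facetMap p w)) =
      (p 2 - p 0) l * fderiv ℝ ζ (facetMap p w) (p 1 - p 0) -
      (p 1 - p 0) l * fderiv ℝ ζ (facetMap p w) (p 2 - p 0) := fun w => by
    rw [apply_eq_sum_unitVec (fderiv ℝ ζ _) (p 1 - p 0),
      apply_eq_sum_unitVec (fderiv ℝ ζ _) (p 2 - p 0)]
    rw [curlField]
    generalize fderiv ℝ ζ (facetMap p w) = L
    fin_cases l <;>
    · simp [conormal_space, Fin.sum_univ_three]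
      ring
  have hc : ∀ e : Vec 3, Continuous fun w : Fin 2 → ℝ => fderiv ℝ ζ (facetMap p w) e := fun e =>
    ((hζ.continuous_fderiv (by simp)).comp (continuous_facetMap p)).clm_apply continuous_const
  have hi : ∀ (c : ℝ) (e : Vec 3), IntegrableOn
      (fun w : Fin 2 → ℝ => c * fderiv ℝ ζ (facetMap p w) e) (baryDomain 2) := fun c e =>
    integrableOn_baryDomain (continuous_const.mul (hc e)).continuousOn
  simp only [h1]
  rw [integral_sub (hi _ _) (hi _ _), integral_const_mul, integral_const_mul,
    integral_baryDomain_two (hc _), integral_baryDomain_two_symm (hc _)]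
  have hcζ : ∀ x e : Vec 3, IntervalIntegrable (fun s : ℝ => ζ (x + s • e)) volume 0 1 :=
    fun x e => (hζ.continuous.comp (by fun_prop)).intervalIntegrable 0 1
  have hx : ∀ y : ℝ, ∫ x in (0 : ℝ)..1 - y, fderiv ℝ ζ (facetMap p ![x, y]) (p 1 - p 0) =
      ζ (p 1 + y • (p 2 - p 1)) - ζ (p 0 + y • (p 2 - p 0)) := fun y => by
    have : ∀ x : ℝ, facetMap p ![x, y] = (p 0 + y • (p 2 - p 0)) + x • (p 1 - p 0) := fun x => by
      simp [facetMap_apply, Fin.sum_univ_two]; abel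
    simp only [this]
    rw [integral_fderiv_segment hζ]
    congr 2
    module
  have hy : ∀ x : ℝ, ∫ y in (0 : ℝ)..1 - x, fderiv ℝ ζ (facetMap p ![x, y]) (p 2 - p 0) =
      ζ (p 2 + x • (p 1 - p 2)) - ζ (p 0 + x • (p 1 - p 0)) := fun x => by
    have : ∀ y : ℝ, facetMap p ![x, y] = (p 0 + x • (p 1 - p 0)) + y • (p 2 - p 0) := fun y => by
      simp [facetMap_apply, Fin.sum_univ_two]; abel
    simp only [this]
    rw [integral_fderiv_segment hζ]
    congr 2
    module
  simp only [hx, hy]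
  rw [intervalIntegral.integral_sub (hcζ _ _) (hcζ _ _),
    intervalIntegral.integral_sub (hcζ _ _) (hcζ _ _)]
  change (p 2 - p 0) l * (edgeMean ζ (p 1) (p 2) - edgeMean ζ (p 0) (p 2)) -
    (p 1 - p 0) l * (edgeMean ζ (p 2) (p 1) - edgeMean ζ (p 0) (p 1)) = _
  rw [edgeMean_comm ζ (p 2) (p 1), edgeMean_comm ζ (p 0) (p 2), Fin.sum_univ_three]
  simp
  ring

/-! ### The oriented facets form a cycle -/

theorem IsPolyhedralInterface.vertex_injective {n K J : ℕ} {facet : Fin J → Fin (n + 1) → Fin K}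
    {q : Fin K → Vec (n + 1)} {Ω : Set (Vec (n + 1))} (h : IsPolyhedralInterface facet q Ω) :
    Function.Injective q := fun a b hab => by
  obtain ⟨i, k, rfl⟩ := h.vertex_used a
  obtain ⟨j, k', rfl⟩ := h.vertex_used b
  have hsum : ∑ l, (Pi.single k 1 : Fin (n + 1) → ℝ) l • q (facet i l) = q (facet i k) := by
    rw [Finset.sum_eq_single k] <;> simp +contextual
  obtain ⟨l, hl⟩ := h.vertex_mem_of_mem (i := j) (j := i) (w := Pi.single k 1) (k := k)
    (fun l => by by_cases hl : l = k <;> simp [hl]) (by simp)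
    (by rw [hsum, hab]; exact subset_convexHull ℝ _ (mem_range_self k')) (by simp)
  rw [← hl] at hab ⊢
  rw [(h.nondegenerate j).injective hab]

/-- In the plane, every vertex is the end point of as many oriented edges as it is the starting
point of: test the divergence theorem with the rotated gradient of a bump function at the vertex. -/
theorem IsPolyhedralInterface.sum_vertex_eq_zero {K J : ℕ} {facet : Fin J → Fin 2 → Fin K}
    {q : Fin K → Vec 2} {Ω : Set (Vec 2)} (h : IsPolyhedralInterface facet q Ω)
    {N : Fin J → Vec 2} (hN : ∀ j, IsFacetNormal facet q j (N j))
    (hb : Bornology.IsBounded (inside facet q)) (g : Fin K → ℝ) :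
    ∑ j, facetSign facet q j (N j) * (g (facet j 1) - g (facet j 0)) = 0 := by
  have hbump : ∀ k, ∃ ζ : Vec 2 → ℝ, ContDiff ℝ ∞ ζ ∧ ∀ k', ζ (q k') = if k' = k then 1 else 0 := by
    intro k
    have hfin : (q '' {k' | k' ≠ k}).Finite := Set.toFinite _
    have hmem : (q '' {k' | k' ≠ k})ᶜ ∈ 𝓝 (q k) := by
      refine hfin.isClosed.isOpen_compl.mem_nhds ?_
      rintro ⟨k', hk', heq⟩
      exact hk' (h.vertex_injective heq)
    obtain ⟨ζ, hsupp, -, hζ, -, h1⟩ := exists_contDiff_tsupport_subset (n := ⊤) hmem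
    refine ⟨ζ, hζ, fun k' => ?_⟩
    split_ifs with hk
    · rw [hk, h1]
    · by_contra hne
      exact hsupp (subset_tsupport _ hne) ⟨k', hk, rfl⟩
  choose ζ hζ hval using hbump
  have hζs : ContDiff ℝ ∞ fun x => ∑ k, g k * ζ k x :=
    ContDiff.sum fun k _ => contDiff_const.mul (hζ k)
  have hdiv := h.setIntegral_divergence_of_contDiff hN hb
    (contDiff_curlField hζs (unitVec 0) (unitVec 1))
  simp only [divergence_curlField hζs, integral_zero, integral_conormal_curlField_one hζs, hval,
    mul_ite, mul_one, mul_zero, Finset.sum_ite_eq, Finset.mem_univ, if_true] at hdiv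
  exact hdiv.symm

section

variable {K J : ℕ} {facet : Fin J → Fin 3 → Fin K} {q : Fin K → Vec 3} {Ω : Set (Vec 3)}

/-- An edge of a facet that contains the midpoint of another edge coincides with it. -/
theorem IsPolyhedralInterface.eq_of_midpoint_mem_segment (h : IsPolyhedralInterface facet q Ω)
    {j₀ j : Fin J} {i₀ i : Fin 3}
    (hm : midpoint ℝ (q (facet j₀ i₀)) (q (facet j₀ (i₀ + 1))) ∈
      segment ℝ (q (facet j i)) (q (facet j (i + 1)))) :
    (facet j i = facet j₀ i₀ ∧ facet j (i + 1) = facet j₀ (i₀ + 1)) ∨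
    (facet j i = facet j₀ (i₀ + 1) ∧ facet j (i + 1) = facet j₀ i₀) := by
  have hne : ∀ i : Fin 3, i ≠ i + 1 := by decide
  -- the midpoint in barycentric coordinates
  have key : ∀ (j : Fin J) (k k' : Fin 3), k ≠ k' →
      (∑ l, (Pi.single k (1 / 2) + Pi.single k' (1 / 2) : Fin 3 → ℝ) l = 1) ∧
      (∀ l, 0 ≤ (Pi.single k (1 / 2) + Pi.single k' (1 / 2) : Fin 3 → ℝ) l) ∧
      (Pi.single k (1 / 2) + Pi.single k' (1 / 2) : Fin 3 → ℝ) k ≠ 0 ∧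
      (Pi.single k (1 / 2) + Pi.single k' (1 / 2) : Fin 3 → ℝ) k' ≠ 0 ∧
      ∑ l, (Pi.single k (1 / 2) + Pi.single k' (1 / 2) : Fin 3 → ℝ) l • q (facet j l) =
        midpoint ℝ (q (facet j k)) (q (facet j k')) := by
    intro j k k' hk
    refine ⟨?_, fun l => ?_, ?_, ?_, ?_⟩
    · simp [Finset.sum_add_distrib]; norm_num
    · simp only [Pi.add_apply, Pi.single_apply]; positivity
    · simp [hk]
    · simp [hk.symm]
    · simp only [Pi.add_apply, add_smul, Finset.sum_add_distrib, Pi.single_apply, ite_smul,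
        zero_smul, Finset.sum_ite_eq', Finset.mem_univ, if_true]
      rw [midpoint_eq_smul_add, smul_add]
      norm_num
  obtain ⟨hs, h0, hk, hk', hsum⟩ := key j₀ i₀ (i₀ + 1) (hne i₀)
  have hpair : segment ℝ (q (facet j i)) (q (facet j (i + 1))) =
      convexHull ℝ ((fun l => q (facet j l)) '' {i, i + 1}) := by
    rw [image_pair, convexHull_pair]
  have hmem : midpoint ℝ (q (facet j₀ i₀)) (q (facet j₀ (i₀ + 1))) ∈ closedFacet facet q j := by
    rw [hpair] at hm
    exact convexHull_mono (image_subset_range _ _) hm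
  rw [← hsum] at hmem
  obtain ⟨k, hk⟩ := h.vertex_mem_of_mem h0 hs hmem hk
  obtain ⟨k', hk'⟩ := h.vertex_mem_of_mem h0 hs hmem hk'
  have hkk : k ≠ k' := by
    rintro rfl
    exact hne i₀ (h.facet_injective j₀ (hk.symm.trans hk'))
  rw [← hk, ← hk'] at hm ⊢
  obtain ⟨hs, -, h1, h2, hsum⟩ := key j k k' hkk
  rw [hpair, ← hsum] at hm
  have hm1 := mem_of_mem_convexHull_image (h.nondegenerate j) hs hm h1
  have hm2 := mem_of_mem_convexHull_image (h.nondegenerate j) hs hm h2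
  simp only [mem_insert_iff, mem_singleton_iff] at hm1 hm2
  grind

/-- In space, every edge occurs in the oriented facets as often in one direction as in the other:
test the divergence theorem with the curl of a field that is concentrated near the midpoint of the
edge. -/
theorem IsPolyhedralInterface.sum_edge_eq_zero (h : IsPolyhedralInterface facet q Ω)
    {N : Fin J → Vec 3} (hN : ∀ j, IsFacetNormal facet q j (N j))
    (hb : Bornology.IsBounded (inside facet q)) (j₀ : Fin J) (i₀ : Fin 3) :
    ∑ j, facetSign facet q j (N j) * ∑ i,
      ((if facet j i = facet j₀ i₀ ∧ facet j (i + 1) = facet j₀ (i₀ + 1) then (1 : ℝ) else 0) -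
      if facet j i = facet j₀ (i₀ + 1) ∧ facet j (i + 1) = facet j₀ i₀ then 1 else 0) = 0 := by
  have hne : facet j₀ i₀ ≠ facet j₀ (i₀ + 1) := fun heq =>
    absurd (h.facet_injective j₀ heq) ((by decide : ∀ i : Fin 3, i ≠ i + 1) i₀)
  set a := facet j₀ i₀ with ha
  set b := facet j₀ (i₀ + 1) with hb'
  -- the union of the remaining edges
  set S : Set (Vec 3) := ⋃ (e : Fin J × Fin 3)
    (_ : ¬ ((facet e.1 e.2 = a ∧ facet e.1 (e.2 + 1) = b) ∨
      (facet e.1 e.2 = b ∧ facet e.1 (e.2 + 1) = a))),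
    segment ℝ (q (facet e.1 e.2)) (q (facet e.1 (e.2 + 1))) with hS
  have hSc : IsClosed S := by
    refine isClosed_iUnion_of_finite fun e => isClosed_iUnion_of_finite fun _ => ?_
    rw [← convexHull_pair]
    exact ((Set.toFinite _).isCompact_convexHull ℝ).isClosed
  have hmS : midpoint ℝ (q a) (q b) ∉ S := by
    simp only [hS, mem_iUnion, not_exists]
    exact fun e he hmem => he (h.eq_of_midpoint_mem_segment hmem)
  obtain ⟨ζ, hsupp, -, hζ, hrange, h1⟩ :=
    exists_contDiff_tsupport_subset (n := ⊤) (hSc.isOpen_compl.mem_nhds hmS)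
  have hζ : ContDiff ℝ ∞ ζ := hζ
  have hζS : ∀ x ∈ S, ζ x = 0 := fun x hx => by
    by_contra hne
    exact hsupp (subset_tsupport _ hne) hx
  have hpos : 0 < edgeMean ζ (q a) (q b) := by
    refine intervalIntegral.integral_pos zero_lt_one
      (hζ.continuous.comp (by fun_prop)).continuousOn (fun s _ => (hrange ⟨_, rfl⟩).1)
      ⟨1 / 2, by norm_num, ?_⟩
    have : q a + (1 / 2 : ℝ) • (q b - q a) = midpoint ℝ (q a) (q b) := by
      rw [midpoint_eq_smul_add, invOf_eq_inv]; module
    rw [this, h1]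
    exact one_pos
  -- a coordinate direction in which the edge has nonzero extent
  obtain ⟨l, hl⟩ : ∃ l, (q b - q a) l ≠ 0 := by
    by_contra hcon
    push Not at hcon
    exact hne (h.vertex_injective (sub_eq_zero.1 (by ext l; exact hcon l))).symm
  have hterm : ∀ j i, edgeMean ζ (q (facet j i)) (q (facet j (i + 1))) *
      (q (facet j (i + 1)) - q (facet j i)) l = (edgeMean ζ (q a) (q b) * (q b - q a) l) *
        ((if facet j i = a ∧ facet j (i + 1) = b then (1 : ℝ) else 0) -
          if facet j i = b ∧ facet j (i + 1) = a then 1 else 0) := by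
    intro j i
    by_cases hab : facet j i = a ∧ facet j (i + 1) = b
    · rw [if_pos hab, if_neg (by rw [hab.1]; exact fun hh => hne hh.1), hab.1, hab.2]
      ring
    by_cases hba : facet j i = b ∧ facet j (i + 1) = a
    · rw [if_pos hba, if_neg hab, hba.1, hba.2, edgeMean_comm, PiLp.sub_apply, PiLp.sub_apply]
      ring
    rw [if_neg hab, if_neg hba, sub_zero, mul_zero]
    have h0 : edgeMean ζ (q (facet j i)) (q (facet j (i + 1))) = 0 := by
      rw [edgeMean, intervalIntegral.integral_zero_ae]
      refine Eventually.of_forall fun s hs => hζS _ ?_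
      rw [uIoc_of_le zero_le_one] at hs
      refine mem_iUnion₂.2 ⟨(j, i), not_or.2 ⟨hab, hba⟩, ?_⟩
      rw [segment_eq_image']
      exact ⟨s, ⟨hs.1.le, hs.2⟩, rfl⟩
    rw [h0, zero_mul]
  have hdiv := h.setIntegral_divergence_of_contDiff hN hb
    (contDiff_curlField hζ (unitVec (l + 1)) (unitVec (l + 2)))
  simp only [divergence_curlField hζ, integral_zero, integral_conormal_curlField_two hζ, hterm,
    ← Finset.mul_sum, mul_left_comm _ (edgeMean ζ (q a) (q b) * (q b - q a) l)] at hdiv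
  exact (mul_eq_zero.1 hdiv.symm).resolve_left (mul_ne_zero hpos.ne' hl)

/-- Consequently the sum of an antisymmetric function over the oriented edges vanishes. -/
theorem IsPolyhedralInterface.sum_antisymm_eq_zero (h : IsPolyhedralInterface facet q Ω)
    {N : Fin J → Vec 3} (hN : ∀ j, IsFacetNormal facet q j (N j))
    (hb : Bornology.IsBounded (inside facet q)) {g : Fin K → Fin K → ℝ}
    (hg : ∀ a b, g b a = - g a b) :
    ∑ j, facetSign facet q j (N j) * ∑ i, g (facet j i) (facet j (i + 1)) = 0 := by
  -- the number of occurrences of the directed edge from `a` to `b`, counted with orientation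
  set c : Fin K → Fin K → ℝ := fun a b => ∑ j, facetSign facet q j (N j) *
    ∑ i, if facet j i = a ∧ facet j (i + 1) = b then (1 : ℝ) else 0 with hc
  have hsub : ∀ a b, ∑ j, facetSign facet q j (N j) * ∑ i,
      ((if facet j i = a ∧ facet j (i + 1) = b then (1 : ℝ) else 0) -
        if facet j i = b ∧ facet j (i + 1) = a then 1 else 0) = c a b - c b a := fun a b => by
    simp only [hc, Finset.sum_sub_distrib, mul_sub]
  have hsymm : ∀ a b, c a b = c b a := by
    intro a b
    by_cases h1 : ∃ j i, facet j i = a ∧ facet j (i + 1) = b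
    · obtain ⟨j, i, rfl, rfl⟩ := h1
      exact sub_eq_zero.1 ((hsub _ _).symm.trans (h.sum_edge_eq_zero hN hb j i))
    by_cases h2 : ∃ j i, facet j i = b ∧ facet j (i + 1) = a
    · obtain ⟨j, i, rfl, rfl⟩ := h2
      exact (sub_eq_zero.1 ((hsub _ _).symm.trans (h.sum_edge_eq_zero hN hb j i))).symm
    push Not at h1 h2
    have h1 : ∀ j i, ¬ (facet j i = a ∧ facet j (i + 1) = b) := fun j i hh => h1 j i hh.1 hh.2
    have h2 : ∀ j i, ¬ (facet j i = b ∧ facet j (i + 1) = a) := fun j i hh => h2 j i hh.1 hh.2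
    simp only [hc, h1, h2, if_false]
  have hexp : ∑ j, facetSign facet q j (N j) * ∑ i, g (facet j i) (facet j (i + 1)) =
      ∑ a, ∑ b, g a b * c a b := by
    have : ∀ j i, g (facet j i) (facet j (i + 1)) = ∑ a, ∑ b, g a b *
        if facet j i = a ∧ facet j (i + 1) = b then (1 : ℝ) else 0 := fun j i => by
      simp [ite_and]
    simp only [this, hc, Finset.mul_sum]
    simp only [Finset.sum_comm (s := (Finset.univ : Finset (Fin 3)))]
    rw [Finset.sum_comm]
    refine Finset.sum_congr rfl fun a _ => ?_
    rw [Finset.sum_comm]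
    refine Finset.sum_congr rfl fun b _ => Finset.sum_congr rfl fun j _ => ?_
    exact Finset.sum_congr rfl fun i _ => by ring
  have hneg : ∑ a, ∑ b, g a b * c a b = - ∑ a, ∑ b, g a b * c a b := by
    conv_lhs => rw [Finset.sum_comm]
    rw [← Finset.sum_neg_distrib]
    refine Finset.sum_congr rfl fun a _ => ?_
    rw [← Finset.sum_neg_distrib]
    refine Finset.sum_congr rfl fun b _ => ?_
    rw [hg a b, hsymm b a, neg_mul]
  rw [hexp]
  linarith

end

/-! ### The derivative of the enclosed volume -/

/-- With `V` the velocities of the vertices, the difference between the two sides is the sum over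
the oriented edges of the increments of the vertex function `det (V, q)`. -/
theorem IsPolyhedralInterface.hasDerivWithinAt_plane {K J : ℕ} {facet : Fin J → Fin 2 → Fin K}
    {Q : ℝ → Fin K → Vec 2} {t : ℝ} {Ω : Set (Vec 2)}
    (h : IsPolyhedralInterface facet (Q t) Ω)
    {N : Fin J → Vec 2} (hN : ∀ j, IsFacetNormal facet (Q t) j (N j))
    (hb : Bornology.IsBounded (inside facet (Q t))) {V : Fin K → Vec 2} {S : Set ℝ}
    (hV : ∀ k, HasDerivWithinAt (fun s => Q s k) (V k) S t) :
    HasDerivWithinAt (fun s => ∑ j, facetSign facet (Q t) j (N j) *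
        conormal (fun k => Q s (facet j k)) (Q s (facet j 0)))
      (∑ j, facetSign facet (Q t) j (N j) *
        ∑ i, conormal (fun k => Q t (facet j k)) (V (facet j i))) S t := by
  have hVc : ∀ k l, HasDerivWithinAt (fun s => Q s k l) (V k l) S t := fun k l =>
    (EuclideanSpace.proj l : Vec 2 →L[ℝ] ℝ).hasFDerivAt.comp_hasDerivWithinAt t (hV k)
  have h0 := h.sum_vertex_eq_zero hN hb fun k => V k 0 * Q t k 1 - V k 1 * Q t k 0
  have hd : ∀ j, HasDerivWithinAt (fun s =>
      conormal (fun k => Q s (facet j k)) (Q s (facet j 0))) _ S t := fun j => by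
    simp only [conormal_plane, PiLp.sub_apply]
    exact ((hVc _ 0).mul ((hVc _ 1).sub (hVc _ 1))).sub ((hVc _ 1).mul ((hVc _ 0).sub (hVc _ 0)))
  refine (HasDerivWithinAt.fun_sum (u := Finset.univ) fun j _ =>
    (hd j).const_mul (facetSign facet (Q t) j (N j))).congr_deriv (Eq.symm ?_)
  rw [← sub_eq_zero, ← h0, ← Finset.sum_sub_distrib]
  refine Finset.sum_congr rfl fun j _ => ?_
  simp only [conormal_plane, Fin.sum_univ_two, PiLp.sub_apply, Pi.sub_apply]
  ring

/-- With `V` the velocities of the vertices, the difference between the two sides is the sum over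
the oriented edges from `a` to `b` of the antisymmetric function `(V a + V b) · (q a × q b)`. -/
theorem IsPolyhedralInterface.hasDerivWithinAt_space {K J : ℕ} {facet : Fin J → Fin 3 → Fin K}
    {Q : ℝ → Fin K → Vec 3} {t : ℝ} {Ω : Set (Vec 3)}
    (h : IsPolyhedralInterface facet (Q t) Ω)
    {N : Fin J → Vec 3} (hN : ∀ j, IsFacetNormal facet (Q t) j (N j))
    (hb : Bornology.IsBounded (inside facet (Q t))) {V : Fin K → Vec 3} {S : Set ℝ}
    (hV : ∀ k, HasDerivWithinAt (fun s => Q s k) (V k) S t) :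
    HasDerivWithinAt (fun s => ∑ j, facetSign facet (Q t) j (N j) *
        conormal (fun k => Q s (facet j k)) (Q s (facet j 0)))
      (∑ j, facetSign facet (Q t) j (N j) *
        ∑ i, conormal (fun k => Q t (facet j k)) (V (facet j i))) S t := by
  have hVc : ∀ k l, HasDerivWithinAt (fun s => Q s k l) (V k l) S t := fun k l =>
    (EuclideanSpace.proj l : Vec 3 →L[ℝ] ℝ).hasFDerivAt.comp_hasDerivWithinAt t (hV k)
  have h0 := h.sum_antisymm_eq_zero hN hb (g := fun a b =>
    (V a 0 + V b 0) * (Q t a 1 * Q t b 2 - Q t a 2 * Q t b 1) +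
    (V a 1 + V b 1) * (Q t a 2 * Q t b 0 - Q t a 0 * Q t b 2) +
    (V a 2 + V b 2) * (Q t a 0 * Q t b 1 - Q t a 1 * Q t b 0)) fun a b => by ring
  have hd : ∀ j, HasDerivWithinAt (fun s =>
      conormal (fun k => Q s (facet j k)) (Q s (facet j 0))) _ S t := fun j => by
    have hs : ∀ k l, HasDerivWithinAt (fun s => Q s (facet j k) l - Q s (facet j 0) l)
      (V (facet j k) l - V (facet j 0) l) S t := fun k l => (hVc _ l).sub (hVc _ l)
    simp only [conormal_space, PiLp.sub_apply]
    exact ((((((hVc _ 0).mul (hs 1 1)).mul (hs 2 2)).sub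
      (((hVc _ 0).mul (hs 1 2)).mul (hs 2 1))).sub
      (((hVc _ 1).mul (hs 1 0)).mul (hs 2 2))).add
      (((hVc _ 1).mul (hs 1 2)).mul (hs 2 0))).add
      (((hVc _ 2).mul (hs 1 0)).mul (hs 2 1)) |>.sub
      (((hVc _ 2).mul (hs 1 1)).mul (hs 2 0))
  refine (HasDerivWithinAt.fun_sum (u := Finset.univ) fun j _ =>
    (hd j).const_mul (facetSign facet (Q t) j (N j))).congr_deriv (Eq.symm ?_)
  rw [← sub_eq_zero, ← h0, ← Finset.sum_sub_distrib]
  refine Finset.sum_congr rfl fun j _ => ?_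
  simp only [conormal_space, Fin.sum_univ_three, PiLp.sub_apply, Pi.mul_apply,
    Fin.isValue, zero_add,
    Fin.reduceAdd]
  ring

/-! ### Conservation of the phase volumes -/

section

variable {n K J : ℕ} {facet : Fin J → Fin (n + 1) → Fin K} {q : Fin K → Vec (n + 1)}
  {Ω : Set (Vec (n + 1))}

theorem memSurfaceP1_const {F : Type*} [NormedAddCommGroup F] [NormedSpace ℝ F] (c : F) :
    MemSurfaceP1 facet q fun _ => c :=
  ⟨continuousOn_const, fun _ => ⟨AffineMap.const ℝ _ c, fun _ _ => rfl⟩⟩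

theorem memSurfaceP1_id : MemSurfaceP1 facet q fun x => x :=
  ⟨continuousOn_id, fun _ => ⟨AffineMap.id ℝ _, fun _ _ => rfl⟩⟩

theorem MemSurfaceP1.sub {F : Type*} [NormedAddCommGroup F] [NormedSpace ℝ F]
    {v w : Vec (n + 1) → F} (hv : MemSurfaceP1 facet q v) (hw : MemSurfaceP1 facet q w) :
    MemSurfaceP1 facet q fun x => v x - w x := by
  refine ⟨hv.1.sub hw.1, fun j => ?_⟩
  obtain ⟨A, hA⟩ := hv.2 j
  obtain ⟨B, hB⟩ := hw.2 j
  exact ⟨A - B, fun x hx => by simp [hA hx, hB hx]⟩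

theorem MemSurfaceP1.const_smul {F : Type*} [NormedAddCommGroup F] [NormedSpace ℝ F]
    {v : Vec (n + 1) → F} (hv : MemSurfaceP1 facet q v) (c : ℝ) :
    MemSurfaceP1 facet q fun x => c • v x := by
  refine ⟨hv.1.const_smul c, fun j => ?_⟩
  obtain ⟨A, hA⟩ := hv.2 j
  exact ⟨c • A, fun x hx => by simp [hA hx]⟩

theorem surfaceInner_const_smul (c : ℝ) (v w : Vec (n + 1) → Vec (n + 1)) :
    surfaceInner facet q (fun x => c • v x) w = c * surfaceInner facet q v w := by
  simp only [surfaceInner, real_inner_smul_left]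
  exact integral_const_mul _ _

/-- Testing the incompressibility condition with the characteristic function of the interior and
the kinematic condition with the constant function `1`. -/
theorem SolvesSystem.flux_eq_zero {γ μp μm : ℝ} {f : Vec (n + 1) → Vec (n + 1)}
    {F : FESpaces (n + 1) Ω} {ν u : Vec (n + 1) → Vec (n + 1)} {p : Lp ℝ 2 (volume.restrict Ω)}
    {X Y : Vec (n + 1) → Vec (n + 1)} {κ : Vec (n + 1) → ℝ}
    (hs : SolvesSystem facet q γ μp μm f F ν u p X Y κ) (h : IsPolyhedralInterface facet q Ω)
    (hν : IsOuterNormal facet q ν) (hΩ : IsOpen Ω) (hΩne : Ω.Nonempty)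
    (hchar : F.CharMem (inside facet q)) (hY : MemSurfaceP1 facet q Y) :
    surfaceInner facet q Y ν = 0 ∧ lumpedInner facet q Y ν = 0 ∧ surfaceInner facet q u ν = 0 ∧
      ∫ x in inside facet q, divergence u x = 0 := by
  have hdiv := FESpaces.setIntegral_divergence_eq_zero hΩ hΩne
    (isOpen_inside facet q).measurableSet h.inside_subset hchar hs.u_mem hs.incompressible
  have hu := h.setIntegral_divergence hΩ hν (F.U_piecewise u hs.u_mem)
  have hk := hs.kinematic (fun _ => 1) (memSurfaceP1_const 1)
  simp only [one_smul] at hk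
  have hl := h.lumpedInner_normal hν hY
  refine ⟨?_, ?_, ?_, hdiv⟩ <;> linarith

theorem IsPolyhedralInterface.volume_surface (h : IsPolyhedralInterface facet q Ω) :
    volume (surface facet q) = 0 := by
  refine measure_iUnion_null fun j => ?_
  have hint : interior (closedFacet facet q j) = ∅ := by
    refine subset_empty_iff.1 ((interior_mono (closedFacet_subset_surface facet q j)).trans ?_)
    rw [h.eq_frontier, ← frontier_compl,
      interior_frontier (isOpen_inside facet q).isClosed_compl]
  have hfr : frontier (closedFacet facet q j) = closedFacet facet q j := by
    rw [frontier, hint, sdiff_empty, (isCompact_closedFacet facet q j).isClosed.closure_eq]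
  rw [← hfr]
  exact (convex_convexHull ℝ _).addHaar_frontier _

theorem IsPolyhedralInterface.volume_outside (h : IsPolyhedralInterface facet q Ω)
    (hfin : volume Ω ≠ ⊤) :
    volume (Ω ∩ outside facet q) = volume Ω - volume (inside facet q) := by
  have hae : (Ω ∩ outside facet q : Set (Vec (n + 1))) =ᵐ[volume]
      (Ω \ inside facet q : Set (Vec (n + 1))) := by
    filter_upwards [measure_eq_zero_iff_ae_notMem.1 h.volume_surface] with x hx
    have h1 : x ∈ inside facet q ∪ outside facet q := by
      rw [inside_union_outside]; exact hx
    have h2 : x ∈ inside facet q → x ∉ outside facet q := fun hi =>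
      disjoint_left.1 (disjoint_inside_outside facet q) hi
    refine propext ⟨fun hh => ⟨hh.1, fun hi => h2 hi hh.2⟩, fun hh => ⟨hh.1, ?_⟩⟩
    exact h1.resolve_left hh.2
  rw [measure_congr hae, measure_sdiff h.inside_subset
    (isOpen_inside facet q).measurableSet.nullMeasurableSet
    (measure_ne_top_of_subset h.inside_subset hfin)]

/-- Along a continuous family of interfaces the enclosed volume is locally given by a polynomial in
the vertices, with frozen orientations. -/
theorem eventually_volume_inside_eq {Q : ℝ → Fin K → Vec (n + 1)} {S : Set ℝ} {t : ℝ} (ht : t ∈ S)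
    (hQ : ContinuousWithinAt Q S t) (h : ∀ s ∈ S, IsPolyhedralInterface facet (Q s) Ω)
    (hΩb : Bornology.IsBounded Ω) {ν : ℝ → Vec (n + 1) → Vec (n + 1)}
    (hν : ∀ s ∈ S, IsOuterNormal facet (Q s) (ν s)) {N : Fin J → Vec (n + 1)}
    (hN : ∀ j, IsFacetNormal facet (Q t) j (N j)) :
    ∀ᶠ s in 𝓝[S] t, volume.real (inside facet (Q s)) = volume.real (baryDomain n) / (n + 1) *
      ∑ j, facetSign facet (Q t) j (N j) *
        conormal (fun k => Q s (facet j k)) (Q s (facet j 0)) := by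
  have hev := hQ.eventually (eventually_all.2 fun j => (h t ht).eventually_facetSign_eq (hN j))
  filter_upwards [hev, self_mem_nhdsWithin] with s hs hsS
  obtain ⟨N', hN', -⟩ := (hν s hsS).exists_facetNormal
  rw [(h s hsS).volume_inside hN' (hΩb.subset (h s hsS).inside_subset)]
  congr 1
  exact Finset.sum_congr rfl fun j _ => by rw [hs j (h s hsS) _ (hN' j)]

theorem continuousOn_volume_inside {Q : ℝ → Fin K → Vec (n + 1)} {S : Set ℝ}
    (hQ : ContinuousOn Q S) (h : ∀ s ∈ S, IsPolyhedralInterface facet (Q s) Ω)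
    (hΩb : Bornology.IsBounded Ω) {ν : ℝ → Vec (n + 1) → Vec (n + 1)}
    (hν : ∀ s ∈ S, IsOuterNormal facet (Q s) (ν s)) :
    ContinuousOn (fun s => volume.real (inside facet (Q s))) S := fun t ht => by
  obtain ⟨N, hN, -⟩ := (hν t ht).exists_facetNormal
  have hev := eventually_volume_inside_eq ht (hQ t ht) h hΩb hν hN
  refine ContinuousWithinAt.congr_of_eventuallyEq ?_ hev (hev.self_of_nhdsWithin ht)
  refine continuousWithinAt_const.mul ?_
  have hc : Continuous fun q : Fin K → Vec (n + 1) => ∑ j, facetSign facet (Q t) j (N j) *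
      conormal (fun k => q (facet j k)) (q (facet j 0)) :=
    continuous_finsetSum _ fun j _ => continuous_const.mul
      (continuous_conormal facet j (continuous_apply _))
  exact hc.continuousAt.comp_continuousWithinAt (hQ t ht)

end

/-- Transport theorem for the volume enclosed by a moving interface. -/
theorem hasDerivWithinAt_volume_inside {d K J : ℕ} (hd : d = 2 ∨ d = 3)
    {facet : Fin J → Fin d → Fin K} {Ω : Set (Vec d)}
    {Q : ℝ → Fin K → Vec d} {S : Set ℝ} {t : ℝ} (ht : t ∈ S)
    (h : ∀ s ∈ S, IsPolyhedralInterface facet (Q s) Ω)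
    (hΩb : Bornology.IsBounded Ω) {ν : ℝ → Vec d → Vec d}
    (hν : ∀ s ∈ S, IsOuterNormal facet (Q s) (ν s)) {V : Vec d → Vec d}
    (hVmem : MemSurfaceP1 facet (Q t) V)
    (hV : ∀ k, HasDerivWithinAt (fun s => Q s k) (V (Q t k)) S t) :
    HasDerivWithinAt (fun s => volume.real (inside facet (Q s)))
      (surfaceInner facet (Q t) V (ν t)) S t := by
  have hQ : ContinuousWithinAt Q S t := continuousWithinAt_pi.2 fun k => (hV k).continuousWithinAt
  obtain ⟨N, hN, hNν⟩ := (hν t ht).exists_facetNormal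
  have hb := hΩb.subset (h t ht).inside_subset
  rcases hd with rfl | rfl
  · have hev := eventually_volume_inside_eq (n := 1) ht hQ h hΩb hν hN
    refine HasDerivWithinAt.congr_of_eventuallyEq ?_ hev (hev.self_of_nhdsWithin ht)
    rw [(h t ht).surfaceInner_normal_eq_conormal hN hNν hVmem]
    exact ((h t ht).hasDerivWithinAt_plane hN hb hV).const_mul _
  · have hev := eventually_volume_inside_eq (n := 2) ht hQ h hΩb hν hN
    refine HasDerivWithinAt.congr_of_eventuallyEq ?_ hev (hev.self_of_nhdsWithin ht)
    rw [(h t ht).surfaceInner_normal_eq_conormal hN hNν hVmem]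
    exact ((h t ht).hasDerivWithinAt_space hN hb hV).const_mul _

end TwoPhaseStokes

theorem mainTheorem5 {d : ℕ} (hd : d = 2 ∨ d = 3)
    (Ω : Set (TwoPhaseStokes.Vec d)) (hΩ_open : IsOpen Ω) (hΩ_conn : IsConnected Ω)
    (γ μp μm T : ℝ) (hγ : 0 < γ) (hμp : 0 < μp) (hμm : 0 < μm) (hT : 0 < T)
    (f : ℝ → TwoPhaseStokes.Vec d → TwoPhaseStokes.Vec d)
    {K J : ℕ} (facet : Fin J → Fin d → Fin K) :
    -- semidiscrete scheme
    (∀ (F : ℝ → TwoPhaseStokes.FESpaces d Ω) (q : ℝ → Fin K → TwoPhaseStokes.Vec d)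
        (ν V u : ℝ → TwoPhaseStokes.Vec d → TwoPhaseStokes.Vec d)
        (p : ℝ → Lp ℝ 2 (volume.restrict Ω)) (κ : ℝ → TwoPhaseStokes.Vec d → ℝ),
      TwoPhaseStokes.IsSemidiscreteSolution Ω γ μp μm T f facet F q ν V u p κ →
      (∀ t ∈ Ioc 0 T, (F t).CharMem (TwoPhaseStokes.inside facet (q t)) →
        HasDerivWithinAt (fun s => volume.real (TwoPhaseStokes.inside facet (q s))) 0 (Icc 0 T) t ∧
        TwoPhaseStokes.surfaceInner facet (q t) (V t) (ν t) = 0 ∧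
        TwoPhaseStokes.lumpedInner facet (q t) (V t) (ν t) = 0 ∧
        TwoPhaseStokes.surfaceInner facet (q t) (u t) (ν t) = 0 ∧
        ∫ x in TwoPhaseStokes.inside facet (q t), TwoPhaseStokes.divergence (u t) x = 0) ∧
      ((∀ t ∈ Ioc 0 T, (F t).CharMem (TwoPhaseStokes.inside facet (q t))) →
        ∀ t ∈ Icc 0 T,
          volume (TwoPhaseStokes.inside facet (q t)) =
            volume (TwoPhaseStokes.inside facet (q 0)) ∧
          volume (Ω ∩ TwoPhaseStokes.outside facet (q t)) =
            volume (Ω ∩ TwoPhaseStokes.outside facet (q 0)))) ∧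
    -- fully discrete scheme
    (∀ (M : ℕ) (t : ℕ → ℝ), t 0 = 0 → t M = T → (∀ m < M, t m < t (m + 1)) →
      ∀ (F : ℕ → TwoPhaseStokes.FESpaces d Ω) (q : ℕ → Fin K → TwoPhaseStokes.Vec d)
        (ν X u : ℕ → TwoPhaseStokes.Vec d → TwoPhaseStokes.Vec d)
        (p : ℕ → Lp ℝ 2 (volume.restrict Ω)) (κ : ℕ → TwoPhaseStokes.Vec d → ℝ),
      TwoPhaseStokes.IsDiscreteSolution Ω γ μp μm M t f facet F q ν X u p κ →
      ∀ m < M, (F m).CharMem (TwoPhaseStokes.inside facet (q m)) →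
        TwoPhaseStokes.surfaceInner facet (q m) (u (m + 1)) (ν m) = 0 ∧
        TwoPhaseStokes.surfaceInner facet (q m) (fun x => X (m + 1) x - x) (ν m) = 0) := by
  open TwoPhaseStokes in
  obtain ⟨n, rfl⟩ : ∃ n, d = n + 1 := by
    rcases hd with rfl | rfl
    exacts [⟨1, rfl⟩, ⟨2, rfl⟩]
  refine ⟨fun F q ν V u p κ hsol => ?_, fun M t _ _ hlt F q ν X u p κ hsol m hm hchar => ?_⟩
  · have hcl : IsCompact (closure Ω) := (F 0).mesh.isCompact_closure
    have hΩb : Bornology.IsBounded Ω := hcl.isBounded.subset subset_closure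
    have hfin : volume Ω ≠ ⊤ := hΩb.measure_lt_top.ne
    have hmain : ∀ t ∈ Ioc 0 T, (F t).CharMem (inside facet (q t)) →
        HasDerivWithinAt (fun s => volume.real (inside facet (q s))) 0 (Icc 0 T) t ∧
        surfaceInner facet (q t) (V t) (ν t) = 0 ∧ lumpedInner facet (q t) (V t) (ν t) = 0 ∧
        surfaceInner facet (q t) (u t) (ν t) = 0 ∧
        ∫ x in inside facet (q t), divergence (u t) x = 0 := by
      intro t ht hchar
      have htI := Ioc_subset_Icc_self ht
      have hflux := (hsol.solves t ht).flux_eq_zero (hsol.isInterface t htI) (hsol.normal t htI)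
        hΩ_open hΩ_conn.nonempty hchar (hsol.V_mem t ht)
      refine ⟨?_, hflux⟩
      have hderiv := hasDerivWithinAt_volume_inside hd htI hsol.isInterface hΩb hsol.normal
        (hsol.V_mem t ht) (hsol.velocity t ht)
      rwa [hflux.1] at hderiv
    refine ⟨hmain, fun hchar t ht => ?_⟩
    have hcont := continuousOn_volume_inside (continuousOn_pi.2 hsol.continuous) hsol.isInterface
      hΩb hsol.normal
    -- the derivative vanishes on `(0, T]` only; at `t = 0` the volume is merely continuous
    have hreal : volume.real (inside facet (q t)) = volume.real (inside facet (q 0)) := by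
      rcases ht.1.eq_or_lt with rfl | h0t
      · rfl
      obtain ⟨s, -, hs⟩ := exists_hasDerivAt_eq_slope
        (fun s => volume.real (inside facet (q s))) (fun _ => 0) h0t
        (hcont.mono (Icc_subset_Icc_right ht.2)) fun s hs => by
          have hsT : s < T := hs.2.trans_le ht.2
          exact (hmain s ⟨hs.1, hsT.le⟩ (hchar s ⟨hs.1, hsT.le⟩)).1.hasDerivAt
            (Icc_mem_nhds hs.1 hsT)
      rw [eq_comm, div_eq_zero_iff] at hs
      rcases hs with hs | hs <;> linarith
    have hI := hsol.isInterface t ht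
    have hI0 := hsol.isInterface 0 ⟨le_rfl, hT.le⟩
    have hvol : volume (inside facet (q t)) = volume (inside facet (q 0)) :=
      (measureReal_eq_measureReal_iff (measure_ne_top_of_subset hI.inside_subset hfin)
        (measure_ne_top_of_subset hI0.inside_subset hfin)).1 hreal
    exact ⟨hvol, by rw [hI.volume_outside hfin, hI0.volume_outside hfin, hvol]⟩
  · have hs := hsol.solves m hm
    have hXm : MemSurfaceP1 facet (q m) fun x => X (m + 1) x - x := hs.X_mem.sub memSurfaceP1_id
    have hflux := hs.flux_eq_zero (hsol.isInterface m hm) (hsol.normal m hm) hΩ_open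
      hΩ_conn.nonempty hchar (hXm.const_smul _)
    refine ⟨hflux.2.2.1, ?_⟩
    have h1 := hflux.1
    rw [surfaceInner_const_smul] at h1
    exact (mul_eq_zero.1 h1).resolve_left (inv_ne_zero (sub_pos.2 (hlt m hm)).ne')
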